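/- **Setting.** Let $d\in\mathbb N$, $1\le p\le 2$, let $\|\cdot\|=\|\cdot\|_p$ on $\mathbb R^d$ with conjugate norm $\|\cdot\|_*$, and let $\mathcal X\subset\mathbb R^d$ be compact and convex. Let $\omega$ be finite, lower semicontinuous and $1$-strongly convex with respect to $\|\cdot\|$ on $\mathcal X$, let $\mathcal X^\circ=\{x\in\mathcal X:\partial\omega(x)\neq\emptyset\}$ (with $\omega=+\infty$ outside $\mathcal X$), and let $\omega'$ be a continuous selection of subgradients of $\omega$ on $\mathcal X^\circ$. Put $V(x,y)=\omega(y)-\omega(x)-\langle\omega'(x),y-x\rangle$, $P_x(\xi)=\arg\min_{y\in\mathcal X}\{V(x,y)+\langle\xi,y\rangle\}$ and $D^2=\sup_{x\in\mathcal X^\circ,\,y\in\mathcal X}V(x,y)<\infty$, $D\ge0$. Let $(Z_n)_{n\ge0}$ be a stationary Markov chain on a complete separable metric space $\mathsf Z$ with kernel $Q$ and invariant distribution $\pi$, uniformly geometrically ergodic with mixing time $\tau_{\rm mix}\in\mathbb N$, $\tau_{\rm mix}\ge1$: for some $c$, $|Q^t(z_0,A)-\pi(A)|\le c\,(1/2)^{t/\tau_{\rm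 mix}}$ for all $t>0$, all $z_0\in\mathsf Z$ and all Borel sets $A$. Let $F:\mathcal X\to\mathbb R^d$ be monotone on $\mathcal X$ and $L$-Lipschitz, $\|F(x)-F(y)\|_*\le L\|x-y\|$, with $L>0$. Let the (jointly measurable) oracle $F(x,Z)$ satisfy, for every $x\in\mathcal X$, $\mathbb E_\pi[F(x,Z)]=F(x)$ and $\|F(x,z)-F(x)\|_*^2\le\sigma^2$ for all $z\in\mathsf Z$, where $\sigma\ge0$. Let $\mathrm{Err}_{\rm VI}(x)=\max_{u\in\mathcal X}\langle F(u),x-u\rangle$. **Algorithm (Markovian Mirror-Prox with batching).** Let $J_0,J_1,\dots$ be independent of each other and of $(Z_n)$, with $\mathbb P\{J_t=i\}=2^{-i}$ for $i\ge1$. Start at $x^0\in\mathcal X^\circ$, $N_0=0$. For $t=0,1,\dots,T$ put $$x^{t+1/2}=P_{x^t}\Big(\gamma B^{-1}\sum_{i=1}^BF(x^t,Z_{N_t+i})\Big),\qquad N_{t+1/2}=N_t+B,$$ $$g^t=g^t_0+\begin{cases}2^{J_t}(g^t_{J_t}-g^t_{J_t-1}),&2^{J_t}\le M,\\0,&\text{otherwise,}\end{cases}\qquad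 g^t_j=2^{-j}B^{-1}\sum_{i=1}^{2^jB}F(x^{t+1/2},Z_{N_{t+1/2}+i}),$$ $$x^{t+1}=P_{x^t}(\gamma g^t),\qquad N_{t+1}=N_{t+1/2}+2^{J_t}B.$$ The output is $\widehat x^T=\frac1T\sum_{t=0}^{T-1}x^{t+1/2}$. The oracle calls of iteration $t$ are the $B$ evaluations for $x^{t+1/2}$ together with the evaluations needed for $g^t$, which are $2^{J_t}B$ in number if $2^{J_t}\le M$ and $B$ otherwise. **Corollary.** Take $\gamma=\min\big\{\frac1{2L},\frac{D}{T^{1/2}\sigma\tau_{\rm mix}^{1/2}}\big\}$ (the second term being $+\infty$ if $\sigma=0$), $M=T$ and $B=1$. Then, in order to achieve $\mathbb E[\mathrm{Err}_{\rm VI}(\widehat x^T)]\le\varepsilon$, the algorithm takes $$\widetilde{\mathcal O}\Big(\max\Big\{\frac{LD^2}{\varepsilon},\frac{\tau_{\rm mix}D^2\sigma^2}{\varepsilon^2}\Big\}\Big)$$ iterations, and as many oracle calls in expectation. Precisely: there are $C>0$ and $k\in\mathbb N$ depending only on $c$ such that for all data as above and every $\varepsilon>0$, with $R=\max\{LD^2/\varepsilon,\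 \tau_{\rm mix}D^2\sigma^2/\varepsilon^2\}$ and $\Lambda=\log(R+3)$ if $p=2$, $\Lambda=\log(R+3)\log(d+3)$ if $p<2$, there is an integer $T_0\ge1$ with $$T_0\le C\Lambda^k\max\{1,R\},$$ such that the expected number of oracle calls made in iterations $0,\dots,T_0$ of the algorithm run with $T=T_0$ is at most $C\Lambda^k\max\{1,R\}$, and such that for every $T\ge T_0$, with $\gamma$, $M$, $B$ chosen as above for this $T$, $\mathrm{Err}_{\rm VI}(\widehat x^T)$ is integrable and $\mathbb E[\mathrm{Err}_{\rm VI}(\widehat x^T)]\le\varepsilon$. -/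

import Mathlib

open MeasureTheory ProbabilityTheory
open scoped ENNReal

namespace MarkovMirrorProx

noncomputable section

/-! ### Bregman divergence and prox mapping

`E` is the primal space and `StrongDual ℝ E` its dual; the norm of `StrongDual ℝ E` is the
conjugate norm `‖ξ‖_* = sup {ξ z | ‖z‖ ≤ 1}`, and `ξ z` is the pairing `⟨ξ, z⟩`. -/

section Prox

variable {E : Type*} [NormedAddCommGroup E] [NormedSpace ℝ E]

/-- `ξ` is a subgradient at `x` of the function equal to `ω` on `X` and to `+∞` outside `X`. -/
def IsSubgradientOn (X : Set E) (ω : E → ℝ) (x : E) (ξ : StrongDual ℝ E) : Prop :=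
  ∀ y ∈ X, ω x + ξ (y - x) ≤ ω y

/-- The points of `X` at which the subdifferential of `ω` (on `X`) is non-empty. -/
def subdiffDomain (X : Set E) (ω : E → ℝ) : Set E :=
  {x | x ∈ X ∧ ∃ ξ, IsSubgradientOn X ω x ξ}

/-- `ω` is a distance-generating function on `X` with selection `ω'` of subgradients: `ω` is
lower semicontinuous and `1`-strongly convex on `X` for the norm of `E`, and `ω'` is a continuous
selection of its subgradients. -/
structure IsDistanceGenerating (X : Set E) (ω : E → ℝ) (ω' : E → StrongDual ℝ E) : Prop where
  lsc : LowerSemicontinuousOn ω X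
  strongConvex : StrongConvexOn X 1 ω
  subgradient : ∀ x ∈ subdiffDomain X ω, IsSubgradientOn X ω x (ω' x)
  continuousOn : ContinuousOn ω' (subdiffDomain X ω)

/-- The Bregman divergence `V(x, y) = ω(y) - ω(x) - ⟨ω'(x), y - x⟩`. -/
def bregman (ω : E → ℝ) (ω' : E → StrongDual ℝ E) (x y : E) : ℝ :=
  ω y - ω x - ω' x (y - x)

/-- The set of values `V(x, y)`, `x, y ∈ X` (with `∂ω(x)` non-empty, so that `V(x, y)` is
defined). -/
def bregmanValues (X : Set E) (ω : E → ℝ) (ω' : E → StrongDual ℝ E) : Set ℝ :=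
  {v | ∃ x ∈ subdiffDomain X ω, ∃ y ∈ X, v = bregman ω ω' x y}

/-- The prox mapping `P_x(ξ) = argmin_{y ∈ X} (V(x, y) + ⟨ξ, y⟩)`. -/
def prox (X : Set E) (ω : E → ℝ) (ω' : E → StrongDual ℝ E) (x : E) (ξ : StrongDual ℝ E) : E :=
  Classical.epsilon fun y => y ∈ X ∧ IsMinOn (fun u => bregman ω ω' x u + ξ u) X y

/-- The merit function `Err_VI(x) = max_{u ∈ X} ⟨F(u), x - u⟩` of the variational inequality. -/
def errVI (X : Set E) (F : E → StrongDual ℝ E) (x : E) : ℝ :=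
  sSup ((fun u => F u (x - u)) '' X)

end Prox

/-! ### The noise -/

section Noise

variable {S Ω : Type*} [MeasurableSpace S] [MeasurableSpace Ω]

/-- `Q` has invariant distribution `π` and is uniformly geometrically ergodic with mixing time
`τ` and constant `c`: in `t` steps the chain comes, from any initial state, within
`c * (1/2) ^ (t/τ)` of `π` in total variation. (So `π` is the unique invariant distribution.) -/
structure IsUniformlyErgodic (Q : Kernel S S) (π : Measure S) (τ : ℕ) (c : ℝ) : Prop where
  invariant : Kernel.Invariant Q π
  mixing : ∀ t : ℕ, 0 < t → ∀ z₀ : S, ∀ A : Set S, MeasurableSet A →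
    |((Q ^ t) z₀).real A - π.real A| ≤ c * (1 / 2 : ℝ) ^ ((t : ℝ) / (τ : ℝ))

/-- `Z` is a Markov chain with transition kernel `Q` and initial distribution `π` under `P`. -/
structure IsMarkovChain (Q : Kernel S S) (π : Measure S) (P : Measure Ω) (Z : ℕ → Ω → S) :
    Prop where
  measurable : ∀ n, Measurable (Z n)
  initial : HasLaw (Z 0) π P
  transition : ∀ n, HasCondDistrib (Z (n + 1)) (fun w (i : Fin (n + 1)) => Z i w)
    (Q.comap (fun h : Fin (n + 1) → S => h (Fin.last n)) (measurable_pi_apply _)) P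

/-- The `J t` are independent, each geometrically distributed with parameter `1/2` on
`{1, 2, 3, …}`. -/
structure IsIIDGeomHalf (P : Measure Ω) (J : ℕ → Ω → ℕ) : Prop where
  measurable : ∀ t, Measurable (J t)
  indep : iIndepFun J P
  law : ∀ t i : ℕ, 1 ≤ i → P.real {w | J t w = i} = (1 / 2 : ℝ) ^ i

end Noise

/-! ### The algorithm, along one realization `z` of the noise and `j` of the batch levels -/

section Algorithm

variable {E S : Type*} [NormedAddCommGroup E] [NormedSpace ℝ E]

/-- The mean `n⁻¹ ∑_{i=1}^n G(x, z_{N+i})` of `n` consecutive oracle answers. -/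
def oracleMean (G : E → S → StrongDual ℝ E) (z : ℕ → S) (x : E) (N n : ℕ) : StrongDual ℝ E :=
  (n : ℝ)⁻¹ • ∑ i ∈ Finset.Icc 1 n, G x (z (N + i))

/-- The estimator `g = g_0 + 2^j (g_j - g_{j-1})` if `2^j ≤ M`, and `g = g_0` otherwise, where
`g_i = 2^{-i} B⁻¹ ∑_{l=1}^{2^i B} G(x, z_{N+l})`. -/
def multilevelEstimator (G : E → S → StrongDual ℝ E) (z : ℕ → S) (B M : ℕ) (x : E) (N j : ℕ) :
    StrongDual ℝ E :=
  oracleMean G z x N B +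
    if 2 ^ j ≤ M then
      (2 : ℝ) ^ j • (oracleMean G z x N (2 ^ j * B) - oracleMean G z x N (2 ^ (j - 1) * B))
    else 0

/-- The half step `x^{t+1/2}`, from the state `s = (x^t, N_t)`. -/
def mmpHalf (X : Set E) (ω : E → ℝ) (ω' : E → StrongDual ℝ E) (G : E → S → StrongDual ℝ E)
    (γ : ℝ) (B : ℕ) (z : ℕ → S) (s : E × ℕ) : E :=
  prox X ω ω' s.1 (γ • oracleMean G z s.1 s.2 B)

/-- The state `(x^t, N_t)` of Markovian Mirror-Prox with batching, started at `(x⁰, 0)`. -/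
def mmpState (X : Set E) (ω : E → ℝ) (ω' : E → StrongDual ℝ E) (G : E → S → StrongDual ℝ E)
    (γ : ℝ) (B M : ℕ) (x₀ : E) (z : ℕ → S) (j : ℕ → ℕ) : ℕ → E × ℕ
  | 0 => (x₀, 0)
  | t + 1 =>
    let s := mmpState X ω ω' G γ B M x₀ z j t
    (prox X ω ω' s.1
        (γ • multilevelEstimator G z B M (mmpHalf X ω ω' G γ B z s) (s.2 + B) (j t)),
      s.2 + B + 2 ^ j t * B)

/-- The output `T⁻¹ ∑_{t=0}^{T-1} x^{t+1/2}` of the algorithm. -/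
def mmpOutput (X : Set E) (ω : E → ℝ) (ω' : E → StrongDual ℝ E) (G : E → S → StrongDual ℝ E)
    (γ : ℝ) (B M : ℕ) (x₀ : E) (z : ℕ → S) (j : ℕ → ℕ) (T : ℕ) : E :=
  (T : ℝ)⁻¹ • ∑ t ∈ Finset.range T,
    mmpHalf X ω ω' G γ B z (mmpState X ω ω' G γ B M x₀ z j t)

/-- The number of oracle calls (evaluations of `G(x, z_i)`) in iterations `t = 0, …, T`:
`B` for the half step, and for the full step `2^{j_t} B` if `2^{j_t} ≤ M` and `B` otherwise
(only `g_0` is needed then). -/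
def oracleCalls (B M : ℕ) (j : ℕ → ℕ) (T : ℕ) : ℕ :=
  ∑ t ∈ Finset.range (T + 1), (B + if 2 ^ j t ≤ M then 2 ^ j t * B else B)

/-- The stepsize `min {1/(2L), D/(T^{1/2} σ τ^{1/2})}`; the second term is `+∞` if `σ = 0`. -/
def stepsize (L D σ : ℝ) (τ T : ℕ) : ℝ :=
  if σ = 0 then 1 / (2 * L)
  else min (1 / (2 * L)) (D / (Real.sqrt T * σ * Real.sqrt τ))

end Algorithm

/-- The complexity `max {L D² / ε, τ D² σ² / ε²}`. -/
def complexity (L D σ ε : ℝ) (τ : ℕ) : ℝ :=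
  max (L * D ^ 2 / ε) (τ * D ^ 2 * σ ^ 2 / ε ^ 2)

/-- The logarithmic factor hidden in `Õ(R)`: `log (R + 3)`, times `log (d + 3)` in the
non-Euclidean case `p ≠ 2`. -/
def logFactor (p : ℝ≥0∞) (d : ℕ) (R : ℝ) : ℝ :=
  Real.log (R + 3) * if p = 2 then 1 else Real.log (d + 3)

end

end MarkovMirrorProx

/-! Fix the levels and a path of the chain. Let `y_t` be the half step, `g_t` the multilevel
estimator and `e_t = F(y_t) - g_t`. An extragradient step bounds `γ g_t(y_t - u)` by a telescoping
Bregman difference plus a multiple of `γ² ‖g_t - g₀‖²`, where `g₀` drives the half step. It remains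
to control `e_t(y_t - u)`, where the maximizing `u` depends on the whole path. This pairing is split
at a ghost point `w_t`, produced by mirror descent driven by the errors themselves: `e_t(w_t - u)`
telescopes pathwise, and `e_t(y_t - w_t)` does not involve `u`. By monotonicity the merit function
is then at most `2D²/(Tγ)` plus averages of `γ ‖e_t‖²`, `γ σ²` and `e_t(y_t - w_t)`
(`IsValid.errVI_output_le`).

Once the levels are fixed, the times `N_t` are deterministic, `y_t` and `w_t` depend on the states
up to `N_t + 1`, and `g_t` at the given point `y_t` reads only later states. Ergodicity enters
through `IsDecorrelating`: a bounded function of the past and of the state `t` steps later, centred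
in that state, has mean `O(ρ t)`, where the sums of `ρ` are at most `4|c|τ`. So the mean of `2^k`
oracle answers has bias `O(τσ/2^k)` and second moment `O(Kτσ²/2^k)`. The second moment is measured
in the conjugate norm, which need not be Euclidean. It is bounded by following a potential with
`K`-Lipschitz gradient along the partial sums and telescoping that gradient
(`IsDecorrelating.integral_norm_noiseSum_sq_le`). The potential is a regularized squared `ℓ^r` norm
with `r = O(log d)`, or `r = 2` if `p = 2`.

Level `k` has probability `2^{-k}` and weight `2^k`. Hence the expectation of the estimator
telescopes to that of the highest admissible level, whose bias is `O(τσ/M)`. Each of the `log₂ M`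
levels adds `O(Kτσ²)` to the second moment and one expected oracle call. With `M = T` and the given
stepsize the error is `LD²/T` plus `√(τD²σ²/T)` up to logarithms, and `T` of order `Λ^8 max(1, R)`
suffices. -/

namespace MarkovMirrorProx

open Filter Topology

/-! ### Geometry of the prox mapping and of the Bregman divergence. -/

section ProxGeometry

variable {E : Type*} [NormedAddCommGroup E] [NormedSpace ℝ E]
  {X : Set E} {ω : E → ℝ} {ω' : E → StrongDual ℝ E}

/-- The minimizer over `X` of `ω - η`, that is, the gradient at `η` of the convex conjugate of
`ω` on `X`. -/
noncomputable def tiltedMin (X : Set E) (ω : E → ℝ) (η : StrongDual ℝ E) : E :=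
  Classical.epsilon fun y => y ∈ X ∧ IsMinOn (fun u => ω u - η u) X y

/-- The two objectives differ by a constant. The prox thus depends on `x` only through `ω' x - ξ`,
so its continuity and measurability reduce to those of one map on the dual. -/
lemma prox_eq_tiltedMin (X : Set E) (ω : E → ℝ) (ω' : E → StrongDual ℝ E) (x : E)
    (ξ : StrongDual ℝ E) : prox X ω ω' x ξ = tiltedMin X ω (ω' x - ξ) := by
  unfold prox tiltedMin
  congr 1
  funext y
  simp only [isMinOn_iff, bregman, sub_apply, map_sub, eq_iff_iff]
  refine and_congr_right fun _ => forall₂_congr fun u _ => ?_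
  constructor <;> intro h <;> linarith

lemma tiltedMin_spec (hX : IsCompact X) (hne : X.Nonempty) (hω : LowerSemicontinuousOn ω X)
    (η : StrongDual ℝ E) :
    tiltedMin X ω η ∈ X ∧ IsMinOn (fun u => ω u - η u) X (tiltedMin X ω η) := by
  refine Classical.epsilon_spec (p := fun y => y ∈ X ∧ IsMinOn (fun u => ω u - η u) X y) ?_
  have : LowerSemicontinuousOn (fun u => ω u + (-η u)) X :=
    hω.add (η.continuous.neg.continuousOn.lowerSemicontinuousOn)
  obtain ⟨y, hy, hmin⟩ := this.exists_isMinOn hne hX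
  exact ⟨y, hy, by simpa only [sub_eq_add_neg] using hmin⟩

lemma tiltedMin_mem (hX : IsCompact X) (hne : X.Nonempty) (hω : LowerSemicontinuousOn ω X)
    (η : StrongDual ℝ E) : tiltedMin X ω η ∈ X :=
  (tiltedMin_spec hX hne hω η).1

lemma isSubgradientOn_tiltedMin (hX : IsCompact X) (hne : X.Nonempty)
    (hω : LowerSemicontinuousOn ω X) (η : StrongDual ℝ E) :
    IsSubgradientOn X ω (tiltedMin X ω η) η := by
  intro u hu
  have := isMinOn_iff.1 (tiltedMin_spec hX hne hω η).2 u hu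
  simp only [map_sub]
  linarith

lemma tiltedMin_mem_subdiffDomain (hX : IsCompact X) (hne : X.Nonempty)
    (hω : LowerSemicontinuousOn ω X) (η : StrongDual ℝ E) :
    tiltedMin X ω η ∈ subdiffDomain X ω :=
  ⟨tiltedMin_mem hX hne hω η, η, isSubgradientOn_tiltedMin hX hne hω η⟩

lemma half_mul_le_of_forall {a b : ℝ} (h : ∀ s : ℝ, 0 < s → s < 1 → (1 - s) / 2 * a ≤ b) :
    1 / 2 * a ≤ b := by
  have h1 : Tendsto (fun s : ℝ => (1 - s) / 2 * a) (𝓝[>] 0) (𝓝 ((1 - 0) / 2 * a)) := by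
    apply Tendsto.mono_left _ nhdsWithin_le_nhds
    exact Continuous.tendsto (by fun_prop) 0
  have h2 := le_of_tendsto h1 (b := b) (by
    filter_upwards [Ioo_mem_nhdsGT (zero_lt_one' ℝ)] with s hs using h s hs.1 hs.2)
  simpa using h2

/-- Compare the subgradient inequality at `x + s(u - x)` with strong convexity along the segment,
divide by `s` and let `s → 0`. -/
lemma IsSubgradientOn.add_sq_le (hω : StrongConvexOn X 1 ω) {x : E} {ξ : StrongDual ℝ E}
    (h : IsSubgradientOn X ω x ξ) (hx : x ∈ X) {u : E} (hu : u ∈ X) :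
    ω x + ξ (u - x) + 1 / 2 * ‖u - x‖ ^ 2 ≤ ω u := by
  have key : 1 / 2 * ‖u - x‖ ^ 2 ≤ ω u - ω x - ξ (u - x) := by
    refine half_mul_le_of_forall fun s hs hs1 => ?_
    have h1 := hω.2 hx hu (show 0 ≤ 1 - s by linarith) hs.le (by ring)
    have hmem := hω.1 hx hu (show 0 ≤ 1 - s by linarith) hs.le (by ring)
    have h2 := h _ hmem
    have e : (1 - s) • x + s • u - x = s • (u - x) := by module
    rw [e, map_smul, smul_eq_mul] at h2
    rw [norm_sub_rev] at h1
    simp only [smul_eq_mul] at h1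
    have h3 : s * ((1 - s) / 2 * ‖u - x‖ ^ 2) ≤ s * (ω u - ω x - ξ (u - x)) := by nlinarith
    exact le_of_mul_le_mul_left h3 hs
  linarith

/-- Adding the two subgradient inequalities with their quadratic gains gives `‖y - y₂‖² ≤ (η - η₂)(y
- y₂)`. -/
lemma tiltedMin_lipschitz (hX : IsCompact X) (hne : X.Nonempty) (hω : LowerSemicontinuousOn ω X)
    (hc : StrongConvexOn X 1 ω) : LipschitzWith 1 (tiltedMin X ω) := by
  refine LipschitzWith.of_dist_le_mul fun η η₂ => ?_
  rw [NNReal.coe_one, one_mul, dist_eq_norm, dist_eq_norm]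
  set y := tiltedMin X ω η
  set y₂ := tiltedMin X ω η₂
  have hy := tiltedMin_mem hX hne hω η
  have hy₂ := tiltedMin_mem hX hne hω η₂
  have h1 := (isSubgradientOn_tiltedMin hX hne hω η).add_sq_le hc hy hy₂
  have h2 := (isSubgradientOn_tiltedMin hX hne hω η₂).add_sq_le hc hy₂ hy
  have h3 : (η - η₂) (y - y₂) ≤ ‖η - η₂‖ * ‖y - y₂‖ :=
    (le_abs_self _).trans ((η - η₂).le_opNorm _)
  change ω y + η (y₂ - y) + 1 / 2 * ‖y₂ - y‖ ^ 2 ≤ ω y₂ at h1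
  change ω y₂ + η₂ (y - y₂) + 1 / 2 * ‖y - y₂‖ ^ 2 ≤ ω y at h2
  rw [norm_sub_rev] at h1
  simp only [map_sub, sub_apply] at h1 h2 h3
  by_contra hlt
  push Not at hlt
  nlinarith [norm_nonneg (η - η₂)]

lemma half_sq_le_bregman (hω : IsDistanceGenerating X ω ω') {x : E} (hx : x ∈ subdiffDomain X ω)
    {y : E} (hy : y ∈ X) : 1 / 2 * ‖x - y‖ ^ 2 ≤ bregman ω ω' x y := by
  have := (hω.subgradient x hx).add_sq_le hω.strongConvex hx.1 hy
  rw [norm_sub_rev] at this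
  unfold bregman
  linarith

lemma bregman_nonneg (hω : IsDistanceGenerating X ω ω') {x : E} (hx : x ∈ subdiffDomain X ω)
    {y : E} (hy : y ∈ X) : 0 ≤ bregman ω ω' x y :=
  le_trans (by positivity) (half_sq_le_bregman hω hx hy)

/-- The domain of the subdifferential is dense in `X`: the Moreau regularizations converge. -/
lemma exists_mem_subdiffDomain_norm_sub_lt [FiniteDimensional ℝ E] (hX : IsCompact X)
    (hc : Convex ℝ X) (hω : LowerSemicontinuousOn ω X) (hconv : ConvexOn ℝ X ω) {u : E}
    (hu : u ∈ X) {r : ℝ} (hr : 0 < r) : ∃ v ∈ subdiffDomain X ω, ‖v - u‖ < r := by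
  let e := toEuclidean (E := E)
  obtain ⟨m, hm, hmin⟩ := hω.exists_isMinOn ⟨u, hu⟩ hX
  rw [isMinOn_iff] at hmin
  obtain ⟨C, hC0, hC⟩ : ∃ C : ℝ, 0 < C ∧ ∀ v, ‖v‖ ≤ C * ‖e v‖ := by
    refine ⟨‖(e.symm : EuclideanSpace ℝ (Fin (Module.finrank ℝ E)) →L[ℝ] E)‖ + 1, by positivity, fun v => ?_⟩
    have := (e.symm : EuclideanSpace ℝ (Fin (Module.finrank ℝ E)) →L[ℝ] E).le_opNorm (e v)
    simp only [ContinuousLinearEquiv.coe_coe, ContinuousLinearEquiv.symm_apply_apply] at this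
    nlinarith [norm_nonneg (e v)]
  -- The penalty weight is large enough that the minimizer `v` of `ω + n ‖e · - e u‖²` satisfies `n
  -- ‖e v - e u‖² ≤ ω u - ω m < n (r/C)²`. The Euclidean norm is used because its square is
  -- differentiable; `C` converts back.
  obtain ⟨n, hn0, hn⟩ : ∃ n : ℝ, 0 < n ∧ ω u - ω m < n * (r / C) ^ 2 := by
    refine ⟨(ω u - ω m + 1) / (r / C) ^ 2, ?_, ?_⟩
    · have := hmin u hu
      positivity
    · rw [div_mul_cancel₀ _ (by positivity)]
      linarith
  have hlsc : LowerSemicontinuousOn (fun v => ω v + n * ‖e v - e u‖ ^ 2) X :=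
    hω.add (Continuous.continuousOn (by fun_prop)).lowerSemicontinuousOn
  obtain ⟨v, hv, hvmin⟩ := hlsc.exists_isMinOn ⟨u, hu⟩ hX
  rw [isMinOn_iff] at hvmin
  refine ⟨v, ⟨hv, ?_⟩, ?_⟩
  · let ξ : StrongDual ℝ E :=
      (-(2 * n)) • (innerSL ℝ (e v - e u)).comp (e : E →L[ℝ] EuclideanSpace ℝ _)
    refine ⟨ξ, fun w hw => ?_⟩
    have hξ : ξ (w - v) = -(2 * n) * inner ℝ (e v - e u) (e w - e v) := by
      rw [← map_sub e w v]
      rfl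
    rw [hξ]
    have key : ∀ s : ℝ, 0 < s → s < 1 → ω v - 2 * n * inner ℝ (e v - e u) (e w - e v)
        ≤ ω w + s * (n * ‖e w - e v‖ ^ 2) := by
      intro s hs hs1
      have h1 := hconv.2 hv hw (show 0 ≤ 1 - s by linarith) hs.le (by ring)
      have h2 := hvmin _ (hc hv hw (show 0 ≤ 1 - s by linarith) hs.le (by ring))
      simp only [map_add, map_smul] at h2
      have e1 : (1 - s) • e v + s • e w - e u = (e v - e u) + s • (e w - e v) := by module
      rw [e1, norm_add_sq_real, inner_smul_right, norm_smul, mul_pow, Real.norm_eq_abs,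
        sq_abs] at h2
      simp only [smul_eq_mul] at h1
      have h3 : s * (ω v - 2 * n * inner ℝ (e v - e u) (e w - e v))
        ≤ s * (ω w + s * (n * ‖e w - e v‖ ^ 2)) := by nlinarith
      exact le_of_mul_le_mul_left h3 hs
    have lim : Tendsto (fun s : ℝ => ω w + s * (n * ‖e w - e v‖ ^ 2)) (𝓝[>] 0)
        (𝓝 (ω w + 0 * (n * ‖e w - e v‖ ^ 2))) := by
      apply Tendsto.mono_left _ nhdsWithin_le_nhds
      exact Continuous.tendsto (by fun_prop) 0
    have := ge_of_tendsto lim (by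
      filter_upwards [Ioo_mem_nhdsGT (zero_lt_one' ℝ)] with s hs using key s hs.1 hs.2)
    linarith
  · have h1 := hvmin u hu
    have h2 := hmin v hv
    simp only [sub_self, norm_zero, ne_eq, OfNat.ofNat_ne_zero, not_false_eq_true, zero_pow,
      mul_zero, add_zero] at h1
    have h3 : n * ‖e v - e u‖ ^ 2 < n * (r / C) ^ 2 := by linarith
    have h4 : ‖e v - e u‖ < r / C :=
      lt_of_pow_lt_pow_left₀ 2 (by positivity) (lt_of_mul_lt_mul_left h3 hn0.le)
    have h5 := hC (v - u)
    rw [map_sub] at h5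
    calc ‖v - u‖ ≤ C * ‖e v - e u‖ := h5
      _ < C * (r / C) := by gcongr
      _ = r := by field_simp

lemma IsDistanceGenerating.convexOn (hω : IsDistanceGenerating X ω ω') : ConvexOn ℝ X ω :=
  hω.strongConvex.convexOn (by intro x; simp only [Pi.zero_apply]; positivity)

/-- The continuous selection of subgradients satisfies the optimality condition at the minimizer
of a tilted function. -/
lemma IsDistanceGenerating.optimality [FiniteDimensional ℝ E] (hX : IsCompact X)
    (hω : IsDistanceGenerating X ω ω') (η : StrongDual ℝ E) {u : E} (hu : u ∈ X) :
    0 ≤ (ω' (tiltedMin X ω η) - η) (u - tiltedMin X ω η) := by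
  have hne : X.Nonempty := ⟨u, hu⟩
  set y := tiltedMin X ω η with hydef
  have hyX : y ∈ X := tiltedMin_mem hX hne hω.lsc η
  have hyD : y ∈ subdiffDomain X ω := tiltedMin_mem_subdiffDomain hX hne hω.lsc η
  have hsub : IsSubgradientOn X ω y η := isSubgradientOn_tiltedMin hX hne hω.lsc η
  have hc := hω.strongConvex.1
  -- At `y` the selection `ω'` may differ from the subgradient `η`, so minimality alone does not
  -- suffice. Take points `w n` of the domain close to `y + (u - y)/(n+1)`. Monotonicity of
  -- subgradients gives `(ω' (w n) - η)(w n - y) ≥ 0`; multiply by `n + 1` and pass to the limit by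
  -- continuity of `ω'`. The tolerance `1/(n+1)²` survives this rescaling.
  have hs : ∀ n : ℕ, ∃ w ∈ subdiffDomain X ω,
      ‖w - (y + (1 / ((n : ℝ) + 1)) • (u - y))‖ < (1 / ((n : ℝ) + 1)) ^ 2 := fun n => by
    refine exists_mem_subdiffDomain_norm_sub_lt hX hc hω.lsc hω.convexOn ?_ (by positivity)
    have hle : 1 / ((n : ℝ) + 1) ≤ 1 := by
      rw [div_le_one (by positivity)]; linarith [n.cast_nonneg (α := ℝ)]
    exact hc.add_smul_sub_mem hyX hu ⟨by positivity, hle⟩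
  choose w hwD hw using hs
  have hpos : ∀ n : ℕ, 0 ≤ (ω' (w n) - η) (((n : ℝ) + 1) • (w n - y)) := fun n => by
    have h1 := hω.subgradient _ (hwD n) y hyX
    have h2 := hsub _ (hwD n).1
    rw [map_smul, smul_eq_mul]
    refine mul_nonneg (by positivity) ?_
    simp only [map_sub, sub_apply] at h1 h2 ⊢
    linarith
  have hlim0 := tendsto_one_div_add_atTop_nhds_zero_nat (𝕜 := ℝ)
  have hdir : Tendsto (fun n : ℕ => ((n : ℝ) + 1) • (w n - y)) atTop (𝓝 (u - y)) := by
    rw [tendsto_iff_norm_sub_tendsto_zero]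
    refine squeeze_zero (fun _ => norm_nonneg _) (fun n => ?_) hlim0
    have hn : (0 : ℝ) < (n : ℝ) + 1 := by positivity
    have e : ((n : ℝ) + 1) • (w n - y) - (u - y)
        = ((n : ℝ) + 1) • (w n - (y + (1 / ((n : ℝ) + 1)) • (u - y))) := by
      rw [← sub_sub, smul_sub _ (w n - y), smul_smul, mul_one_div_cancel hn.ne', one_smul]
    rw [e, norm_smul, Real.norm_of_nonneg hn.le]
    calc ((n : ℝ) + 1) * _ ≤ ((n : ℝ) + 1) * (1 / ((n : ℝ) + 1)) ^ 2 := by gcongr; exact (hw n).le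
      _ = 1 / ((n : ℝ) + 1) := by field_simp
  have hwy : Tendsto w atTop (𝓝 y) := by
    have : Tendsto (fun n : ℕ => y + (1 / ((n : ℝ) + 1)) • (((n : ℝ) + 1) • (w n - y))) atTop
        (𝓝 (y + (0 : ℝ) • (u - y))) := tendsto_const_nhds.add (hlim0.smul hdir)
    simp only [zero_smul, add_zero] at this
    refine this.congr fun n => ?_
    have hn : (n : ℝ) + 1 ≠ 0 := by positivity
    rw [smul_smul, one_div_mul_cancel hn, one_smul]
    abel
  have hω'lim : Tendsto (fun n => ω' (w n)) atTop (𝓝 (ω' y)) :=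
    (hω.continuousOn y hyD).tendsto.comp
      (tendsto_nhdsWithin_iff.2 ⟨hwy, Eventually.of_forall hwD⟩)
  have hfin : Tendsto (fun n : ℕ => (ω' (w n) - η) (((n : ℝ) + 1) • (w n - y))) atTop
      (𝓝 ((ω' y - η) (u - y))) := 
    ((isBoundedBilinearMap_apply (𝕜 := ℝ) (E := E) (F := ℝ)).continuous.tendsto
      (ω' y - η, u - y)).comp ((hω'lim.sub_const η).prodMk_nhds hdir)
  exact ge_of_tendsto hfin (Eventually.of_forall hpos)

lemma prox_mem_subdiffDomain (hX : IsCompact X) (hne : X.Nonempty)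
    (hω : IsDistanceGenerating X ω ω') (x : E) (ξ : StrongDual ℝ E) :
    prox X ω ω' x ξ ∈ subdiffDomain X ω := by
  rw [prox_eq_tiltedMin]
  exact tiltedMin_mem_subdiffDomain hX hne hω.lsc _

/-- The three-point identity of the Bregman divergence turns the optimality condition into this
form. -/
lemma prox_inequality [FiniteDimensional ℝ E] (hX : IsCompact X)
    (hω : IsDistanceGenerating X ω ω') (x : E) (ξ : StrongDual ℝ E) {u : E} (hu : u ∈ X) :
    ξ (prox X ω ω' x ξ - u) ≤ bregman ω ω' x u - bregman ω ω' (prox X ω ω' x ξ) u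
      - bregman ω ω' x (prox X ω ω' x ξ) := by
  have h := hω.optimality hX (ω' x - ξ) hu
  rw [← prox_eq_tiltedMin X ω ω' x ξ] at h
  simp only [bregman, map_sub, sub_apply] at h ⊢
  linarith

/-- For `x` in the domain of the subdifferential, `V(x, y)` dominates half the squared distance.
Density of that domain and closedness extend the bound to all of `X`. -/
lemma norm_sub_sq_le_of_isLUB [FiniteDimensional ℝ E] (hX : IsCompact X)
    (hω : IsDistanceGenerating X ω ω') {D : ℝ} (hD : IsLUB (bregmanValues X ω ω') (D ^ 2))
    {x y : E} (hx : x ∈ X) (hy : y ∈ X) : ‖x - y‖ ^ 2 ≤ 2 * D ^ 2 := by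
  have h1 : ∀ v ∈ subdiffDomain X ω, ‖v - y‖ ^ 2 ≤ 2 * D ^ 2 := fun v hv => by
    have := half_sq_le_bregman hω hv hy
    have := hD.1 ⟨v, hv, y, hy, rfl⟩
    linarith
  have h2 : x ∈ closure (subdiffDomain X ω) := by
    rw [Metric.mem_closure_iff]
    intro r hr
    obtain ⟨v, hv, hvr⟩ := exists_mem_subdiffDomain_norm_sub_lt hX hω.strongConvex.1 hω.lsc
      hω.convexOn hx hr
    exact ⟨v, hv, by rwa [dist_comm, dist_eq_norm]⟩
  have h3 : IsClosed {v : E | ‖v - y‖ ^ 2 ≤ 2 * D ^ 2} :=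
    isClosed_le (by fun_prop) continuous_const
  exact closure_minimal (fun v hv => h1 v hv) h3 h2

end ProxGeometry

/-! ### One-step inequalities for extragradient and for the ghost sequence. -/

section Regret

variable {E : Type*} [NormedAddCommGroup E] [NormedSpace ℝ E]
  {X : Set E} {ω : E → ℝ} {ω' : E → StrongDual ℝ E}

lemma smul_apply_le_young (γ : ℝ) (ξ : StrongDual ℝ E) (v : E) :
    γ * ξ v ≤ γ ^ 2 / 2 * ‖ξ‖ ^ 2 + 1 / 2 * ‖v‖ ^ 2 := by
  have h1 : |γ * ξ v| ≤ |γ| * (‖ξ‖ * ‖v‖) := by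
    rw [abs_mul]
    gcongr
    exact ξ.le_opNorm v
  have h2 := le_abs_self (γ * ξ v)
  nlinarith [sq_nonneg (|γ| * ‖ξ‖ - ‖v‖), sq_abs γ]

/-- Apply the prox inequality to the full step against `u` and to the half step against the full
step. By Young, the mismatch `γ (g - g₀)(y - x₁)` is absorbed by `V(y, x₁)`. The gain `‖x - y‖²/2`
is kept, to pay later for the variation of `F` between `x` and `y`. -/
lemma extragradient_step [FiniteDimensional ℝ E] (hX : IsCompact X) (hω : IsDistanceGenerating X ω ω') {x : E}
    (hx : x ∈ subdiffDomain X ω) (γ : ℝ) (g₀ g : StrongDual ℝ E) {u : E} (hu : u ∈ X) :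
    γ * g (prox X ω ω' x (γ • g₀) - u) ≤
      bregman ω ω' x u - bregman ω ω' (prox X ω ω' x (γ • g)) u + γ ^ 2 / 2 * ‖g - g₀‖ ^ 2
        - 1 / 2 * ‖x - prox X ω ω' x (γ • g₀)‖ ^ 2 := by
  have hne : X.Nonempty := ⟨u, hu⟩
  set y := prox X ω ω' x (γ • g₀)
  set x₁ := prox X ω ω' x (γ • g)
  have hy : y ∈ subdiffDomain X ω := prox_mem_subdiffDomain hX hne hω _ _
  have hx₁ : x₁ ∈ subdiffDomain X ω := prox_mem_subdiffDomain hX hne hω _ _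
  have h1 := prox_inequality hX hω x (γ • g) hu
  have h2 := prox_inequality hX hω x (γ • g₀) hx₁.1
  change (γ • g) (x₁ - u) ≤ bregman ω ω' x u - bregman ω ω' x₁ u - bregman ω ω' x x₁ at h1
  change (γ • g₀) (y - x₁) ≤ bregman ω ω' x x₁ - bregman ω ω' y x₁ - bregman ω ω' x y at h2
  have h3 := half_sq_le_bregman hω hy hx₁.1
  have h4 := half_sq_le_bregman hω hx hy.1
  have h5 := smul_apply_le_young γ (g - g₀) (y - x₁)
  simp only [map_sub, sub_apply, smul_apply,
    smul_eq_mul] at h1 h2 h5 ⊢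
  nlinarith

/-- The pairing is with the old point `w`, which is chosen before `δ`; Young pays for the move to
the new point. -/
lemma ghost_step [FiniteDimensional ℝ E] (hX : IsCompact X) (hω : IsDistanceGenerating X ω ω') {w : E}
    (hw : w ∈ subdiffDomain X ω) (γ : ℝ) (δ : StrongDual ℝ E) {u : E} (hu : u ∈ X) :
    γ * δ (w - u) ≤
      bregman ω ω' w u - bregman ω ω' (prox X ω ω' w (γ • δ)) u + γ ^ 2 / 2 * ‖δ‖ ^ 2 := by
  have hne : X.Nonempty := ⟨u, hu⟩
  set y := prox X ω ω' w (γ • δ)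
  have hy : y ∈ subdiffDomain X ω := prox_mem_subdiffDomain hX hne hω _ _
  have h1 := prox_inequality hX hω w (γ • δ) hu
  change (γ • δ) (y - u) ≤ bregman ω ω' w u - bregman ω ω' y u - bregman ω ω' w y at h1
  have h3 := half_sq_le_bregman hω hw hy.1
  have h5 := smul_apply_le_young γ δ (w - y)
  simp only [map_sub, smul_apply, smul_eq_mul] at h1 h5 ⊢
  nlinarith

end Regret

/-! ### A smooth substitute for the squared `ℓ^r` norm. -/

section SmoothPotential

/-- The squared norm of `V` is dominated, up to an arbitrarily small error at the origin, by a
potential whose gradient is `K`-Lipschitz. -/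
def HasSmoothPotential (V : Type*) [NormedAddCommGroup V] [NormedSpace ℝ V] (K : ℝ) : Prop :=
  ∀ δ : ℝ, 0 < δ → ∃ (Φ : V → ℝ) (g : V → StrongDual ℝ V), Φ 0 ≤ δ ∧ g 0 = 0 ∧
    (∀ x, ‖x‖ ^ 2 ≤ Φ x) ∧ (∀ x h, Φ (x + h) ≤ Φ x + g x h + K * ‖h‖ ^ 2) ∧
    ∀ x y, ‖g x - g y‖ ≤ K * ‖x - y‖

variable {ι : Type*} [Fintype ι]

/-- The `ℓ^r` norm of a finite family of real numbers. -/
noncomputable def lrNorm (r : ℝ) (a : ι → ℝ) : ℝ := (∑ i, |a i| ^ r) ^ (1 / r)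

lemma lrNorm_nonneg (r : ℝ) (a : ι → ℝ) : 0 ≤ lrNorm r a :=
  Real.rpow_nonneg (Finset.sum_nonneg fun _ _ => by positivity) _

lemma lrNorm_rpow {r : ℝ} (hr : 0 < r) (a : ι → ℝ) : lrNorm r a ^ r = ∑ i, |a i| ^ r := by
  rw [lrNorm, ← Real.rpow_mul (Finset.sum_nonneg fun _ _ => by positivity),
    one_div_mul_cancel hr.ne', Real.rpow_one]

lemma lrNorm_smul {r : ℝ} (hr : 0 < r) (s : ℝ) (a : ι → ℝ) :
    lrNorm r (fun i => s * a i) = |s| * lrNorm r a := by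
  simp only [lrNorm, abs_mul, Real.mul_rpow (abs_nonneg _) (abs_nonneg _)]
  rw [← Finset.mul_sum, Real.mul_rpow (by positivity)
    (Finset.sum_nonneg fun _ _ => by positivity), ← Real.rpow_mul (abs_nonneg _),
    mul_one_div_cancel hr.ne', Real.rpow_one]

lemma eq_zero_of_lrNorm_eq_zero {r : ℝ} (hr : 0 < r) {a : ι → ℝ} (h : lrNorm r a = 0) (i : ι) :
    a i = 0 := by
  have h1 := lrNorm_rpow hr a
  rw [h, Real.zero_rpow hr.ne', eq_comm,
    Finset.sum_eq_zero_iff_of_nonneg fun _ _ => by positivity] at h1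
  have := h1 i (Finset.mem_univ i)
  rwa [Real.rpow_eq_zero (abs_nonneg _) hr.ne', abs_eq_zero] at this

/-- Hölder's inequality for the exponents `r / (r - 2)`, `r`, `r`. -/
lemma sum_abs_rpow_mul_mul_le {r : ℝ} (hr : 2 ≤ r) (y b c : ι → ℝ) :
    ∑ i, |y i| ^ (r - 2) * |b i| * |c i| ≤ lrNorm r y ^ (r - 2) * lrNorm r b * lrNorm r c := by
  have hr0 : 0 < r := by linarith
  rcases (lrNorm_nonneg r b).eq_or_lt with hb | hb
  · simp [← hb, eq_zero_of_lrNorm_eq_zero hr0 hb.symm]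
  rcases (lrNorm_nonneg r c).eq_or_lt with hc | hc
  · simp [← hc, eq_zero_of_lrNorm_eq_zero hr0 hc.symm]
  -- For `r = 2` the factor `|y i| ^ (r - 2)` is `1` even where `y i = 0`, so a vanishing `y` does
  -- not make the left side vanish. For `r > 2` it does, and otherwise `y` can be normalized.
  rcases hr.eq_or_lt with rfl | hr2
  · simp only [sub_self, Real.rpow_zero, one_mul]
    have := Real.inner_le_Lp_mul_Lq Finset.univ (fun i => |b i|) (fun i => |c i|)
      Real.HolderConjugate.two_two
    simpa [lrNorm] using this
  rcases (lrNorm_nonneg r y).eq_or_lt with hy | hy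
  · simp [← hy, eq_zero_of_lrNorm_eq_zero hr0 hy.symm, Real.zero_rpow (sub_pos.2 hr2).ne']
  have key : ∀ i, (|y i| / lrNorm r y) ^ (r - 2) * (|b i| / lrNorm r b) * (|c i| / lrNorm r c)
      ≤ (r - 2) / r * (|y i| ^ r / lrNorm r y ^ r) + 1 / r * (|b i| ^ r / lrNorm r b ^ r)
        + 1 / r * (|c i| ^ r / lrNorm r c ^ r) := fun i => by
    have := Real.geom_mean_le_arith_mean3_weighted (w₁ := (r - 2) / r) (w₂ := 1 / r)
      (w₃ := 1 / r) (p₁ := (|y i| / lrNorm r y) ^ r) (p₂ := (|b i| / lrNorm r b) ^ r)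
      (p₃ := (|c i| / lrNorm r c) ^ r) (div_nonneg (by linarith) hr0.le) (by positivity)
      (by positivity) (by positivity) (by positivity) (by positivity) (by field_simp; ring)
    rw [← Real.rpow_mul (by positivity), ← Real.rpow_mul (by positivity),
      ← Real.rpow_mul (by positivity), mul_div_cancel₀ _ hr0.ne', mul_one_div_cancel hr0.ne',
      Real.rpow_one, Real.rpow_one] at this
    rwa [Real.div_rpow (abs_nonneg _) hy.le r, Real.div_rpow (abs_nonneg _) hb.le r,
      Real.div_rpow (abs_nonneg _) hc.le r] at this
  have hs := Finset.sum_le_sum fun i (_ : i ∈ Finset.univ) => key i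
  simp only [Finset.sum_add_distrib, ← Finset.mul_sum, ← Finset.sum_div, ← lrNorm_rpow hr0] at hs
  rw [div_self (by positivity), div_self (by positivity), div_self (by positivity)] at hs
  have h1 : (r - 2) / r * 1 + 1 / r * 1 + 1 / r * 1 = 1 := by field_simp; ring
  rw [h1] at hs
  have hsum : ∑ i, |y i| ^ (r - 2) * |b i| * |c i|
      = lrNorm r y ^ (r - 2) * lrNorm r b * lrNorm r c *
        ∑ i, (|y i| / lrNorm r y) ^ (r - 2) * (|b i| / lrNorm r b) * (|c i| / lrNorm r c) := by
    rw [Finset.mul_sum]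
    refine Finset.sum_congr rfl fun i _ => ?_
    rw [Real.div_rpow (abs_nonneg _) hy.le]
    have : lrNorm r y ^ (r - 2) ≠ 0 := by positivity
    field_simp
  rw [hsum]
  exact mul_le_of_le_one_right (by positivity) hs

/-- The map `t ↦ |t|^(r-2) t`. -/
noncomputable def signedRpow (r t : ℝ) : ℝ := |t| ^ (r - 2) * t

lemma hasDerivAt_signedRpow {r : ℝ} (hr : 2 ≤ r) (t : ℝ) :
    HasDerivAt (signedRpow r) ((r - 1) * |t| ^ (r - 2)) t := by
  rcases hr.eq_or_lt with rfl | hr2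
  · have e : signedRpow 2 = id := by funext t; simp [signedRpow]
    rw [e]
    convert! hasDerivAt_id t using 1
    norm_num
  rcases lt_trichotomy t 0 with ht | rfl | ht
  · have h1 : HasDerivAt (fun s : ℝ => -((-s) ^ (r - 1))) ((r - 1) * |t| ^ (r - 2)) t := by
      have := ((hasDerivAt_id t).neg.rpow_const (p := r - 1) (Or.inr (by linarith))).neg
      convert! this using 1
      rw [abs_of_neg ht]
      simp only [Pi.neg_apply, id]
      rw [show r - 1 - 1 = r - 2 by ring]
      ring
    refine h1.congr_of_eventuallyEq ?_
    filter_upwards [Iio_mem_nhds ht] with s hs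
    have hs' : 0 < -s := by simpa using hs
    rw [signedRpow, abs_of_neg hs, show r - 1 = (r - 2) + 1 by ring, Real.rpow_add_one hs'.ne']
    ring
  · have h0 : (r - 1) * |(0 : ℝ)| ^ (r - 2) = 0 := by
      rw [abs_zero, Real.zero_rpow (by linarith), mul_zero]
    rw [h0, hasDerivAt_iff_tendsto_slope]
    have hc : Tendsto (fun s : ℝ => |s| ^ (r - 2)) (𝓝[≠] 0) (𝓝 0) := by
      have : Continuous fun s : ℝ => |s| ^ (r - 2) :=
        continuous_abs.rpow_const fun _ => Or.inr (by linarith)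
      have h := this.tendsto 0
      rw [abs_zero, Real.zero_rpow (by linarith)] at h
      exact h.mono_left nhdsWithin_le_nhds
    refine hc.congr' ?_
    filter_upwards [self_mem_nhdsWithin] with s hs
    have hs' : s ≠ 0 := hs
    simp [slope, signedRpow]
    field_simp
  · have h1 : HasDerivAt (fun s : ℝ => s ^ (r - 1)) ((r - 1) * |t| ^ (r - 2)) t := by
      have := (hasDerivAt_id t).rpow_const (p := r - 1) (Or.inr (by linarith))
      convert! this using 1
      rw [abs_of_pos ht]
      simp only [id]
      rw [show r - 1 - 1 = r - 2 by ring]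
      ring
    refine h1.congr_of_eventuallyEq ?_
    filter_upwards [Ioi_mem_nhds ht] with s hs
    have hs' : 0 < s := hs
    rw [signedRpow, abs_of_pos hs, show r - 1 = (r - 2) + 1 by ring, Real.rpow_add_one hs'.ne']

/-- The regularized `r`-th power of the `ℓ^r` norm. -/
noncomputable def lrPow (r δ : ℝ) (a : ι → ℝ) : ℝ := δ + ∑ i, |a i| ^ r

/-- The regularized squared `ℓ^r` norm. -/
noncomputable def lrPotential (r δ : ℝ) (a : ι → ℝ) : ℝ := lrPow r δ a ^ (2 / r)

/-- The derivative of the regularized squared `ℓ^r` norm at `a` in direction `h`. -/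
noncomputable def lrGradient (r δ : ℝ) (a h : ι → ℝ) : ℝ :=
  2 * lrPow r δ a ^ (2 / r - 1) * ∑ i, signedRpow r (a i) * h i

lemma lrPow_pos {r δ : ℝ} (hδ : 0 < δ) (a : ι → ℝ) : 0 < lrPow r δ a :=
  add_pos_of_pos_of_nonneg hδ (Finset.sum_nonneg fun _ _ => by positivity)

lemma lrNorm_rpow_le_lrPow_rpow {r δ : ℝ} (hr : 0 < r) (hδ : 0 < δ) (a : ι → ℝ) {s : ℝ}
    (hs : 0 ≤ s) : lrNorm r a ^ (r * s) ≤ lrPow r δ a ^ s := by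
  rw [Real.rpow_mul (lrNorm_nonneg _ _), lrNorm_rpow hr]
  refine Real.rpow_le_rpow (Finset.sum_nonneg fun _ _ => by positivity) ?_ hs
  unfold lrPow
  linarith

lemma lrNorm_sq_le_lrPotential {r δ : ℝ} (hr : 0 < r) (hδ : 0 < δ) (a : ι → ℝ) :
    lrNorm r a ^ 2 ≤ lrPotential r δ a := by
  have := lrNorm_rpow_le_lrPow_rpow hr hδ a (s := 2 / r) (by positivity)
  rw [mul_div_cancel₀ _ hr.ne'] at this
  exact_mod_cast this

lemma hasDerivAt_lrPow {r : ℝ} (hr : 2 ≤ r) (δ : ℝ) (a h : ι → ℝ) (t : ℝ) :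
    HasDerivAt (fun t => lrPow r δ fun i => a i + t * h i)
      (r * ∑ i, signedRpow r (a i + t * h i) * h i) t := by
  unfold lrPow
  refine HasDerivAt.const_add δ ?_
  rw [Finset.mul_sum]
  refine HasDerivAt.fun_sum fun i _ => ?_
  have h1 : HasDerivAt (fun t => a i + t * h i) (h i) t := by
    simpa using ((hasDerivAt_id t).mul_const (h i)).const_add (a i)
  have := (hasDerivAt_abs_rpow (a i + t * h i) (p := r) (by linarith)).comp t h1
  convert! this using 1
  unfold signedRpow
  ring

/-- The offset `δ` keeps the base positive, hence the power `2/r` differentiable, also at the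
origin. -/
lemma hasDerivAt_lrPotential {r δ : ℝ} (hr : 2 ≤ r) (hδ : 0 < δ) (a h : ι → ℝ) (t : ℝ) :
    HasDerivAt (fun t => lrPotential r δ fun i => a i + t * h i)
      (lrGradient r δ (fun i => a i + t * h i) h) t := by
  have := (hasDerivAt_lrPow hr δ a h t).rpow_const (p := 2 / r) (Or.inl (lrPow_pos hδ _).ne')
  unfold lrPotential lrGradient
  convert! this using 1
  have : r ≠ 0 := by linarith
  field_simp

lemma hasDerivAt_lrGradient {r δ : ℝ} (hr : 2 ≤ r) (hδ : 0 < δ) (a b c : ι → ℝ) (t : ℝ) :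
    HasDerivAt (fun t => lrGradient r δ (fun i => a i + t * b i) c)
      (2 * ((2 - r) * lrPow r δ (fun i => a i + t * b i) ^ (2 / r - 2) *
          (∑ i, signedRpow r (a i + t * b i) * b i) * (∑ i, signedRpow r (a i + t * b i) * c i)
        + (r - 1) * lrPow r δ (fun i => a i + t * b i) ^ (2 / r - 1) *
          ∑ i, |a i + t * b i| ^ (r - 2) * b i * c i)) t := by
  have h1 := (hasDerivAt_lrPow hr δ a b t).rpow_const (p := 2 / r - 1)
    (Or.inl (lrPow_pos hδ _).ne')
  have h2 : HasDerivAt (fun t => ∑ i, signedRpow r (a i + t * b i) * c i)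
      ((r - 1) * ∑ i, |a i + t * b i| ^ (r - 2) * b i * c i) t := by
    rw [Finset.mul_sum]
    refine HasDerivAt.fun_sum fun i _ => ?_
    have h1 : HasDerivAt (fun t => a i + t * b i) (b i) t := by
      simpa using ((hasDerivAt_id t).mul_const (b i)).const_add (a i)
    have := ((hasDerivAt_signedRpow hr (a i + t * b i)).comp t h1).mul_const (c i)
    convert! this using 1
    ring
  unfold lrGradient
  convert! (h1.const_mul 2).mul h2 using 1
  have : r ≠ 0 := by linarith
  rw [show 2 / r - 1 - 1 = 2 / r - 2 by ring]
  field_simp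

lemma abs_sum_signedRpow_le {r : ℝ} (hr : 2 ≤ r) (y c : ι → ℝ) :
    |∑ i, signedRpow r (y i) * c i| ≤ lrNorm r y ^ (r - 1) * lrNorm r c := by
  calc |∑ i, signedRpow r (y i) * c i| ≤ ∑ i, |signedRpow r (y i) * c i| :=
        Finset.abs_sum_le_sum_abs _ _
    _ = ∑ i, |y i| ^ (r - 2) * |y i| * |c i| := by
        refine Finset.sum_congr rfl fun i _ => ?_
        rw [signedRpow, abs_mul, abs_mul, abs_of_nonneg (Real.rpow_nonneg (abs_nonneg _) _)]
    _ ≤ lrNorm r y ^ (r - 2) * lrNorm r y * lrNorm r c := sum_abs_rpow_mul_mul_le hr y y c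
    _ = _ := by
        rcases (lrNorm_nonneg r y).eq_or_lt with hy | hy
        · rw [← hy, Real.zero_rpow (by linarith : r - 1 ≠ 0)]
          simp
        · rw [← Real.rpow_add_one hy.ne']
          ring_nf

/-- By Hölder the sums are bounded by `‖b‖_r ‖c‖_r` times powers of `‖y‖_r`. These are compensated
exactly by the negative powers of `lrPow`, which dominates `‖y‖_r ^ r`. What remains is `2((r - 2) +
(r - 1)) ≤ 4r`. -/
lemma abs_deriv_lrGradient_le {r δ : ℝ} (hr : 2 ≤ r) (hδ : 0 < δ) (y b c : ι → ℝ) :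
    |2 * ((2 - r) * lrPow r δ y ^ (2 / r - 2) *
          (∑ i, signedRpow r (y i) * b i) * (∑ i, signedRpow r (y i) * c i)
        + (r - 1) * lrPow r δ y ^ (2 / r - 1) * ∑ i, |y i| ^ (r - 2) * b i * c i)|
      ≤ 4 * r * lrNorm r b * lrNorm r c := by
  have hr0 : 0 < r := by linarith
  have hf := lrPow_pos (r := r) hδ y
  have hb := lrNorm_nonneg r b
  have hc := lrNorm_nonneg r c
  have hy := lrNorm_nonneg r y
  have hdiv : 2 / r ≤ 1 := by rw [div_le_one hr0]; exact hr
  have e1 : |∑ i, |y i| ^ (r - 2) * b i * c i|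
      ≤ lrNorm r y ^ (r - 2) * lrNorm r b * lrNorm r c := by
    refine (Finset.abs_sum_le_sum_abs _ _).trans (le_trans (le_of_eq ?_)
      (sum_abs_rpow_mul_mul_le hr y b c))
    refine Finset.sum_congr rfl fun i _ => ?_
    rw [abs_mul, abs_mul, abs_of_nonneg (Real.rpow_nonneg (abs_nonneg _) _)]
  have e2 : lrPow r δ y ^ (2 / r - 1) * lrNorm r y ^ (r - 2) ≤ 1 := by
    have := lrNorm_rpow_le_lrPow_rpow hr0 hδ y (s := 1 - 2 / r) (by linarith)
    rw [show r * (1 - 2 / r) = r - 2 by field_simp] at this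
    calc _ ≤ lrPow r δ y ^ (2 / r - 1) * lrPow r δ y ^ (1 - 2 / r) := by gcongr
      _ = 1 := by rw [← Real.rpow_add hf]; simp
  have e3 : lrPow r δ y ^ (2 / r - 2) * (lrNorm r y ^ (r - 1) * lrNorm r y ^ (r - 1)) ≤ 1 := by
    have := lrNorm_rpow_le_lrPow_rpow hr0 hδ y (s := 2 - 2 / r) (by linarith)
    rw [show r * (2 - 2 / r) = (r - 1) + (r - 1) by field_simp; ring,
      Real.rpow_add_of_nonneg hy (by linarith) (by linarith)] at this
    calc _ ≤ lrPow r δ y ^ (2 / r - 2) * lrPow r δ y ^ (2 - 2 / r) := by gcongr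
      _ = 1 := by rw [← Real.rpow_add hf]; simp
  have f1 : |(2 - r) * lrPow r δ y ^ (2 / r - 2) *
          (∑ i, signedRpow r (y i) * b i) * (∑ i, signedRpow r (y i) * c i)|
      ≤ (r - 2) * (lrNorm r b * lrNorm r c) := by
    rw [abs_mul, abs_mul, abs_mul, abs_of_nonneg (Real.rpow_nonneg hf.le _),
      abs_of_nonpos (by linarith : 2 - r ≤ 0), neg_sub]
    calc _ ≤ (r - 2) * lrPow r δ y ^ (2 / r - 2) * (lrNorm r y ^ (r - 1) * lrNorm r b)
          * (lrNorm r y ^ (r - 1) * lrNorm r c) := by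
          have : 0 ≤ r - 2 := by linarith
          gcongr
          · exact abs_sum_signedRpow_le hr y b
          · exact abs_sum_signedRpow_le hr y c
      _ = (r - 2) * (lrNorm r b * lrNorm r c) * (lrPow r δ y ^ (2 / r - 2) *
          (lrNorm r y ^ (r - 1) * lrNorm r y ^ (r - 1))) := by ring
      _ ≤ _ := mul_le_of_le_one_right (mul_nonneg (by linarith) (by positivity)) e3
  have f2 : |(r - 1) * lrPow r δ y ^ (2 / r - 1) * ∑ i, |y i| ^ (r - 2) * b i * c i|
      ≤ (r - 1) * (lrNorm r b * lrNorm r c) := by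
    rw [abs_mul, abs_mul, abs_of_nonneg (Real.rpow_nonneg hf.le _),
      abs_of_nonneg (by linarith : 0 ≤ r - 1)]
    calc _ ≤ (r - 1) * lrPow r δ y ^ (2 / r - 1) *
          (lrNorm r y ^ (r - 2) * lrNorm r b * lrNorm r c) := by
          have : 0 ≤ r - 1 := by linarith
          gcongr
      _ = (r - 1) * (lrNorm r b * lrNorm r c) *
          (lrPow r δ y ^ (2 / r - 1) * lrNorm r y ^ (r - 2)) := by ring
      _ ≤ _ := mul_le_of_le_one_right (mul_nonneg (by linarith) (by positivity)) e2
  rw [abs_mul, abs_two]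
  have := abs_add_le ((2 - r) * lrPow r δ y ^ (2 / r - 2) *
          (∑ i, signedRpow r (y i) * b i) * (∑ i, signedRpow r (y i) * c i))
        ((r - 1) * lrPow r δ y ^ (2 / r - 1) * ∑ i, |y i| ^ (r - 2) * b i * c i)
  nlinarith [mul_nonneg hb hc]

lemma abs_lrGradient_sub_le {r δ : ℝ} (hr : 2 ≤ r) (hδ : 0 < δ) (x b c : ι → ℝ) :
    |lrGradient r δ (x + b) c - lrGradient r δ x c| ≤ 4 * r * lrNorm r b * lrNorm r c := by
  obtain ⟨t, -, ht⟩ := exists_hasDerivAt_eq_slope _ _ (zero_lt_one' ℝ)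
    (fun t _ => (hasDerivAt_lrGradient hr hδ x b c t).continuousAt.continuousWithinAt)
    (fun t _ => hasDerivAt_lrGradient hr hδ x b c t)
  have h1 := abs_deriv_lrGradient_le hr hδ (fun i => x i + t * b i) b c
  rw [ht] at h1
  simpa [← Pi.add_def] using h1

/-- By the mean value theorem the increment is the gradient at some `x + t h`, `0 < t < 1`, applied
to `h`; replacing it by the gradient at `x` costs its Lipschitz bound. -/
lemma lrPotential_add_le {r δ : ℝ} (hr : 2 ≤ r) (hδ : 0 < δ) (x h : ι → ℝ) :
    lrPotential r δ (x + h) ≤ lrPotential r δ x + lrGradient r δ x h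
      + 4 * r * lrNorm r h ^ 2 := by
  obtain ⟨t, ht01, ht⟩ := exists_hasDerivAt_eq_slope _ _ (zero_lt_one' ℝ)
    (fun t _ => (hasDerivAt_lrPotential hr hδ x h t).continuousAt.continuousWithinAt)
    (fun t _ => hasDerivAt_lrPotential hr hδ x h t)
  have h1 := abs_lrGradient_sub_le hr hδ x (fun i => t * h i) h
  rw [lrNorm_smul (by linarith), abs_of_pos ht01.1] at h1
  simp only [one_mul, zero_mul, add_zero, sub_zero, div_one] at ht
  have h2 : lrGradient r δ (x + fun i => t * h i) h
      = lrPotential r δ (x + h) - lrPotential r δ x := ht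
  have h3 := (le_abs_self _).trans h1
  have h4 : 4 * r * (t * lrNorm r h) * lrNorm r h ≤ 4 * r * lrNorm r h ^ 2 := by
    have : 0 ≤ 4 * r * lrNorm r h ^ 2 := by positivity
    nlinarith [ht01.2]
  linarith

end SmoothPotential

/-! ### Comparison of the conjugate norm with an `ℓ^r` norm. -/

section DualNorm

variable {ι : Type*} [Fintype ι] {p : ℝ≥0∞} [Fact (1 ≤ p)]

/-- Power means: the entries have modulus `|a i| ^ (r - 1)`, whose `ℓ^{r/(r-1)}` norm is `‖a‖_r ^ (r
- 1)`. The hypothesis `hs` says `q ≤ r/(r-1)`, and passing to `ℓ^q` costs the power of the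
cardinality that `hd` bounds by `2`. -/
lemma lrNorm_signedRpow_le {r q : ℝ} (hr : 2 ≤ r) (hq : 1 ≤ q) (hs : 0 ≤ 1 / q - 1 + 1 / r)
    (hd : (Fintype.card ι : ℝ) ^ (1 / q - 1 + 1 / r) ≤ 2) (a : ι → ℝ) :
    lrNorm q (fun i => signedRpow r (a i)) ≤ 2 * lrNorm r a ^ (r - 1) := by
  have hr0 : 0 < r := by linarith
  have hq0 : 0 < q := by linarith
  set θ := (r - 1) * q / r with hθ
  have hθ0 : 0 < θ := div_pos (mul_pos (by linarith) hq0) hr0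
  have hθ1 : θ ≤ 1 := by
    rw [hθ, div_le_one hr0]
    have h1 : (1 / q - 1 + 1 / r) * (q * r) = r - q * r + q := by field_simp
    have h2 := mul_nonneg hs (mul_pos hq0 hr0).le
    linarith
  have h1 := Real.rpow_sum_le_const_mul_sum_rpow Finset.univ
    (fun i => |signedRpow r (a i)| ^ q) (p := 1 / θ) (by rw [le_div_iff₀ hθ0]; linarith)
  have h2 : ∀ i, |(|signedRpow r (a i)| ^ q)| ^ (1 / θ) = |a i| ^ r := fun i => by
    rw [abs_of_nonneg (by positivity), ← Real.rpow_mul (abs_nonneg _)]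
    have e : |signedRpow r (a i)| = |a i| ^ (r - 1) := by
      rw [signedRpow, abs_mul, abs_of_nonneg (Real.rpow_nonneg (abs_nonneg _) _)]
      rcases (abs_nonneg (a i)).eq_or_lt with h | h
      · rw [← h, mul_zero, Real.zero_rpow (by linarith)]
      · rw [← Real.rpow_add_one h.ne']
        ring_nf
    rw [e, ← Real.rpow_mul (abs_nonneg _)]
    congr 1
    rw [hθ]
    have : r - 1 ≠ 0 := by linarith
    field_simp
  simp only [h2, Finset.card_univ] at h1
  rw [← lrNorm_rpow hr0] at h1
  have hnn : 0 ≤ ∑ i, |signedRpow r (a i)| ^ q :=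
    Finset.sum_nonneg fun _ _ => by positivity
  have habs : ∑ i, |(|signedRpow r (a i)| ^ q)| = ∑ i, |signedRpow r (a i)| ^ q :=
    Finset.sum_congr rfl fun i _ => abs_of_nonneg (by positivity)
  rw [habs] at h1
  have h3 := Real.rpow_le_rpow (by positivity) h1 (z := θ / q) (by positivity)
  rw [← Real.rpow_mul hnn, Real.mul_rpow (by positivity)
    (Real.rpow_nonneg (lrNorm_nonneg _ _) _), ← Real.rpow_mul (by positivity),
    ← Real.rpow_mul (lrNorm_nonneg _ _)] at h3
  have e1 : 1 / θ * (θ / q) = 1 / q := by field_simp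
  have e2 : r * (θ / q) = r - 1 := by rw [hθ]; field_simp
  have e3 : (1 / θ - 1) * (θ / q) = 1 / q - 1 + 1 / r := by
    have : (1 / θ - 1) * (θ / q) = 1 / q - θ / q := by field_simp
    rw [this, hθ]
    field_simp
    ring
  rw [e1, e2, e3] at h3
  exact h3.trans (mul_le_mul_of_nonneg_right hd (Real.rpow_nonneg (lrNorm_nonneg _ _) _))

/-- Hölder with exponent `r` and its conjugate `r'`, together with `q ≤ r'`: the normalized entries
of `x` are at most `1`, so raising the exponent decreases their powers. -/
lemma sum_mul_le_lrNorm_mul {r q : ℝ} (hr : 2 ≤ r) (hq : 1 ≤ q) (hs : 0 ≤ 1 / q - 1 + 1 / r)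
    (a x : ι → ℝ) : ∑ i, |a i| * |x i| ≤ lrNorm r a * lrNorm q x := by
  have hr0 : 0 < r := by linarith
  have hq0 : 0 < q := by linarith
  rcases (lrNorm_nonneg r a).eq_or_lt with ha | ha
  · simp [← ha, eq_zero_of_lrNorm_eq_zero hr0 ha.symm]
  rcases (lrNorm_nonneg q x).eq_or_lt with hx | hx
  · simp [← hx, eq_zero_of_lrNorm_eq_zero hq0 hx.symm]
  have hrr : r.HolderConjugate r.conjExponent := Real.HolderConjugate.conjExponent (by linarith)
  have hle : ∀ i, |x i| / lrNorm q x ≤ 1 := fun i => by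
    rw [div_le_one hx]
    have : |x i| ^ q ≤ lrNorm q x ^ q := by
      rw [lrNorm_rpow hq0]
      exact Finset.single_le_sum (f := fun i => |x i| ^ q) (fun _ _ => by positivity)
        (Finset.mem_univ i)
    exact (Real.rpow_le_rpow_iff (abs_nonneg _) hx.le hq0).1 this
  have hqr : q ≤ r.conjExponent := by
    have h1 := hrr.inv_add_inv_eq_one
    have h2 := hrr.symm.pos
    rw [← inv_le_inv₀ h2 hq0]
    simp only [one_div] at hs
    linarith
  have key : ∀ i, (|a i| / lrNorm r a) * (|x i| / lrNorm q x) ≤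
      |a i| ^ r / lrNorm r a ^ r / r + |x i| ^ q / lrNorm q x ^ q / r.conjExponent := fun i => by
    have h1 := Real.young_inequality_of_nonneg (a := |a i| / lrNorm r a)
      (b := |x i| / lrNorm q x) (by positivity) (by positivity) hrr
    rw [Real.div_rpow (abs_nonneg _) ha.le] at h1
    refine h1.trans ?_
    have h2 : (|x i| / lrNorm q x) ^ r.conjExponent ≤ |x i| ^ q / lrNorm q x ^ q := by
      rw [← Real.div_rpow (abs_nonneg _) hx.le]
      rcases (div_nonneg (abs_nonneg (x i)) hx.le).eq_or_lt with h0 | h0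
      · rw [← h0, Real.zero_rpow hrr.symm.pos.ne', Real.zero_rpow hq0.ne']
      · exact Real.rpow_le_rpow_of_exponent_ge h0 (hle i) hqr
    have := hrr.symm.pos
    gcongr
  have hsum := Finset.sum_le_sum fun i (_ : i ∈ Finset.univ) => key i
  simp only [Finset.sum_add_distrib, ← Finset.sum_div, ← lrNorm_rpow hr0,
    ← lrNorm_rpow hq0] at hsum
  rw [div_self (by positivity), div_self (by positivity), one_div, one_div,
    hrr.inv_add_inv_eq_one] at hsum
  have e : ∑ i, |a i| * |x i| = lrNorm r a * lrNorm q x *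
      ∑ i, (|a i| / lrNorm r a) * (|x i| / lrNorm q x) := by
    rw [Finset.mul_sum]
    refine Finset.sum_congr rfl fun i _ => ?_
    field_simp
  rw [e]
  exact mul_le_of_le_one_right (by positivity) hsum

lemma piLp_norm_eq_lrNorm (hp : p ≠ ∞) (x : PiLp p fun _ : ι => ℝ) :
    ‖x‖ = lrNorm p.toReal (fun i => x i) := by
  rw [PiLp.norm_eq_sum (ENNReal.toReal_pos (zero_lt_one.trans_le Fact.out).ne' hp)]
  rfl

variable [DecidableEq ι]

/-- The coefficients of a linear form in the standard basis. -/
noncomputable def dualCoeff (p : ℝ≥0∞) [Fact (1 ≤ p)] :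
    StrongDual ℝ (PiLp p fun _ : ι => ℝ) →ₗ[ℝ] (ι → ℝ) where
  toFun ξ i := ξ (WithLp.toLp p (Pi.single i 1))
  map_add' _ _ := rfl
  map_smul' _ _ := rfl

lemma apply_eq_sum_dualCoeff (ξ : StrongDual ℝ (PiLp p fun _ : ι => ℝ))
    (x : PiLp p fun _ : ι => ℝ) : ξ x = ∑ i, dualCoeff p ξ i * x i := by
  have hx : x = ∑ i, x i • WithLp.toLp p (Pi.single i (1 : ℝ)) := by
    ext j
    simp [Pi.single_apply]
  conv_lhs => rw [hx, map_sum]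
  refine Finset.sum_congr rfl fun i _ => ?_
  rw [map_smul, smul_eq_mul, mul_comm]
  rfl

lemma norm_le_lrNorm_dualCoeff (hp : p ≠ ∞) {r : ℝ} (hr : 2 ≤ r)
    (hs : 0 ≤ 1 / p.toReal - 1 + 1 / r) (ξ : StrongDual ℝ (PiLp p fun _ : ι => ℝ)) :
    ‖ξ‖ ≤ lrNorm r (dualCoeff p ξ) := by
  have hq : 1 ≤ p.toReal := by
    simpa using ENNReal.toReal_mono hp (Fact.out : 1 ≤ p)
  refine ξ.opNorm_le_bound (lrNorm_nonneg _ _) fun x => ?_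
  rw [apply_eq_sum_dualCoeff, piLp_norm_eq_lrNorm hp]
  refine (Finset.abs_sum_le_sum_abs _ _).trans ?_
  simp only [abs_mul]
  exact sum_mul_le_lrNorm_mul hr hq hs _ _

/-- Test the form on the extremal vector of Hölder's inequality, `|a i|^(r-2) a i`, whose `ℓ^p` norm
has just been bounded. -/
lemma lrNorm_dualCoeff_le (hp : p ≠ ∞) {r : ℝ} (hr : 2 ≤ r)
    (hs : 0 ≤ 1 / p.toReal - 1 + 1 / r)
    (hd : (Fintype.card ι : ℝ) ^ (1 / p.toReal - 1 + 1 / r) ≤ 2)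
    (ξ : StrongDual ℝ (PiLp p fun _ : ι => ℝ)) :
    lrNorm r (dualCoeff p ξ) ≤ 2 * ‖ξ‖ := by
  have hq : 1 ≤ p.toReal := by
    simpa using ENNReal.toReal_mono hp (Fact.out : 1 ≤ p)
  have hr0 : 0 < r := by linarith
  set a := dualCoeff p ξ with ha
  rcases (lrNorm_nonneg r a).eq_or_lt with h0 | h0
  · rw [← h0]; positivity
  have h1 : lrNorm r a ^ r ≤ ‖ξ‖ * (2 * lrNorm r a ^ (r - 1)) := by
    have h2 : lrNorm r a ^ r = ξ (WithLp.toLp p fun i => signedRpow r (a i)) := by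
      rw [lrNorm_rpow hr0, apply_eq_sum_dualCoeff]
      refine Finset.sum_congr rfl fun i _ => ?_
      change |a i| ^ r = a i * (|a i| ^ (r - 2) * a i)
      rcases (abs_nonneg (a i)).eq_or_lt with h | h
      · rw [← h, Real.zero_rpow hr0.ne', abs_eq_zero.1 h.symm]
        simp
      · have : a i * (|a i| ^ (r - 2) * a i) = |a i| ^ (r - 2) * |a i| ^ (2 : ℝ) := by
          rw [Real.rpow_two, sq_abs]; ring
        rw [this, ← Real.rpow_add h]
        ring_nf
    rw [h2]
    refine (le_abs_self _).trans ((ξ.le_opNorm _).trans ?_)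
    rw [piLp_norm_eq_lrNorm hp]
    gcongr
    exact lrNorm_signedRpow_le hr hq hs hd a
  have h3 : lrNorm r a ^ r = lrNorm r a ^ (r - 1) * lrNorm r a := by
    rw [← Real.rpow_add_one h0.ne']; ring_nf
  rw [h3] at h1
  have h4 : 0 < lrNorm r a ^ (r - 1) := by positivity
  nlinarith

/-- The `ℓ^r` norm of the coefficients lies between the conjugate norm and twice it. The constant
`4r` is thus multiplied by `2 · 2`. -/
lemma hasSmoothPotential_dual_of_exponent (hp : p ≠ ∞) {r : ℝ} (hr : 2 ≤ r)
    (hs : 0 ≤ 1 / p.toReal - 1 + 1 / r)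
    (hd : (Fintype.card ι : ℝ) ^ (1 / p.toReal - 1 + 1 / r) ≤ 2) :
    HasSmoothPotential (StrongDual ℝ (PiLp p fun _ : ι => ℝ)) (16 * r) := by
  intro δ hδ
  have hr0 : 0 < r := by linarith
  -- Chosen so that the potential at the origin, `δ' ^ (2/r)`, equals `δ`.
  set δ' := δ ^ (r / 2) with hδ'
  have hδ'0 : 0 < δ' := by positivity
  let g (ξ : StrongDual ℝ (PiLp p fun _ : ι => ℝ)) :
      StrongDual ℝ (PiLp p fun _ : ι => ℝ) →ₗ[ℝ] ℝ :=
    { toFun := fun h => lrGradient r δ' (dualCoeff p ξ) (dualCoeff p h)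
      map_add' := fun h₁ h₂ => by
        simp [lrGradient, mul_add, Finset.sum_add_distrib]
      map_smul' := fun s h => by
        simp only [lrGradient, map_smul, Pi.smul_apply, smul_eq_mul, RingHom.id_apply,
          Finset.mul_sum]
        exact Finset.sum_congr rfl fun _ _ => by ring }
  have hN := fun ξ : StrongDual ℝ (PiLp p fun _ : ι => ℝ) => lrNorm_dualCoeff_le hp hr hs hd ξ
  refine ⟨fun ξ => lrPotential r δ' (dualCoeff p ξ),
    fun ξ => LinearMap.toContinuousLinearMap (g ξ), ?_, ?_, fun ξ => ?_, fun x h => ?_,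
    fun x y => ?_⟩
  · simp only [map_zero, lrPotential, lrPow, Pi.zero_apply, abs_zero, Real.zero_rpow hr0.ne',
      Finset.sum_const_zero, add_zero, hδ', ← Real.rpow_mul hδ.le]
    rw [show r / 2 * (2 / r) = 1 by field_simp, Real.rpow_one]
  · ext h
    simp [g, lrGradient, signedRpow]
  · refine le_trans ?_ (lrNorm_sq_le_lrPotential hr0 hδ'0 _)
    gcongr
    exact norm_le_lrNorm_dualCoeff hp hr hs ξ
  · have h1 := lrPotential_add_le hr hδ'0 (dualCoeff p x) (dualCoeff p h)
    have h2 : lrNorm r (dualCoeff p h) ^ 2 ≤ (2 * ‖h‖) ^ 2 := by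
      have := lrNorm_nonneg r (dualCoeff p h)
      gcongr
      exact hN h
    rw [← map_add] at h1
    refine h1.trans ?_
    change _ ≤ lrPotential r δ' _ + lrGradient r δ' _ _ + _
    nlinarith
  · refine ContinuousLinearMap.opNorm_le_bound _ (by positivity) fun h => ?_
    have h1 := abs_lrGradient_sub_le hr hδ'0 (dualCoeff p y) (dualCoeff p (x - y))
      (dualCoeff p h)
    rw [← map_add, add_sub_cancel] at h1
    refine h1.trans ?_
    have := lrNorm_nonneg r (dualCoeff p h)
    have := lrNorm_nonneg r (dualCoeff p (x - y))
    calc 4 * r * lrNorm r (dualCoeff p (x - y)) * lrNorm r (dualCoeff p h)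
        ≤ 4 * r * (2 * ‖x - y‖) * (2 * ‖h‖) := by
          gcongr
          · exact hN _
          · exact hN _
      _ = _ := by ring

lemma HasSmoothPotential.mono {V : Type*} [NormedAddCommGroup V] [NormedSpace ℝ V] {K K' : ℝ}
    (h : HasSmoothPotential V K) (hK : K ≤ K') : HasSmoothPotential V K' := by
  intro δ hδ
  obtain ⟨Φ, g, h0, hg, h1, h2, h3⟩ := h δ hδ
  refine ⟨Φ, g, h0, hg, h1, fun x h => (h2 x h).trans ?_, fun x y => (h3 x y).trans ?_⟩ <;> gcongr

lemma one_lt_log_add_three {x : ℝ} (hx : 0 ≤ x) : 1 < Real.log (x + 3) := by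
  rw [Real.lt_log_iff_exp_lt (by linarith)]
  linarith [Real.exp_one_lt_d9]

/-- The conjugate of the `ℓ^p` norm on `ℝ^d`, `1 ≤ p ≤ 2`, is smooth up to a factor `log d`. -/
lemma hasSmoothPotential_dual_piLp {d : ℕ} (hp : p ≤ 2) :
    HasSmoothPotential (StrongDual ℝ (PiLp p fun _ : Fin d => ℝ))
      (32 * if p = 2 then 1 else Real.log (d + 3)) := by
  have htop : p ≠ ∞ := (hp.trans_lt (by simp)).ne
  have hq : 1 ≤ p.toReal := by
    simpa using ENNReal.toReal_mono htop (Fact.out : 1 ≤ p)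
  split_ifs with h2
  · subst h2
    refine (hasSmoothPotential_dual_of_exponent (r := 2) htop le_rfl ?_ ?_).mono (by norm_num)
    · norm_num
    · norm_num
  have hlog := one_lt_log_add_three (Nat.cast_nonneg (α := ℝ) d)
  -- With this exponent `d ^ (1/ρ) ≤ e^{1/2} ≤ 2`, so the norms compare without loss in the
  -- dimension, and `16 ρ = 32 log (d + 3)`.
  set ρ := 2 * Real.log (d + 3) with hρ
  have hρ2 : 2 ≤ ρ := by linarith
  have hρ0 : 0 < ρ := by linarith
  by_cases hs : 0 ≤ 1 / p.toReal - 1 + 1 / ρ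
  · refine (hasSmoothPotential_dual_of_exponent (r := ρ) htop hρ2 hs ?_).mono (by linarith)
    rw [Fintype.card_fin]
    have hle : 1 / p.toReal - 1 + 1 / ρ ≤ 1 / ρ := by
      have : 1 / p.toReal ≤ 1 := by rw [div_le_one (by linarith)]; exact hq
      linarith
    have hd3 : (0 : ℝ) < d + 3 := by positivity
    calc (d : ℝ) ^ (1 / p.toReal - 1 + 1 / ρ) ≤ ((d : ℝ) + 3) ^ (1 / p.toReal - 1 + 1 / ρ) :=
          Real.rpow_le_rpow (by positivity) (by linarith) hs
      _ ≤ ((d : ℝ) + 3) ^ (1 / ρ) :=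
          Real.rpow_le_rpow_of_exponent_le (by linarith [d.cast_nonneg (α := ℝ)]) hle
      _ = Real.exp (1 / 2) := by
          rw [Real.rpow_def_of_pos hd3, hρ]
          congr 1
          field_simp
      _ ≤ 2 := by
          have h1 : Real.exp (1 / 2) ^ 2 = Real.exp 1 := by
            rw [← Real.exp_nat_mul]; norm_num
          have := Real.exp_one_lt_d9
          nlinarith [Real.exp_pos (1 / 2)]
  -- Here the conjugate exponent of `p` is below `ρ`, so it can itself serve as `r`; this excludes
  -- `p = 1`.
  · push Not at hs
    have hq1 : 1 < p.toReal := by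
      refine lt_of_le_of_ne hq fun h => ?_
      rw [← h] at hs
      have : 0 < 1 / ρ := by positivity
      norm_num at hs
      linarith [inv_pos.2 hρ0]
    have hq2 : p.toReal ≤ 2 := by simpa using ENNReal.toReal_mono (by simp) hp
    set q := p.toReal
    have hzero : 1 / q - 1 + 1 / (q / (q - 1)) = 0 := by
      have : q - 1 ≠ 0 := by linarith
      field_simp
      ring
    have hr2 : 2 ≤ q / (q - 1) := by
      rw [le_div_iff₀ (by linarith)]
      linarith
    refine (hasSmoothPotential_dual_of_exponent (r := q / (q - 1)) htop hr2 hzero.ge ?_).mono ?_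
    · rw [hzero, Real.rpow_zero]
      norm_num
    · have h1 : 1 / ρ < 1 / (q / (q - 1)) := by linarith
      have := (one_div_lt_one_div hρ0 (by linarith)).1 h1
      linarith

end DualNorm

/-! ### The Markov property and forgetting of the past. -/

section Chain

variable {S Ω : Type*} [MeasurableSpace S] [MeasurableSpace Ω]

/-- Layer cake: each integral of `f + b` is the integral over levels in `(0, 2b]` of the measures of
superlevel sets, and these differ by at most `a`. -/
lemma abs_integral_sub_le_of_forall_measureReal {μ ν : Measure S} [IsProbabilityMeasure μ]
    [IsProbabilityMeasure ν] {a : ℝ}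
    (h : ∀ A, MeasurableSet A → |μ.real A - ν.real A| ≤ a) {f : S → ℝ} (hf : Measurable f)
    {b : ℝ} (hb : ∀ s, |f s| ≤ b) : |∫ s, f s ∂μ - ∫ s, f s ∂ν| ≤ 2 * b * a := by
  have hS : Nonempty S := μ.nonempty_of_neZero
  have hb0 : 0 ≤ b := (abs_nonneg _).trans (hb hS.some)
  have key : ∀ (κ : Measure S) [IsProbabilityMeasure κ], Integrable f κ ∧
      ∫ s, f s ∂κ + b = ∫ t in Set.Ioc 0 (2 * b), κ.real {s | t ≤ f s + b} := by
    intro κ _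
    have hi : Integrable f κ :=
      Integrable.of_bound hf.aestronglyMeasurable b (Eventually.of_forall hb)
    refine ⟨hi, ?_⟩
    have h0 := (hi.add (integrable_const b)).integral_eq_integral_Ioc_meas_le (M := 2 * b) ?_ ?_
    · rw [integral_add' hi (integrable_const b)] at h0
      simpa using h0
    · exact Eventually.of_forall fun s => by
        have := (abs_le.1 (hb s)).1
        simp only [Pi.zero_apply, Pi.add_apply]; linarith
    · exact Eventually.of_forall fun s => by
        have := (abs_le.1 (hb s)).2
        simp only [Pi.add_apply]; linarith
  have hint : ∀ (κ : Measure S) [IsProbabilityMeasure κ],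
      IntegrableOn (fun t => κ.real {s | t ≤ f s + b}) (Set.Ioc 0 (2 * b)) := by
    intro κ _
    refine Measure.integrableOn_of_bounded (M := 1) measure_Ioc_lt_top.ne ?_
      (Eventually.of_forall fun t => ?_)
    · refine (Antitone.measurable fun t₁ t₂ h12 => ?_).aestronglyMeasurable
      exact measureReal_mono fun s hs => le_trans h12 hs
    · rw [Real.norm_of_nonneg measureReal_nonneg]
      exact measureReal_le_one
  have e : ∫ s, f s ∂μ - ∫ s, f s ∂ν = ∫ t in Set.Ioc 0 (2 * b),
      (μ.real {s | t ≤ f s + b} - ν.real {s | t ≤ f s + b}) := by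
    rw [integral_sub (hint μ) (hint ν), ← (key μ).2, ← (key ν).2]
    ring
  rw [e, ← Real.norm_eq_abs]
  refine (norm_setIntegral_le_of_norm_le_const (C := a) measure_Ioc_lt_top fun t _ => ?_).trans ?_
  · exact h _ (measurableSet_le measurable_const (hf.add_const b))
  · rw [measureReal_def, Real.volume_Ioc, sub_zero, ENNReal.toReal_ofReal (by positivity)]
    linarith

/-- The path stopped at time `m`. -/
def stopPath (m : ℕ) (z : ℕ → S) : ℕ → S := fun i => z (min i m)

lemma measurable_stopPath (m : ℕ) : Measurable (stopPath (S := S) m) :=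
  measurable_pi_lambda _ fun _ => measurable_pi_apply _

omit [MeasurableSpace S] in
lemma dependsOn_apply_stopPath {β : Type*} {f : (ℕ → S) → β} {m : ℕ}
    (hf : DependsOn f (Set.Iic m)) (z : ℕ → S) : f (stopPath m z) = f z :=
  hf fun i hi => by simp [stopPath, min_eq_left (Set.mem_Iic.1 hi)]

instance isMarkovKernel_pow (Q : Kernel S S) [IsMarkovKernel Q] (t : ℕ) :
    IsMarkovKernel (Q ^ t) := by
  induction t with
  | zero => exact inferInstanceAs (IsMarkovKernel Kernel.id)
  | succ t ih =>
    rw [pow_succ']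
    exact inferInstanceAs (IsMarkovKernel (Q ∘ₖ (Q ^ t)))

variable {Q : Kernel S S} [IsMarkovKernel Q] {π : Measure S} {P : Measure Ω}
  [IsProbabilityMeasure P] {Z : ℕ → Ω → S}

omit [IsMarkovKernel Q] [IsProbabilityMeasure P] in
lemma IsMarkovChain.measurable_path (hZ : IsMarkovChain Q π P Z) :
    Measurable fun w n => Z n w :=
  measurable_pi_lambda _ hZ.measurable

lemma IsMarkovChain.lintegral_succ (hZ : IsMarkovChain Q π P Z) (n : ℕ) {m : ℕ} (hm : m ≤ n)
    {f : (ℕ → S) → S → ℝ≥0∞} (hf : Measurable (Function.uncurry f)) :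
    ∫⁻ w, f (stopPath m fun i => Z i w) (Z (n + 1) w) ∂P
      = ∫⁻ w, ∫⁻ s, f (stopPath m fun i => Z i w) s ∂(Q (Z n w)) ∂P := by
  -- The transition law conditions on a finite tuple. `ext` prolongs it to a path, and stopping at
  -- `m ≤ n` does not see the prolongation.
  let ext : (Fin (n + 1) → S) → ℕ → S := fun h i => h ⟨min i n, by omega⟩
  have hext : Measurable ext := measurable_pi_lambda _ fun _ => measurable_pi_apply _
  have hpath : ∀ w, stopPath m (ext fun i => Z i w) = stopPath m fun i => Z i w := fun w => by
    funext i
    simp only [stopPath, ext]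
    congr 1
    omega
  have hlaw := hZ.transition n
  have hf' : Measurable fun q : (Fin (n + 1) → S) × S => f (stopPath m (ext q.1)) q.2 :=
    hf.comp ((((measurable_stopPath m).comp hext).comp measurable_fst).prodMk measurable_snd)
  have h1 := lintegral_map' (μ := P) (f := fun q : (Fin (n + 1) → S) × S =>
    f (stopPath m (ext q.1)) q.2) hf'.aemeasurable hlaw.aemeasurable
  rw [hlaw.map_eq, Measure.lintegral_compProd hf',
    lintegral_map' hf'.lintegral_kernel_prod_right'.aemeasurable
      hlaw.aemeasurable_fst] at h1
  simp only [hpath] at h1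
  exact h1.symm

/-- Induction on `t` for all `f` at once: integrating out the last transition yields a function of
the same frozen past and of the previous state. -/
lemma IsMarkovChain.lintegral_add (hZ : IsMarkovChain Q π P Z) (m t : ℕ)
    {f : (ℕ → S) → S → ℝ≥0∞} (hf : Measurable (Function.uncurry f)) :
    ∫⁻ w, f (stopPath m fun i => Z i w) (Z (m + t) w) ∂P
      = ∫⁻ w, ∫⁻ s, f (stopPath m fun i => Z i w) s ∂((Q ^ t) (Z m w)) ∂P := by
  induction t generalizing f with
  | zero =>
    refine lintegral_congr fun w => ?_
    have : Q ^ 0 = Kernel.id := rfl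
    have h0 : Measurable fun s => f (stopPath m fun i => Z i w) s := hf.comp measurable_prodMk_left
    rw [this, Kernel.lintegral_id' h0]
    rfl
  | succ t ih =>
    have h1 := hZ.lintegral_succ (m + t) (Nat.le_add_right m t) hf
    rw [← add_assoc, h1]
    have hf' : Measurable (Function.uncurry fun (z : ℕ → S) (y : S) => ∫⁻ s, f z s ∂(Q y)) := by
      have h2 : Measurable fun q : ((ℕ → S) × S) × S => f q.1.1 q.2 :=
        hf.comp ((measurable_fst.comp measurable_fst).prodMk measurable_snd)
      exact Measurable.lintegral_kernel_prod_right' (κ := Q.comap Prod.snd measurable_snd) h2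
    rw [ih hf']
    refine lintegral_congr fun w => ?_
    have h3 : Q ^ (t + 1) = Q ∘ₖ (Q ^ t) := pow_succ' Q t
    have h0 : Measurable fun s => f (stopPath m fun i => Z i w) s := hf.comp measurable_prodMk_left
    rw [h3, Kernel.lintegral_comp _ _ _ h0]

lemma IsMarkovChain.map_stopPath_prod (hZ : IsMarkovChain Q π P Z) (m t : ℕ) :
    P.map (fun w => (stopPath m fun i => Z i w, Z (m + t) w))
      = (P.map fun w => stopPath m fun i => Z i w) ⊗ₘ
        ((Q ^ t).comap (fun z : ℕ → S => z m) (measurable_pi_apply m)) := by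
  have hm1 : Measurable fun w => stopPath m fun i => Z i w :=
    (measurable_stopPath m).comp hZ.measurable_path
  have hm2 : Measurable fun w => (stopPath m fun i => Z i w, Z (m + t) w) :=
    hm1.prodMk (hZ.measurable _)
  refine Measure.ext_of_lintegral _ fun f hf => ?_
  rw [lintegral_map hf hm2, Measure.lintegral_compProd hf,
    lintegral_map hf.lintegral_kernel_prod_right' hm1]
  have := hZ.lintegral_add m t (f := fun z s => f (z, s)) hf
  rw [this]
  simp [stopPath, Kernel.comap_apply]

/-- Under `μ`, the coordinate at time `m + t` forgets the coordinates up to time `m` at rate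
`ρ t`: it is then almost distributed as `π`. -/
def IsDecorrelating (μ : Measure (ℕ → S)) (π : Measure S) (ρ : ℕ → ℝ) : Prop :=
  ∀ (m t : ℕ), 0 < t → ∀ ψ : (ℕ → S) → S → ℝ, Measurable (Function.uncurry ψ) →
    (∀ s, DependsOn (fun z => ψ z s) (Set.Iic m)) → ∀ b : ℝ, (∀ z s, |ψ z s| ≤ b) →
    (∀ z, ∫ s, ψ z s ∂π = 0) → |∫ z, ψ z (z (m + t)) ∂μ| ≤ b * ρ t

/-- Given the path up to `m`, the later state has law `(Q ^ t) (Z m)`. As `ψ z` is centred under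
`π`, its conditional mean is a difference of integrals against two close measures; the factor `2`
comes from the range `[-b, b]`. -/
lemma IsMarkovChain.isDecorrelating [IsProbabilityMeasure π] (hZ : IsMarkovChain Q π P Z)
    {τ : ℕ} {c : ℝ} (hQ : IsUniformlyErgodic Q π τ c) :
    IsDecorrelating (P.map fun w n => Z n w) π
      fun t => 2 * c * (1 / 2 : ℝ) ^ ((t : ℝ) / (τ : ℝ)) := by
  intro m t ht ψ hψ hdep b hb hπ
  have hmeas : Measurable fun z : ℕ → S => ψ z (z (m + t)) :=
    hψ.comp (measurable_id.prodMk (measurable_pi_apply _))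
  rw [integral_map hZ.measurable_path.aemeasurable hmeas.aestronglyMeasurable]
  have hm2 : Measurable fun w => (stopPath m fun i => Z i w, Z (m + t) w) :=
    ((measurable_stopPath m).comp hZ.measurable_path).prodMk (hZ.measurable _)
  have e : ∫ w, ψ (fun n => Z n w) (Z (m + t) w) ∂P
      = ∫ q, ψ q.1 q.2 ∂(P.map fun w => (stopPath m fun i => Z i w, Z (m + t) w)) := by
    have h0 : Measurable fun q : (ℕ → S) × S => ψ q.1 q.2 := hψ
    rw [integral_map hm2.aemeasurable h0.aestronglyMeasurable]
    refine integral_congr_ae (Eventually.of_forall fun w => ?_)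
    exact (dependsOn_apply_stopPath (hdep (Z (m + t) w)) _).symm
  have hprob : IsProbabilityMeasure (P.map fun w => stopPath m fun i => Z i w) :=
    Measure.isProbabilityMeasure_map
      ((measurable_stopPath m).comp hZ.measurable_path).aemeasurable
  rw [e, hZ.map_stopPath_prod, Measure.integral_compProd]
  · have := norm_integral_le_of_norm_le_const (μ := P.map fun w => stopPath m fun i => Z i w)
      (f := fun z => ∫ s, ψ z s ∂((Q ^ t).comap (fun z : ℕ → S => z m)
        (measurable_pi_apply m) z)) (C := b * (2 * c * (1 / 2 : ℝ) ^ ((t : ℝ) / (τ : ℝ))))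
      (Eventually.of_forall fun z => ?_)
    · simpa using this
    · have h1 := abs_integral_sub_le_of_forall_measureReal (μ := (Q ^ t) (z m)) (ν := π)
        (hQ.mixing t ht (z m)) (hψ.comp measurable_prodMk_left) (hb z)
      have h2 : ∫ s, (Function.uncurry ψ ∘ Prod.mk z) s ∂π = 0 := hπ z
      rw [h2, sub_zero] at h1
      rw [Kernel.comap_apply, Real.norm_eq_abs]
      refine h1.trans (le_of_eq ?_)
      ring
  · exact Integrable.of_bound hψ.aestronglyMeasurable b (Eventually.of_forall fun q => hb q.1 q.2)

end Chain

/-! ### The total correlation is proportional to the mixing time. -/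

section GeometricSum

/-- The ratio `q` satisfies `q ^ τ = 1/2`; Bernoulli's inequality gives `1 - q ≥ 1/(2τ)`, and the
geometric sum is at most `1/(1 - q)`. -/
lemma sum_half_rpow_div_le {τ : ℕ} (hτ : 1 ≤ τ) (n : ℕ) :
    ∑ t ∈ Finset.Icc 1 n, (1 / 2 : ℝ) ^ ((t : ℝ) / (τ : ℝ)) ≤ 2 * τ := by
  have hτ0 : (0 : ℝ) < τ := by exact_mod_cast hτ
  set q : ℝ := (1 / 2 : ℝ) ^ (1 / (τ : ℝ)) with hq
  have hq0 : 0 < q := by positivity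
  have hq1 : q < 1 := Real.rpow_lt_one (by norm_num) (by norm_num) (by positivity)
  have hpow : ∀ t : ℕ, (1 / 2 : ℝ) ^ ((t : ℝ) / (τ : ℝ)) = q ^ t := fun t => by
    rw [hq, ← Real.rpow_natCast, ← Real.rpow_mul (by norm_num)]
    congr 1
    field_simp
  have hqτ : q ^ τ = 1 / 2 := by
    rw [← hpow, div_self hτ0.ne', Real.rpow_one]
  have hb : 1 / 2 ≤ τ * (1 - q) := by
    have := one_add_mul_le_pow (a := q - 1) (by linarith) τ
    rw [add_sub_cancel, hqτ] at this
    linarith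
  simp only [hpow]
  have hgeom : (∑ t ∈ Finset.Icc 1 n, q ^ t) * (1 - q) ≤ 1 := by
    have h2 : ∑ t ∈ Finset.Icc 1 n, q ^ t ≤ ∑ t ∈ Finset.range (n + 1), q ^ t := by
      refine Finset.sum_le_sum_of_subset_of_nonneg (fun t ht => ?_) fun _ _ _ => by positivity
      rw [Finset.mem_Icc] at ht
      rw [Finset.mem_range]
      omega
    have h3 := geom_sum_mul_neg q (n + 1)
    have h4 : 0 < q ^ (n + 1) := by positivity
    nlinarith
  have h5 : 0 < 1 - q := by linarith
  by_contra hlt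
  push Not at hlt
  nlinarith [mul_lt_mul_of_pos_right hlt h5]

end GeometricSum

/-! ### Bias and second moment of sums of oracle noises. -/

section Oracle

variable {E S : Type*} [NormedAddCommGroup E] [NormedSpace ℝ E] [FiniteDimensional ℝ E]
  [MeasurableSpace E] [BorelSpace E] [MeasurableSpace S]

/-- `G` is a measurable oracle for `F` on `X`, unbiased under `π` and with noise bounded by
`σ`. -/
structure IsOracle (X : Set E) (F : E → StrongDual ℝ E) (G : E → S → StrongDual ℝ E)
    (π : Measure S) (σ : ℝ) : Prop where
  measurable : Measurable (Function.uncurry G)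
  mean : ∀ x ∈ X, ∫ s, G x s ∂π = F x
  bound : ∀ x ∈ X, ∀ s, ‖G x s - F x‖ ≤ σ

/-- The noise `G(x, s) - F(x)` of the oracle. -/
def noise (F : E → StrongDual ℝ E) (G : E → S → StrongDual ℝ E) (x : E) (s : S) :
    StrongDual ℝ E := G x s - F x

variable {X : Set E} {F : E → StrongDual ℝ E} {G : E → S → StrongDual ℝ E} {π : Measure S}
  [IsProbabilityMeasure π] {σ : ℝ}

lemma measurable_dual_apply {α V : Type*} [MeasurableSpace α] [NormedAddCommGroup V]
    [NormedSpace ℝ V] [FiniteDimensional ℝ V] [MeasurableSpace V] [BorelSpace V]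
    {ξ : α → StrongDual ℝ V} {v : α → V} (hξ : Measurable ξ) (hv : Measurable v) :
    Measurable fun a => ξ a (v a) := by
  have := FiniteDimensional.proper_real V
  exact (isBoundedBilinearMap_apply (𝕜 := ℝ) (E := V) (F := ℝ)).continuous.measurable.comp
    (hξ.prodMk hv)

omit [BorelSpace E] in
-- `F ∘ x` is a `π`-integral of the jointly measurable oracle, so nothing has to be known about `F`
-- outside `X`.
lemma IsOracle.measurable_comp (h : IsOracle X F G π σ) {α : Type*} [MeasurableSpace α]
    {x : α → E} (hx : Measurable x) (hxX : ∀ a, x a ∈ X) : Measurable fun a => F (x a) := by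
  have h1 : StronglyMeasurable fun q : α × S => G (x q.1) q.2 :=
    (h.measurable.comp ((hx.comp measurable_fst).prodMk measurable_snd)).stronglyMeasurable
  have h2 := h1.integral_prod_right' (ν := π)
  convert! h2.measurable using 2 with a
  exact (h.mean _ (hxX a)).symm

omit [BorelSpace E] in
lemma IsOracle.measurable_noise (h : IsOracle X F G π σ) {α : Type*} [MeasurableSpace α]
    {x : α → E} {s : α → S} (hx : Measurable x) (hs : Measurable s) (hxX : ∀ a, x a ∈ X) :
    Measurable fun a => noise F G (x a) (s a) :=
  (h.measurable.comp (hx.prodMk hs)).sub (h.measurable_comp hx hxX)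

omit [BorelSpace E] in
lemma IsOracle.integral_noise (h : IsOracle X F G π σ) {x : E} (hx : x ∈ X) :
    Integrable (fun s => noise F G x s) π ∧ ∫ s, noise F G x s ∂π = 0 := by
  have h1 : Measurable fun s => noise F G x s :=
    (h.measurable.comp measurable_prodMk_left).sub_const _
  have h2 : Integrable (fun s => noise F G x s) π :=
    Integrable.of_bound h1.aestronglyMeasurable σ (Eventually.of_forall fun s => h.bound x hx s)
  refine ⟨h2, ?_⟩
  have h3 : Integrable (fun s => G x s) π :=
    (h2.add (integrable_const (F x))).congr (Eventually.of_forall fun s => by simp [noise])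
  simp only [noise]
  rw [integral_sub h3 (integrable_const _), h.mean x hx]
  simp

variable {μ : Measure (ℕ → S)} [IsProbabilityMeasure μ] {ρ : ℕ → ℝ}

omit [IsProbabilityMeasure μ] in
omit [BorelSpace E] in
-- `W` is bidual-valued to serve two purposes: gradients of the potential for second moments, and
-- evaluation at vectors for the bias.
lemma IsDecorrelating.abs_integral_dual_noise_le (hμ : IsDecorrelating μ π ρ)
    (h : IsOracle X F G π σ) {m t : ℕ} (ht : 0 < t) {x : (ℕ → S) → E} (hx : Measurable x)
    (hxX : ∀ z, x z ∈ X) (hxd : DependsOn x (Set.Iic m))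
    {W : (ℕ → S) → StrongDual ℝ (StrongDual ℝ E)} (hW : Measurable W)
    (hWd : DependsOn W (Set.Iic m)) {b : ℝ} (hb : ∀ z, ‖W z‖ ≤ b) :
    |∫ z, W z (noise F G (x z) (z (m + t))) ∂μ| ≤ b * σ * ρ t := by
  refine hμ m t ht (fun z s => W z (noise F G (x z) s)) ?_ ?_ (b * σ) ?_ ?_
  · exact measurable_dual_apply (hW.comp measurable_fst)
      (h.measurable_noise (hx.comp measurable_fst) measurable_snd fun q => hxX q.1)
  · intro s z z' hz
    simp only [hxd hz, hWd hz]
  · intro z s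
    refine ((W z).le_opNorm _).trans ?_
    gcongr
    · exact (norm_nonneg (W z)).trans (hb z)
    · exact hb z
    · exact h.bound _ (hxX z) s
  · intro z
    have h1 := h.integral_noise (hxX z)
    rw [ContinuousLinearMap.integral_comp_comm _ h1.1, h1.2, map_zero]

/-- The sum of the noises of `n` consecutive oracle answers at `x`, from time `N + 1` on. -/
def noiseSum (F : E → StrongDual ℝ E) (G : E → S → StrongDual ℝ E) (x : E) (N n : ℕ)
    (z : ℕ → S) : StrongDual ℝ E :=
  ∑ i ∈ Finset.range n, noise F G x (z (N + (i + 1)))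

omit [FiniteDimensional ℝ E] [MeasurableSpace E] [BorelSpace E] [MeasurableSpace S] in
lemma oracleMean_sub_eq (x : E) (N : ℕ) {n : ℕ} (hn : n ≠ 0) (z : ℕ → S) :
    oracleMean G z x N n - F x = (n : ℝ)⁻¹ • noiseSum F G x N n z := by
  have h1 : ∑ i ∈ Finset.Icc 1 n, G x (z (N + i))
      = ∑ i ∈ Finset.range n, G x (z (N + (i + 1))) := by
    rw [Finset.range_eq_Ico, Finset.sum_Ico_add' (fun i => G x (z (N + i))) 0 n 1]
    rfl
  have hn' : (n : ℝ) ≠ 0 := by exact_mod_cast hn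
  simp only [oracleMean, noiseSum, noise, h1, Finset.sum_sub_distrib, smul_sub,
    Finset.sum_const, Finset.card_range]
  rw [← Nat.cast_smul_eq_nsmul ℝ, smul_smul, inv_mul_cancel₀ hn', one_smul]

omit [FiniteDimensional ℝ E] [BorelSpace E] [IsProbabilityMeasure π] in
lemma IsOracle.norm_noiseSum_le (h : IsOracle X F G π σ) {x : E} (hx : x ∈ X) (N n : ℕ)
    (z : ℕ → S) : ‖noiseSum F G x N n z‖ ≤ n * σ := by
  refine (norm_sum_le_of_le _ fun i _ => h.bound x hx _).trans ?_
  simp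

omit [BorelSpace E] in
lemma IsOracle.measurable_noiseSum (h : IsOracle X F G π σ) {x : (ℕ → S) → E}
    (hx : Measurable x) (hxX : ∀ z, x z ∈ X) (N n : ℕ) :
    Measurable fun z => noiseSum F G (x z) N n z := by
  have : ∀ z : ℕ → S, noiseSum F G (x z) N n z
      = ∑ i ∈ Finset.range n, noise F G (x z) (z (N + (i + 1))) := fun _ => rfl
  simp only [this]
  exact Finset.measurable_sum _ fun i _ =>
    h.measurable_noise hx (measurable_pi_apply _) hxX

omit [FiniteDimensional ℝ E] [MeasurableSpace E] [BorelSpace E] [MeasurableSpace S] in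
lemma dependsOn_noiseSum {x : (ℕ → S) → E} {N : ℕ} (hxd : DependsOn x (Set.Iic N)) (n : ℕ) :
    DependsOn (fun z => noiseSum F G (x z) N n z) (Set.Iic (N + n)) := by
  intro z z' hz
  have hx : x z = x z' := hxd fun i hi => hz i (Set.mem_Iic.2 (by
    have := Set.mem_Iic.1 hi; omega))
  simp only [noiseSum, hx]
  refine Finset.sum_congr rfl fun i hi => ?_
  rw [hz (N + (i + 1)) (Set.mem_Iic.2 (by have := Finset.mem_range.1 hi; omega))]

omit [BorelSpace E] in
/-- A dependent sum of noises grows like a sum of independent ones. -/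
lemma IsDecorrelating.integral_norm_noiseSum_sq_le (hμ : IsDecorrelating μ π ρ)
    (h : IsOracle X F G π σ) (hσ : 0 ≤ σ) {A : ℝ} (hA : ∀ n, ∑ t ∈ Finset.Icc 1 n, ρ t ≤ A)
    {K : ℝ} (hK : 0 ≤ K) (hsm : HasSmoothPotential (StrongDual ℝ E) K) {N : ℕ}
    {x : (ℕ → S) → E} (hx : Measurable x) (hxX : ∀ z, x z ∈ X)
    (hxd : DependsOn x (Set.Iic N)) (n : ℕ) :
    ∫ z, ‖noiseSum F G (x z) N n z‖ ^ 2 ∂μ ≤ n * (K * σ ^ 2 * (1 + A)) := by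
  have hproper := FiniteDimensional.proper_real (StrongDual ℝ E)
  refine le_of_forall_pos_le_add fun δ hδ => ?_
  obtain ⟨Φ, g, hΦ0, hg0, hΦ, hstep, hg⟩ := hsm δ hδ
  have hgc : Continuous g := by
    have : LipschitzWith K.toNNReal g := LipschitzWith.of_dist_le_mul fun a b => by
      rw [dist_eq_norm, dist_eq_norm, Real.coe_toNNReal _ hK]
      exact hg a b
    exact this.continuous
  let s : ℕ → (ℕ → S) → StrongDual ℝ E := fun k z => noiseSum F G (x z) N k z
  let y : ℕ → (ℕ → S) → StrongDual ℝ E := fun k z => noise F G (x z) (z (N + (k + 1)))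
  have hs0 : ∀ z, s 0 z = 0 := fun z => by simp [s, noiseSum]
  have hs1 : ∀ k z, s (k + 1) z = s k z + y k z := fun k z => Finset.sum_range_succ _ _
  have hsm : ∀ k, Measurable (s k) := fun k => h.measurable_noiseSum hx hxX N k
  have hym : ∀ k, Measurable (y k) := fun k => h.measurable_noise hx (measurable_pi_apply _) hxX
  have hyb : ∀ k z, ‖y k z‖ ≤ σ := fun k z => h.bound _ (hxX z) _
  have hdiffb : ∀ l z, ‖g (s (l + 1) z) - g (s l z)‖ ≤ K * σ := fun l z => by
    refine (hg _ _).trans ?_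
    rw [hs1, add_sub_cancel_left]
    gcongr
    exact hyb l z
  have hint : ∀ l k, Integrable (fun z => (g (s (l + 1) z) - g (s l z)) (y k z)) μ := by
    intro l k
    refine Integrable.of_bound (C := K * σ * σ) (measurable_dual_apply
      ((hgc.measurable.comp (hsm _)).sub (hgc.measurable.comp (hsm _)))
      (hym k)).aestronglyMeasurable (Eventually.of_forall fun z => ?_)
    refine (ContinuousLinearMap.le_opNorm _ _).trans ?_
    gcongr
    · exact hdiffb l z
    · exact hyb k z
  -- The increment is determined by the states up to time `N + l + 1` and the noise is read at `N +
  -- k + 1`, whence the lag `k - l`.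
  have hcor : ∀ l k, l < k → ∫ z, (g (s (l + 1) z) - g (s l z)) (y k z) ∂μ
      ≤ K * σ * σ * ρ (k - l) := by
    intro l k hlk
    have h1 := hμ.abs_integral_dual_noise_le h (m := N + (l + 1)) (t := k - l) (by omega) hx hxX
      (hxd.mono (Set.Iic_subset_Iic.2 (by omega)))
      (W := fun z => g (s (l + 1) z) - g (s l z))
      ((hgc.measurable.comp (hsm _)).sub (hgc.measurable.comp (hsm _))) ?_ (hdiffb l)
    · rw [show N + (l + 1) + (k - l) = N + (k + 1) by omega] at h1
      exact (le_abs_self _).trans h1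
    · intro z z' hz
      have e1 : s (l + 1) z = s (l + 1) z' := dependsOn_noiseSum hxd (l + 1) hz
      have e2 : s l z = s l z' := dependsOn_noiseSum hxd l fun i hi =>
        hz i (Set.mem_Iic.2 (by have := Set.mem_Iic.1 hi; omega))
      simp only [e1, e2]
  -- The smoothness inequality is iterated along the partial sums. The gradient `g (s k)` may grow
  -- with `k` and involves the most recent states. It is therefore written, using `g 0 = 0`, as a
  -- sum of increments, each bounded by `K σ`, whose correlations with `y k` decay with their age.
  have hpt : ∀ z, ∀ k, Φ (s k z) ≤ δ + ∑ i ∈ Finset.range k,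
      (∑ l ∈ Finset.range i, (g (s (l + 1) z) - g (s l z)) (y i z) + K * σ ^ 2) := by
    intro z k
    induction k with
    | zero => simpa [hs0] using hΦ0
    | succ k ih =>
      rw [Finset.sum_range_succ, hs1]
      have h1 := hstep (s k z) (y k z)
      have h2 : g (s k z) (y k z)
          = ∑ l ∈ Finset.range k, (g (s (l + 1) z) - g (s l z)) (y k z) := by
        simp only [sub_apply]
        rw [Finset.sum_range_sub (fun l => g (s l z) (y k z)), hs0, hg0]
        simp
      have h3 : K * ‖y k z‖ ^ 2 ≤ K * σ ^ 2 := by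
        gcongr
        exact hyb k z
      linarith
  have hi1 : ∀ i, Integrable (fun z => ∑ l ∈ Finset.range i,
      (g (s (l + 1) z) - g (s l z)) (y i z) + K * σ ^ 2) μ := fun i =>
    (integrable_finsetSum _ fun l _ => hint l i).add (integrable_const _)
  have hi2 : Integrable (fun z => δ + ∑ i ∈ Finset.range n,
      (∑ l ∈ Finset.range i, (g (s (l + 1) z) - g (s l z)) (y i z) + K * σ ^ 2)) μ :=
    (integrable_const δ).add (integrable_finsetSum _ fun i _ => hi1 i)
  calc ∫ z, ‖noiseSum F G (x z) N n z‖ ^ 2 ∂μ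
      ≤ ∫ z, (δ + ∑ i ∈ Finset.range n,
        (∑ l ∈ Finset.range i, (g (s (l + 1) z) - g (s l z)) (y i z) + K * σ ^ 2)) ∂μ := by
        refine integral_mono_of_nonneg (Eventually.of_forall fun z => by positivity) hi2
          (Eventually.of_forall fun z => (hΦ _).trans (hpt z n))
    _ = δ + ∑ i ∈ Finset.range n, (∑ l ∈ Finset.range i,
        ∫ z, (g (s (l + 1) z) - g (s l z)) (y i z) ∂μ + K * σ ^ 2) := by
        rw [integral_add (integrable_const δ) (integrable_finsetSum _ fun i _ => hi1 i),
          integral_finsetSum _ fun i _ => hi1 i]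
        congr 1
        · simp
        refine Finset.sum_congr rfl fun i _ => ?_
        rw [integral_add (integrable_finsetSum _ fun l _ => hint l i) (integrable_const _),
          integral_finsetSum _ fun l _ => hint l i]
        simp
    _ ≤ δ + ∑ i ∈ Finset.range n, (K * σ ^ 2 * A + K * σ ^ 2) := by
        gcongr with i _
        calc ∑ l ∈ Finset.range i, ∫ z, (g (s (l + 1) z) - g (s l z)) (y i z) ∂μ
            ≤ ∑ l ∈ Finset.range i, K * σ * σ * ρ (i - l) :=
              Finset.sum_le_sum fun l hl => hcor l i (Finset.mem_range.1 hl)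
          _ = K * σ ^ 2 * ∑ t ∈ Finset.Icc 1 i, ρ t := by
              rw [← Finset.mul_sum, ← Finset.sum_range_reflect]
              rw [show Finset.Icc 1 i = Finset.Ico (0 + 1) (i + 1) from rfl,
                ← Finset.sum_Ico_add' ρ 0 i 1, ← Finset.range_eq_Ico, pow_two, mul_assoc K]
              congr 1
              refine Finset.sum_congr rfl fun l hl => ?_
              rw [Finset.mem_range] at hl
              congr 1
              omega
          _ ≤ K * σ ^ 2 * A := by
              gcongr
              exact hA i
    _ = n * (K * σ ^ 2 * (1 + A)) + δ := by
        rw [Finset.sum_const, Finset.card_range, nsmul_eq_mul]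
        ring

omit [IsProbabilityMeasure μ] in
/-- The expected noise accumulated over any number of steps is bounded. -/
lemma IsDecorrelating.abs_integral_noiseSum_apply_le [IsFiniteMeasure μ]
    (hμ : IsDecorrelating μ π ρ)
    (h : IsOracle X F G π σ) (hσ : 0 ≤ σ) {A : ℝ} (hA : ∀ n, ∑ t ∈ Finset.Icc 1 n, ρ t ≤ A)
    {N : ℕ} {x v : (ℕ → S) → E} (hx : Measurable x) (hxX : ∀ z, x z ∈ X)
    (hxd : DependsOn x (Set.Iic N)) (hv : Measurable v) (hvd : DependsOn v (Set.Iic N)) {b : ℝ}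
    (hb0 : 0 ≤ b) (hb : ∀ z, ‖v z‖ ≤ b) (n : ℕ) :
    |∫ z, noiseSum F G (x z) N n z (v z) ∂μ| ≤ b * σ * A := by
  have hproper := FiniteDimensional.proper_real E
  have hint : ∀ i, Integrable (fun z => noise F G (x z) (z (N + (i + 1))) (v z)) μ := fun i => by
    refine Integrable.of_bound (C := σ * b) (measurable_dual_apply
      (h.measurable_noise hx (measurable_pi_apply _) hxX) hv).aestronglyMeasurable
      (Eventually.of_forall fun z => (ContinuousLinearMap.le_opNorm _ _).trans ?_)
    gcongr
    · exact h.bound _ (hxX z) _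
    · exact hb z
  have e : ∀ z, noiseSum F G (x z) N n z (v z)
      = ∑ i ∈ Finset.range n, noise F G (x z) (z (N + (i + 1))) (v z) := fun z => by
    simp [noiseSum]
  simp only [e]
  rw [integral_finsetSum _ fun i _ => hint i]
  refine (Finset.abs_sum_le_sum_abs _ _).trans ?_
  calc ∑ i ∈ Finset.range n, |∫ z, noise F G (x z) (z (N + (i + 1))) (v z) ∂μ|
      ≤ ∑ i ∈ Finset.range n, b * σ * ρ (i + 1) := by
        refine Finset.sum_le_sum fun i _ => ?_
        have := hμ.abs_integral_dual_noise_le h (m := N) (t := i + 1) (by omega) hx hxX hxd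
          (W := fun z => NormedSpace.inclusionInDoubleDual ℝ E (v z))
          ((NormedSpace.inclusionInDoubleDual ℝ E).continuous.measurable.comp hv)
          (fun z z' hz => by simp only [hvd hz])
          (fun z => (NormedSpace.double_dual_bound ℝ E (v z)).trans (hb z))
        simpa using this
    _ = b * σ * ∑ t ∈ Finset.Icc 1 n, ρ t := by
        rw [← Finset.mul_sum, show Finset.Icc 1 n = Finset.Ico (0 + 1) (n + 1) from rfl,
          ← Finset.sum_Ico_add' ρ 0 n 1, ← Finset.range_eq_Ico]
    _ ≤ b * σ * A := by
        gcongr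
        exact hA n

end Oracle

/-! ### The pathwise analysis of a run. -/

section Run

/-- The data of Markovian Mirror-Prox without batching. -/
structure MirrorProx (E S : Type*) [NormedAddCommGroup E] [NormedSpace ℝ E] where
  /-- The feasible set. -/
  X : Set E
  /-- The distance-generating function. -/
  ω : E → ℝ
  /-- The selection of subgradients. -/
  ω' : E → StrongDual ℝ E
  /-- The operator. -/
  F : E → StrongDual ℝ E
  /-- The stochastic oracle. -/
  G : E → S → StrongDual ℝ E
  /-- The stepsize. -/
  γ : ℝ
  /-- The truncation level. -/
  M : ℕ
  /-- The starting point. -/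
  x₀ : E

namespace MirrorProx

variable {E S : Type*} [NormedAddCommGroup E] [NormedSpace ℝ E] (a : MirrorProx E S)

/-- The iterates `(x^t, N_t)`. -/
noncomputable def state (z : ℕ → S) (j : ℕ → ℕ) (t : ℕ) : E × ℕ :=
  mmpState a.X a.ω a.ω' a.G a.γ 1 a.M a.x₀ z j t

/-- The half steps `x^{t+1/2}`. -/
noncomputable def half (z : ℕ → S) (j : ℕ → ℕ) (t : ℕ) : E :=
  mmpHalf a.X a.ω a.ω' a.G a.γ 1 z (a.state z j t)

/-- The multilevel estimators `g^t`. -/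
noncomputable def grad (z : ℕ → S) (j : ℕ → ℕ) (t : ℕ) : StrongDual ℝ E :=
  multilevelEstimator a.G z 1 a.M (a.half z j t) ((a.state z j t).2 + 1) (j t)

/-- The errors `F(x^{t+1/2}) - g^t`. -/
noncomputable def err (z : ℕ → S) (j : ℕ → ℕ) (t : ℕ) : StrongDual ℝ E :=
  a.F (a.half z j t) - a.grad z j t

/-- The mirror descent iterates driven by the errors. -/
noncomputable def ghost (z : ℕ → S) (j : ℕ → ℕ) : ℕ → E
  | 0 => a.x₀
  | t + 1 => prox a.X a.ω a.ω' (ghost z j t) (a.γ • a.err z j t)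

/-- The number `N_t` of states of the chain consumed before iteration `t`. -/
def time (j : ℕ → ℕ) (t : ℕ) : ℕ := ∑ i ∈ Finset.range t, (1 + 2 ^ j i)

lemma state_succ_fst (z : ℕ → S) (j : ℕ → ℕ) (t : ℕ) :
    (a.state z j (t + 1)).1
      = prox a.X a.ω a.ω' (a.state z j t).1 (a.γ • a.grad z j t) := rfl

lemma half_eq (z : ℕ → S) (j : ℕ → ℕ) (t : ℕ) :
    a.half z j t = prox a.X a.ω a.ω' (a.state z j t).1
      (a.γ • oracleMean a.G z (a.state z j t).1 (a.state z j t).2 1) := rfl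

lemma state_snd (z : ℕ → S) (j : ℕ → ℕ) (t : ℕ) : (a.state z j t).2 = time j t := by
  induction t with
  | zero => rfl
  | succ t ih =>
    have : (a.state z j (t + 1)).2 = (a.state z j t).2 + 1 + 2 ^ j t * 1 := rfl
    rw [this, ih, time, time, Finset.sum_range_succ, mul_one, add_assoc]

/-- The error at `x^{t+1/2}` of the mean of `2^k` oracle answers. -/
noncomputable def levelErr (z : ℕ → S) (j : ℕ → ℕ) (t k : ℕ) : StrongDual ℝ E :=
  oracleMean a.G z (a.half z j t) (time j t + 1) (2 ^ k) - a.F (a.half z j t)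

lemma levelErr_eq (z : ℕ → S) (j : ℕ → ℕ) (t k : ℕ) :
    a.levelErr z j t k
      = ((2 : ℝ) ^ k)⁻¹ • noiseSum a.F a.G (a.half z j t) (time j t + 1) (2 ^ k) z := by
  rw [levelErr, oracleMean_sub_eq _ _ (by positivity)]
  simp

lemma err_eq (z : ℕ → S) (j : ℕ → ℕ) (t : ℕ) :
    a.err z j t = -(a.levelErr z j t 0 + if 2 ^ j t ≤ a.M then
      (2 : ℝ) ^ j t • (a.levelErr z j t (j t) - a.levelErr z j t (j t - 1)) else 0) := by
  simp only [err, grad, multilevelEstimator, levelErr, state_snd, mul_one, pow_zero,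
    sub_sub_sub_cancel_right]
  abel

/-- The hypotheses on the data of the algorithm, except for the regularity of the operator. -/
structure IsValid [FiniteDimensional ℝ E] [MeasurableSpace E] [BorelSpace E] [MeasurableSpace S]
    (π : Measure S) (σ D : ℝ) : Prop where
  compact : IsCompact a.X
  distance : IsDistanceGenerating a.X a.ω a.ω'
  start : a.x₀ ∈ subdiffDomain a.X a.ω
  oracle : IsOracle a.X a.F a.G π σ
  lub : IsLUB (bregmanValues a.X a.ω a.ω') (D ^ 2)
  sigma_nonneg : 0 ≤ σ
  D_nonneg : 0 ≤ D

variable {a} [FiniteDimensional ℝ E] [MeasurableSpace E] [BorelSpace E] [MeasurableSpace S]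
  {π : Measure S} {σ D : ℝ}

lemma IsValid.nonempty (h : a.IsValid π σ D) : a.X.Nonempty := ⟨a.x₀, h.start.1⟩

lemma IsValid.state_mem (h : a.IsValid π σ D) (z : ℕ → S) (j : ℕ → ℕ) (t : ℕ) :
    (a.state z j t).1 ∈ subdiffDomain a.X a.ω := by
  cases t with
  | zero => exact h.start
  | succ t => exact prox_mem_subdiffDomain h.compact h.nonempty h.distance _ _

lemma IsValid.half_mem (h : a.IsValid π σ D) (z : ℕ → S) (j : ℕ → ℕ) (t : ℕ) :
    a.half z j t ∈ a.X :=
  (prox_mem_subdiffDomain h.compact h.nonempty h.distance _ _).1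

lemma IsValid.ghost_mem (h : a.IsValid π σ D) (z : ℕ → S) (j : ℕ → ℕ) (t : ℕ) :
    a.ghost z j t ∈ subdiffDomain a.X a.ω := by
  cases t with
  | zero => exact h.start
  | succ t => exact prox_mem_subdiffDomain h.compact h.nonempty h.distance _ _

lemma IsValid.norm_half_sub_ghost_le (h : a.IsValid π σ D) (z : ℕ → S) (j : ℕ → ℕ) (t : ℕ) :
    ‖a.half z j t - a.ghost z j t‖ ≤ 2 * D := by
  have h1 := norm_sub_sq_le_of_isLUB h.compact h.distance h.lub (h.half_mem z j t)
    (h.ghost_mem z j t).1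
  have := h.D_nonneg
  refine le_of_sq_le_sq ?_ (by positivity)
  nlinarith

lemma IsValid.norm_levelErr_le (h : a.IsValid π σ D) (z : ℕ → S) (j : ℕ → ℕ) (t k : ℕ) :
    ‖a.levelErr z j t k‖ ≤ σ := by
  rw [levelErr_eq, norm_smul, norm_inv, norm_pow, Real.norm_two]
  have h1 := h.oracle.norm_noiseSum_le (h.half_mem z j t) (time j t + 1) (2 ^ k) z
  push_cast at h1
  calc _ ≤ ((2 : ℝ) ^ k)⁻¹ * (2 ^ k * σ) := by gcongr
    _ = σ := by field_simp

/-- One step of the algorithm and of the ghost sequence. -/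
lemma IsValid.step_le (h : a.IsValid π σ D) {L : ℝ}
    (hL : ∀ x ∈ a.X, ∀ y ∈ a.X, ‖a.F x - a.F y‖ ≤ L * ‖x - y‖) (hγL : a.γ ^ 2 * L ^ 2 ≤ 1 / 4)
    (z : ℕ → S) (j : ℕ → ℕ) (t : ℕ) {u : E} (hu : u ∈ a.X) :
    a.γ * a.F (a.half z j t) (a.half z j t - u) ≤
      (bregman a.ω a.ω' (a.state z j t).1 u + bregman a.ω a.ω' (a.ghost z j t) u)
      - (bregman a.ω a.ω' (a.state z j (t + 1)).1 u
        + bregman a.ω a.ω' (a.ghost z j (t + 1)) u)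
      + (a.γ ^ 2 * (2 * ‖a.err z j t‖ ^ 2 + 3 / 2 * σ ^ 2)
        + a.γ * a.err z j t (a.half z j t - a.ghost z j t)) := by
  have h1 := extragradient_step h.compact h.distance (h.state_mem z j t) a.γ
    (oracleMean a.G z (a.state z j t).1 (a.state z j t).2 1) (a.grad z j t) hu
  have h2 := ghost_step h.compact h.distance (h.ghost_mem z j t) a.γ (a.err z j t) hu
  rw [← half_eq, ← state_succ_fst] at h1
  change _ ≤ _ - bregman a.ω a.ω' (a.ghost z j (t + 1)) u + _ at h2
  set x := (a.state z j t).1 with hx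
  set y := a.half z j t
  set e := a.err z j t with he
  set g := a.grad z j t
  set g₀ := oracleMean a.G z x (a.state z j t).2 1
  have h3 : ‖g₀ - a.F x‖ ≤ σ := by
    have := oracleMean_sub_eq (F := a.F) (G := a.G) x (a.state z j t).2 one_ne_zero z
    change g₀ - a.F x = _ at this
    rw [this]
    have := h.oracle.norm_noiseSum_le (h.state_mem z j t).1 (a.state z j t).2 1 z
    simpa using this
  have h4 : ‖g - g₀‖ ≤ ‖e‖ + L * ‖x - y‖ + σ := by
    have e1 : g - g₀ = -e - (a.F x - a.F y) - (g₀ - a.F x) := by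
      rw [he, err]
      abel
    rw [e1]
    refine (norm_sub_le _ _).trans (add_le_add ((norm_sub_le _ _).trans ?_) h3)
    rw [norm_neg]
    exact add_le_add le_rfl (hL x (h.state_mem z j t).1 y (h.half_mem z j t))
  have h5 : ‖g - g₀‖ ^ 2 ≤ 3 * (‖e‖ ^ 2 + L ^ 2 * ‖x - y‖ ^ 2 + σ ^ 2) := by
    have h6 : ‖g - g₀‖ ^ 2 ≤ (‖e‖ + L * ‖x - y‖ + σ) ^ 2 := by gcongr
    nlinarith [sq_nonneg (‖e‖ - L * ‖x - y‖), sq_nonneg (‖e‖ - σ),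
      sq_nonneg (L * ‖x - y‖ - σ)]
  -- The error is paired with `y - w` and `w - u`, `w` being the ghost point: the first is
  -- controlled in expectation, the second by `ghost_step` for every `u`.
  have h7 : a.F y (y - u) = g (y - u) + e (y - a.ghost z j t) + e (a.ghost z j t - u) := by
    rw [he, err]
    simp only [sub_apply, map_sub]
    ring
  have h8 : a.γ ^ 2 / 2 * ‖g - g₀‖ ^ 2
      ≤ a.γ ^ 2 / 2 * (3 * (‖e‖ ^ 2 + L ^ 2 * ‖x - y‖ ^ 2 + σ ^ 2)) := by gcongr
  have h9 : a.γ ^ 2 * L ^ 2 * ‖x - y‖ ^ 2 ≤ 1 / 4 * ‖x - y‖ ^ 2 := by gcongr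
  -- The coefficients of `γ² ‖e‖²` add up to `3/2 + 1/2`; that of `‖x - y‖²` is `3/2 · 1/4`, below
  -- the available `1/2`.
  rw [h7]
  nlinarith [sq_nonneg ‖x - y‖]

/-- Both sequences start at `x₀`, and each contributes one `D²`. -/
lemma IsValid.regret_le (h : a.IsValid π σ D) {L : ℝ}
    (hL : ∀ x ∈ a.X, ∀ y ∈ a.X, ‖a.F x - a.F y‖ ≤ L * ‖x - y‖) (hγL : a.γ ^ 2 * L ^ 2 ≤ 1 / 4)
    (z : ℕ → S) (j : ℕ → ℕ) (T : ℕ) {u : E} (hu : u ∈ a.X) :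
    ∑ t ∈ Finset.range T, a.γ * a.F (a.half z j t) (a.half z j t - u) ≤
      2 * D ^ 2 + ∑ t ∈ Finset.range T,
        (a.γ ^ 2 * (2 * ‖a.err z j t‖ ^ 2 + 3 / 2 * σ ^ 2)
          + a.γ * a.err z j t (a.half z j t - a.ghost z j t)) := by
  have hsum := Finset.sum_le_sum fun t (_ : t ∈ Finset.range T) => h.step_le hL hγL z j t hu
  rw [Finset.sum_add_distrib, Finset.sum_range_sub'
    (fun t => bregman a.ω a.ω' (a.state z j t).1 u + bregman a.ω a.ω' (a.ghost z j t) u)] at hsum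
  have h0 : bregman a.ω a.ω' a.x₀ u ≤ D ^ 2 := h.lub.1 ⟨a.x₀, h.start, u, hu, rfl⟩
  have h1 := bregman_nonneg h.distance (h.state_mem z j T) hu
  have h2 := bregman_nonneg h.distance (h.ghost_mem z j T) hu
  have e1 : (a.state z j 0).1 = a.x₀ := rfl
  have e2 : a.ghost z j 0 = a.x₀ := rfl
  rw [e1, e2] at hsum
  linarith

/-- The output of the algorithm after `T` iterations. -/
noncomputable def output (a : MirrorProx E S) (z : ℕ → S) (j : ℕ → ℕ) (T : ℕ) : E :=
  (T : ℝ)⁻¹ • ∑ t ∈ Finset.range T, a.half z j t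

lemma IsValid.output_mem (h : a.IsValid π σ D) (z : ℕ → S) (j : ℕ → ℕ) {T : ℕ} (hT : 1 ≤ T) :
    a.output z j T ∈ a.X := by
  have hT0 : (T : ℝ) ≠ 0 := by positivity
  rw [output, Finset.smul_sum]
  refine h.distance.strongConvex.1.sum_mem (fun _ _ => by positivity) ?_
    fun t _ => h.half_mem z j t
  simp [hT0]

/-- Monotonicity replaces `F u` by the operator at the half steps; the resulting bound does not
depend on `u`, so it passes to the supremum. -/
lemma IsValid.errVI_output_le (h : a.IsValid π σ D) {L : ℝ}
    (hL : ∀ x ∈ a.X, ∀ y ∈ a.X, ‖a.F x - a.F y‖ ≤ L * ‖x - y‖)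
    (hmono : ∀ x ∈ a.X, ∀ y ∈ a.X, 0 ≤ (a.F x - a.F y) (x - y))
    (hγ : 0 < a.γ) (hγL : a.γ ^ 2 * L ^ 2 ≤ 1 / 4)
    (z : ℕ → S) (j : ℕ → ℕ) {T : ℕ} (hT : 1 ≤ T) :
    errVI a.X a.F (a.output z j T) ≤ (T * a.γ)⁻¹ * (2 * D ^ 2 + ∑ t ∈ Finset.range T,
        (a.γ ^ 2 * (2 * ‖a.err z j t‖ ^ 2 + 3 / 2 * σ ^ 2)
          + a.γ * a.err z j t (a.half z j t - a.ghost z j t))) := by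
  refine csSup_le (h.nonempty.image _) ?_
  rintro _ ⟨u, hu, rfl⟩
  have hT0 : (0 : ℝ) < T := by exact_mod_cast hT
  have h1 := h.regret_le hL hγL z j T hu
  have h2 : a.output z j T - u = (T : ℝ)⁻¹ • ∑ t ∈ Finset.range T, (a.half z j t - u) := by
    rw [Finset.sum_sub_distrib, smul_sub, output, Finset.sum_const, Finset.card_range,
      ← Nat.cast_smul_eq_nsmul ℝ, smul_smul, inv_mul_cancel₀ hT0.ne', one_smul]
  have h3 : ∑ t ∈ Finset.range T, a.γ * a.F u (a.half z j t - u)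
      ≤ ∑ t ∈ Finset.range T, a.γ * a.F (a.half z j t) (a.half z j t - u) := by
    refine Finset.sum_le_sum fun t _ => mul_le_mul_of_nonneg_left ?_ hγ.le
    have := hmono _ (h.half_mem z j t) u hu
    rw [sub_apply] at this
    linarith
  change a.F u (a.output z j T - u) ≤ _
  rw [h2, map_smul, map_sum, smul_eq_mul, mul_inv, mul_assoc]
  refine mul_le_mul_of_nonneg_left ?_ (by positivity)
  rw [← Finset.mul_sum] at h3
  rw [le_inv_mul_iff₀ hγ]
  exact h3.trans h1

end MirrorProx

/-! ### Continuity of the merit function. -/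

section ErrVI

variable {E : Type*} [NormedAddCommGroup E] [NormedSpace ℝ E] {X : Set E}
  {F : E → StrongDual ℝ E}

lemma bddAbove_errVI (hX : IsCompact X) (hF : ContinuousOn F X) (x : E) :
    BddAbove ((fun u => F u (x - u)) '' X) := by
  refine (hX.image_of_continuousOn ?_).bddAbove
  exact (isBoundedBilinearMap_apply (𝕜 := ℝ) (E := E) (F := ℝ)).continuous.comp_continuousOn
    (hF.prodMk (Continuous.continuousOn (by fun_prop)))

lemma errVI_le_add (hX : IsCompact X) (hne : X.Nonempty) (hF : ContinuousOn F X) {C : ℝ}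
    (hC : ∀ u ∈ X, ‖F u‖ ≤ C) (x y : E) : errVI X F x ≤ errVI X F y + C * dist x y := by
  refine csSup_le (hne.image _) ?_
  rintro _ ⟨u, hu, rfl⟩
  have h1 : F u (y - u) ≤ errVI X F y := le_csSup (bddAbove_errVI hX hF y) ⟨u, hu, rfl⟩
  have h2 : F u (x - y) ≤ C * dist x y := by
    rw [dist_eq_norm]
    refine (le_abs_self _).trans (((F u).le_opNorm _).trans ?_)
    gcongr
    exact hC u hu
  have h3 : F u (x - u) = F u (x - y) + F u (y - u) := by rw [← map_add, sub_add_sub_cancel]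
  change F u (x - u) ≤ _
  linarith

lemma continuous_errVI (hX : IsCompact X) (hne : X.Nonempty) (hF : ContinuousOn F X) :
    Continuous (errVI X F) := by
  obtain ⟨C, hC⟩ := hX.exists_bound_of_continuousOn hF
  have hC0 : 0 ≤ C := (norm_nonneg _).trans (hC _ hne.some_mem)
  refine (LipschitzWith.of_le_add_mul C.toNNReal fun x y => ?_).continuous
  rw [Real.coe_toNNReal _ hC0]
  exact errVI_le_add hX hne hF hC x y

lemma continuousOn_of_norm_sub_le {L : ℝ} (hL : ∀ x ∈ X, ∀ y ∈ X, ‖F x - F y‖ ≤ L * ‖x - y‖) :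
    ContinuousOn F X := by
  have : LipschitzOnWith L.toNNReal F X := LipschitzOnWith.of_dist_le_mul fun x hx y hy => by
    rw [dist_eq_norm, dist_eq_norm]
    exact (hL x hx y hy).trans (by gcongr; exact Real.le_coe_toNNReal L)
  exact this.continuousOn

end ErrVI

/-! ### Which states and which levels an iterate depends on. -/

section Dependence

namespace MirrorProx

variable {E S : Type*} [NormedAddCommGroup E] [NormedSpace ℝ E] (a : MirrorProx E S)

lemma time_succ (j : ℕ → ℕ) (t : ℕ) : time j (t + 1) = time j t + 1 + 2 ^ j t := by
  rw [time, time, Finset.sum_range_succ, add_assoc]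

lemma time_add_one_le (j : ℕ → ℕ) (t : ℕ) : time j t + 1 ≤ time j (t + 1) := by
  rw [time_succ]
  exact Nat.le_add_right _ _

lemma dependsOn_time (t : ℕ) : DependsOn (fun j => time j t) (Set.Iio t) := fun j j' h => by
  simp only [time]
  exact Finset.sum_congr rfl fun i hi => by rw [h i (Set.mem_Iio.2 (Finset.mem_range.1 hi))]

lemma oracleMean_congr {G : E → S → StrongDual ℝ E} {z z' : ℕ → S} {N n : ℕ}
    (h : ∀ i ≤ N + n, z i = z' i) (x : E) : oracleMean G z x N n = oracleMean G z' x N n := by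
  simp only [oracleMean]
  congr 1
  refine Finset.sum_congr rfl fun i hi => ?_
  rw [h _ (by have := (Finset.mem_Icc.1 hi).2; omega)]

lemma half_congr {z z' : ℕ → S} {j : ℕ → ℕ} {t : ℕ} (h : ∀ i ≤ time j t + 1, z i = z' i)
    (hs : a.state z j t = a.state z' j t) : a.half z j t = a.half z' j t := by
  rw [half_eq, half_eq, hs, state_snd, oracleMean_congr h]

lemma grad_congr {z z' : ℕ → S} {j : ℕ → ℕ} {t : ℕ} (h : ∀ i ≤ time j (t + 1), z i = z' i)
    (hs : a.state z j t = a.state z' j t) : a.grad z j t = a.grad z' j t := by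
  have h1 : a.half z j t = a.half z' j t :=
    a.half_congr (fun i hi => h i (hi.trans (time_add_one_le j t))) hs
  have h2 : ∀ n ≤ 2 ^ j t, oracleMean a.G z (a.half z' j t) (time j t + 1) n
      = oracleMean a.G z' (a.half z' j t) (time j t + 1) n := fun n hn =>
    oracleMean_congr (fun i hi => h i (by rw [time_succ]; omega)) _
  simp only [grad, multilevelEstimator, h1, state_snd, mul_one]
  rw [h2 _ Nat.one_le_two_pow, h2 _ le_rfl,
    h2 _ (Nat.pow_le_pow_right two_pos (Nat.sub_le _ _))]

/-- For fixed levels the clock `time j t` does not depend on the path, so the past of an iterate is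
a deterministic time interval. -/
lemma state_ghost_congr {z z' : ℕ → S} {j : ℕ → ℕ} {t : ℕ} (h : ∀ i ≤ time j t, z i = z' i) :
    a.state z j t = a.state z' j t ∧ a.ghost z j t = a.ghost z' j t := by
  induction t with
  | zero => exact ⟨rfl, rfl⟩
  | succ t ih =>
    obtain ⟨h1, h2⟩ := ih fun i hi => h i (by have := time_add_one_le j t; omega)
    have h3 := a.grad_congr h h1
    have h4 : a.half z j t = a.half z' j t :=
      a.half_congr (fun i hi => h i (hi.trans (time_add_one_le j t))) h1
    refine ⟨Prod.ext ?_ ?_, ?_⟩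
    · rw [state_succ_fst, state_succ_fst, h1, h3]
    · rw [state_snd, state_snd]
    · simp only [ghost, err, h2, h3, h4]

lemma dependsOn_half (j : ℕ → ℕ) (t : ℕ) :
    DependsOn (fun z => a.half z j t) (Set.Iic (time j t + 1)) := fun _ _ h =>
  a.half_congr (fun i hi => h i hi)
    (a.state_ghost_congr fun i hi => h i (Set.mem_Iic.2 (by omega))).1

lemma dependsOn_ghost (j : ℕ → ℕ) (t : ℕ) :
    DependsOn (fun z => a.ghost z j t) (Set.Iic (time j t)) := fun _ _ h =>
  (a.state_ghost_congr fun i hi => h i (Set.mem_Iic.2 hi)).2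

lemma half_congr_level {z : ℕ → S} {j j' : ℕ → ℕ} {t : ℕ}
    (hs : a.state z j t = a.state z j' t) : a.half z j t = a.half z j' t := by
  rw [half_eq, half_eq, hs]

/-- The level drawn at iteration `t` has no influence on the points at which its errors are
evaluated; with independent levels this permits the telescoping of the bias. -/
lemma state_ghost_congr_level {z : ℕ → S} {j j' : ℕ → ℕ} {t : ℕ} (h : ∀ i < t, j i = j' i) :
    a.state z j t = a.state z j' t ∧ a.ghost z j t = a.ghost z j' t := by
  induction t with
  | zero => exact ⟨rfl, rfl⟩
  | succ t ih =>
    obtain ⟨h1, h2⟩ := ih fun i hi => h i (by omega)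
    have h4 : a.half z j t = a.half z j' t := a.half_congr_level h1
    have h3 : a.grad z j t = a.grad z j' t := by
      rw [grad, grad, h4, h1, h t (Nat.lt_succ_self t)]
    refine ⟨Prod.ext ?_ ?_, ?_⟩
    · rw [state_succ_fst, state_succ_fst, h1, h3]
    · rw [state_snd, state_snd]
      exact dependsOn_time (t + 1) fun i hi => h i hi
    · simp only [ghost, err, h2, h3, h4]

lemma levelErr_congr_level {z : ℕ → S} {j j' : ℕ → ℕ} {t : ℕ} (h : ∀ i < t, j i = j' i)
    (k : ℕ) : a.levelErr z j t k = a.levelErr z j' t k := by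
  have h1 := a.half_congr_level (a.state_ghost_congr_level (z := z) h).1
  have h2 : time j t = time j' t := dependsOn_time t fun i hi => h i hi
  rw [levelErr, levelErr, h1, h2]

end MirrorProx

end Dependence

/-! ### Joint measurability of the run in the path and the levels. -/

section Measurability

variable {E S : Type*} [NormedAddCommGroup E] [NormedSpace ℝ E] [FiniteDimensional ℝ E]
  [MeasurableSpace E] [BorelSpace E] [MeasurableSpace S]

omit [BorelSpace E] in
lemma measurable_oracleMean {G : E → S → StrongDual ℝ E} (hG : Measurable (Function.uncurry G))
    {α : Type*} [MeasurableSpace α] {z : α → ℕ → S} (hz : Measurable z) {x : α → E}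
    (hx : Measurable x) {N n : α → ℕ} (hN : Measurable N) (hn : Measurable n) :
    Measurable fun w => oracleMean G (z w) (x w) (N w) (n w) := by
  have h1 : Measurable fun q : α × (ℕ × ℕ) => oracleMean G (z q.1) (x q.1) q.2.1 q.2.2 := by
    refine measurable_from_prod_countable_left fun m => ?_
    have h0 : Measurable fun w => ∑ i ∈ Finset.Icc 1 m.2, G (x w) (z w (m.1 + i)) :=
      Finset.measurable_sum _ fun i _ =>
        hG.comp (hx.prodMk ((measurable_pi_apply (m.1 + i)).comp hz))
    exact h0.const_smul (m.2 : ℝ)⁻¹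
  exact h1.comp (measurable_id.prodMk (hN.prodMk hn))

omit [BorelSpace E] in
lemma measurable_multilevelEstimator {G : E → S → StrongDual ℝ E}
    (hG : Measurable (Function.uncurry G)) {α : Type*} [MeasurableSpace α] {z : α → ℕ → S}
    (hz : Measurable z) {x : α → E} (hx : Measurable x) {N j : α → ℕ} (hN : Measurable N)
    (hj : Measurable j) (B M : ℕ) :
    Measurable fun w => multilevelEstimator G (z w) B M (x w) (N w) (j w) := by
  have h1 : Measurable fun q : α × ℕ => multilevelEstimator G (z q.1) B M (x q.1) (N q.1) q.2 := by
    refine measurable_from_prod_countable_left fun m => ?_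
    have h0 : ∀ n : ℕ, Measurable fun w => oracleMean G (z w) (x w) (N w) n := fun n =>
      measurable_oracleMean hG hz hx hN measurable_const
    have h2 : ∀ (n₁ n₂ : ℕ) (r : ℝ), Measurable fun w => oracleMean G (z w) (x w) (N w) B
        + r • (oracleMean G (z w) (x w) (N w) n₁ - oracleMean G (z w) (x w) (N w) n₂) :=
      fun n₁ n₂ r => (h0 B).add (((h0 n₁).sub (h0 n₂)).const_smul r)
    by_cases hm : 2 ^ m ≤ M
    · simp only [multilevelEstimator, if_pos hm]
      exact h2 _ _ _
    · simp only [multilevelEstimator, if_neg hm, add_zero]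
      exact h0 B
  have h3 : Measurable fun w => (w, j w) := measurable_id.prodMk hj
  have h4 := h1.comp h3
  simp only [Function.comp_def] at h4
  exact h4

/-- `ω'` is only known to be continuous on the domain of the subdifferential, so measurability of
`x` would not give that of `ω' ∘ x`. The two are propagated together: `ω' ∘ tiltedMin` is continuous
on the whole dual. -/
lemma measurable_prox {X : Set E} {ω : E → ℝ} {ω' : E → StrongDual ℝ E} (hX : IsCompact X)
    (hne : X.Nonempty) (hω : IsDistanceGenerating X ω ω') {α : Type*} [MeasurableSpace α]
    {x : α → E} {ξ : α → StrongDual ℝ E} (hx : Measurable fun w => ω' (x w))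
    (hξ : Measurable ξ) : Measurable (fun w => prox X ω ω' (x w) (ξ w)) ∧
      Measurable fun w => ω' (prox X ω ω' (x w) (ξ w)) := by
  simp only [prox_eq_tiltedMin]
  have h1 := (tiltedMin_lipschitz hX hne hω.lsc hω.strongConvex).continuous
  have h2 : Continuous fun η => ω' (tiltedMin X ω η) :=
    hω.continuousOn.comp_continuous h1 fun η => tiltedMin_mem_subdiffDomain hX hne hω.lsc η
  exact ⟨h1.measurable.comp (hx.sub hξ), h2.measurable.comp (hx.sub hξ)⟩

namespace MirrorProx

lemma measurable_time (t : ℕ) : Measurable fun j : ℕ → ℕ => time j t :=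
  Finset.measurable_sum _ fun i _ => measurable_const.add
    ((measurable_of_countable fun n : ℕ => 2 ^ n).comp (measurable_pi_apply i))

variable {a : MirrorProx E S} {π : Measure S} [IsProbabilityMeasure π] {σ D : ℝ}

omit [IsProbabilityMeasure π] in
lemma IsValid.measurable_half_of_state (h : a.IsValid π σ D) {t : ℕ}
    (h1 : Measurable fun q : (ℕ → S) × (ℕ → ℕ) => (a.state q.1 q.2 t).1)
    (h2 : Measurable fun q : (ℕ → S) × (ℕ → ℕ) => a.ω' (a.state q.1 q.2 t).1) :
    Measurable fun q : (ℕ → S) × (ℕ → ℕ) => a.half q.1 q.2 t := by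
  simp only [half_eq, state_snd]
  exact (measurable_prox h.compact h.nonempty h.distance h2 ((measurable_oracleMean
    h.oracle.measurable measurable_fst h1 ((measurable_time t).comp measurable_snd)
    measurable_const).const_smul a.γ)).1

omit [IsProbabilityMeasure π] in
lemma IsValid.measurable_grad_of_half (h : a.IsValid π σ D) {t : ℕ}
    (h1 : Measurable fun q : (ℕ → S) × (ℕ → ℕ) => a.half q.1 q.2 t) :
    Measurable fun q : (ℕ → S) × (ℕ → ℕ) => a.grad q.1 q.2 t := by
  simp only [grad, state_snd]
  exact measurable_multilevelEstimator h.oracle.measurable measurable_fst h1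
    (((measurable_time t).comp measurable_snd).add_const 1)
    ((measurable_pi_apply t).comp measurable_snd) 1 a.M

omit [IsProbabilityMeasure π] in
lemma IsValid.measurable_state (h : a.IsValid π σ D) (t : ℕ) :
    Measurable (fun q : (ℕ → S) × (ℕ → ℕ) => (a.state q.1 q.2 t).1) ∧
      Measurable fun q : (ℕ → S) × (ℕ → ℕ) => a.ω' (a.state q.1 q.2 t).1 := by
  induction t with
  | zero =>
    exact ⟨measurable_const (a := a.x₀), measurable_const (a := a.ω' a.x₀)⟩
  | succ t ih =>
    simp only [state_succ_fst]
    exact measurable_prox h.compact h.nonempty h.distance ih.2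
      ((h.measurable_grad_of_half (h.measurable_half_of_state ih.1 ih.2)).const_smul a.γ)

omit [IsProbabilityMeasure π] in
lemma IsValid.measurable_half (h : a.IsValid π σ D) (t : ℕ) :
    Measurable fun q : (ℕ → S) × (ℕ → ℕ) => a.half q.1 q.2 t :=
  h.measurable_half_of_state (h.measurable_state t).1 (h.measurable_state t).2

lemma IsValid.measurable_err (h : a.IsValid π σ D) (t : ℕ) :
    Measurable fun q : (ℕ → S) × (ℕ → ℕ) => a.err q.1 q.2 t :=
  (h.oracle.measurable_comp (h.measurable_half t) fun q => h.half_mem q.1 q.2 t).sub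
    (h.measurable_grad_of_half (h.measurable_half t))

lemma IsValid.measurable_levelErr (h : a.IsValid π σ D) (t k : ℕ) :
    Measurable fun q : (ℕ → S) × (ℕ → ℕ) => a.levelErr q.1 q.2 t k :=
  (measurable_oracleMean h.oracle.measurable measurable_fst (h.measurable_half t)
    (((measurable_time t).comp measurable_snd).add_const 1) measurable_const).sub
    (h.oracle.measurable_comp (h.measurable_half t) fun q => h.half_mem q.1 q.2 t)

lemma IsValid.measurable_ghost (h : a.IsValid π σ D) (t : ℕ) :
    Measurable (fun q : (ℕ → S) × (ℕ → ℕ) => a.ghost q.1 q.2 t) ∧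
      Measurable fun q : (ℕ → S) × (ℕ → ℕ) => a.ω' (a.ghost q.1 q.2 t) := by
  induction t with
  | zero =>
    exact ⟨measurable_const (a := a.x₀), measurable_const (a := a.ω' a.x₀)⟩
  | succ t ih =>
    simp only [ghost]
    exact measurable_prox h.compact h.nonempty h.distance ih.2
      ((h.measurable_err t).const_smul a.γ)

omit [IsProbabilityMeasure π] in
lemma IsValid.measurable_output (h : a.IsValid π σ D) (T : ℕ) :
    Measurable fun q : (ℕ → S) × (ℕ → ℕ) => a.output q.1 q.2 T := by
  have := FiniteDimensional.proper_real E
  exact (Finset.measurable_sum _ fun t _ => h.measurable_half t).const_smul (T : ℝ)⁻¹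

end MirrorProx

end Measurability

end Run

/-! ### Second moment and bias of the multilevel estimator. -/

section Expectation

/-- Under `ν`, each coordinate is independent of the previous ones and geometrically distributed
with parameter `1/2`. -/
def IsGeomLevels (ν : Measure (ℕ → ℕ)) : Prop :=
  ∀ (t i : ℕ), 1 ≤ i → ∀ f : (ℕ → ℕ) → ℝ, Measurable f → DependsOn f (Set.Iio t) →
    ∫ j, (if j t = i then f j else 0) ∂ν = (1 / 2 : ℝ) ^ i * ∫ j, f j ∂ν

lemma IsIIDGeomHalf.isGeomLevels {Ω : Type*} [MeasurableSpace Ω] {P : Measure Ω}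
    [IsProbabilityMeasure P] {J : ℕ → Ω → ℕ} (hJ : IsIIDGeomHalf P J) :
    IsGeomLevels (P.map fun w t => J t w) := by
  intro t i hi f hf hdep
  have hJm : Measurable fun w t => J t w := measurable_pi_lambda _ hJ.measurable
  have hset : MeasurableSet {j : ℕ → ℕ | j t = i} :=
    measurableSet_eq_fun (measurable_pi_apply t) measurable_const
  rw [integral_map hJm.aemeasurable (hf.ite hset measurable_const).aestronglyMeasurable,
    integral_map hJm.aemeasurable hf.aestronglyMeasurable]
  -- A function of the levels before `t` is factored through finitely many coordinates, padded by
  -- zeros, so that independence of finite families applies.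
  let ext : (↥(Finset.range t) → ℕ) → ℕ → ℕ := fun h s =>
    if hs : s ∈ Finset.range t then h ⟨s, hs⟩ else 0
  have hext : Measurable ext := by
    refine measurable_pi_lambda _ fun s => ?_
    by_cases hs : s ∈ Finset.range t
    · simp only [ext, dif_pos hs]
      exact measurable_pi_apply _
    · simp only [ext, dif_neg hs]
      exact measurable_const
  have hfe : ∀ w, f (ext fun s => J s w) = f fun s => J s w := fun w =>
    hdep fun s hs => by
      simp only [ext, dif_pos (Finset.mem_range.2 (Set.mem_Iio.1 hs))]
  have hind := hJ.indep.indepFun_finset (Finset.range t) {t}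
    (by simp) hJ.measurable
  have hψ : Measurable fun h : (↥({t} : Finset ℕ) → ℕ) =>
      if h ⟨t, Finset.mem_singleton_self t⟩ = i then (1 : ℝ) else 0 :=
    (measurable_of_countable fun n : ℕ => if n = i then (1 : ℝ) else 0).comp
      (measurable_pi_apply _)
  have hind2 := hind.comp (hf.comp hext) hψ
  have hmul := hind2.integral_fun_mul_eq_mul_integral
    ((hf.comp hext).comp (measurable_pi_lambda _ fun s => hJ.measurable s)).aestronglyMeasurable
    (hψ.comp (measurable_pi_lambda _ fun s => hJ.measurable s)).aestronglyMeasurable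
  simp only [Function.comp_apply, hfe] at hmul
  have h1 : ∫ w, (if J t w = i then (1 : ℝ) else 0) ∂P = (1 / 2 : ℝ) ^ i := by
    rw [← hJ.law t i hi]
    have hs : MeasurableSet {w | J t w = i} :=
      measurableSet_eq_fun (hJ.measurable t) measurable_const
    rw [← integral_indicator_one hs]
    refine integral_congr_ae (Eventually.of_forall fun w => ?_)
    simp [Set.indicator_apply]
  rw [h1, mul_comm] at hmul
  rw [← hmul]
  refine integral_congr_ae (Eventually.of_forall fun w => ?_)
  simp

namespace MirrorProx

variable {E S : Type*} [NormedAddCommGroup E] [NormedSpace ℝ E] [FiniteDimensional ℝ E]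
  [MeasurableSpace E] [BorelSpace E] [MeasurableSpace S] {a : MirrorProx E S}
  {π : Measure S} [IsProbabilityMeasure π] {σ D : ℝ}
  {μ : Measure (ℕ → S)} [IsProbabilityMeasure μ] {ρ : ℕ → ℝ} {A K : ℝ}
  {ν : Measure (ℕ → ℕ)} [IsProbabilityMeasure ν]

omit [FiniteDimensional ℝ E] [MeasurableSpace E] [BorelSpace E] [MeasurableSpace S] in
-- Splitting according to the drawn level gives a finite sum in which each correction carries a
-- fixed level and an indicator.
lemma err_eq_sum (hM : a.M ≠ 0) (z : ℕ → S) (j : ℕ → ℕ) (t : ℕ) :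
    a.err z j t = -(a.levelErr z j t 0 + ∑ k ∈ Finset.Icc 1 (Nat.log 2 a.M),
      if j t = k then (2 : ℝ) ^ k • (a.levelErr z j t k - a.levelErr z j t (k - 1)) else 0) := by
  rw [err_eq, Finset.sum_ite_eq]
  congr 2
  have h1 : 2 ^ j t ≤ a.M ↔ j t ≤ Nat.log 2 a.M := (Nat.le_log_iff_pow_le one_lt_two hM).symm
  -- Level `0` is not excluded pointwise; since `0 - 1 = 0` in `ℕ`, its correction vanishes.
  rcases Nat.eq_zero_or_pos (j t) with h0 | h0
  · simp [h0]
  · simp only [Finset.mem_Icc, h1]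
    simp [Nat.one_le_iff_ne_zero, h0.ne']

omit [IsProbabilityMeasure μ] in
lemma IsValid.abs_integral_levelErr_le [IsFiniteMeasure μ] (h : a.IsValid π σ D)
    (hμ : IsDecorrelating μ π ρ)
    (hA : ∀ n, ∑ t ∈ Finset.Icc 1 n, ρ t ≤ A) (j : ℕ → ℕ) (t k : ℕ) :
    |∫ z, a.levelErr z j t k (a.half z j t - a.ghost z j t) ∂μ| ≤ 2 * D * σ * (A / 2 ^ k) := by
  have hproper := FiniteDimensional.proper_real E
  have hv : Measurable fun z => a.half z j t - a.ghost z j t :=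
    ((h.measurable_half t).comp measurable_prodMk_right).sub
      ((h.measurable_ghost t).1.comp measurable_prodMk_right)
  have hvd : DependsOn (fun z => a.half z j t - a.ghost z j t) (Set.Iic (time j t + 1)) := by
    intro z z' hz
    have h1 := a.dependsOn_half j t hz
    have h2 := a.dependsOn_ghost j t fun i hi => hz i (Set.mem_Iic.2 (by
      have := Set.mem_Iic.1 hi; omega))
    simp only at h1 h2
    simp only [h1, h2]
  have h1 := hμ.abs_integral_noiseSum_apply_le h.oracle h.sigma_nonneg hA
    ((h.measurable_half t).comp measurable_prodMk_right) (fun z => h.half_mem z j t)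
    (a.dependsOn_half j t) hv hvd (b := 2 * D) (by linarith [h.D_nonneg])
    (fun z => h.norm_half_sub_ghost_le z j t) (2 ^ k)
  have e : ∀ z, a.levelErr z j t k (a.half z j t - a.ghost z j t)
      = ((2 : ℝ) ^ k)⁻¹ * noiseSum a.F a.G (a.half z j t) (time j t + 1) (2 ^ k) z
        (a.half z j t - a.ghost z j t) := fun z => by
    rw [levelErr_eq, smul_apply, smul_eq_mul]
  simp only [e]
  rw [integral_const_mul, abs_mul, abs_inv, abs_of_pos (by positivity : (0 : ℝ) < 2 ^ k)]
  calc _ ≤ ((2 : ℝ) ^ k)⁻¹ * (2 * D * σ * A) := by gcongr; exact h1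
    _ = _ := by ring

lemma IsValid.integral_norm_levelErr_sq_le (h : a.IsValid π σ D) (hμ : IsDecorrelating μ π ρ)
    (hA : ∀ n, ∑ t ∈ Finset.Icc 1 n, ρ t ≤ A) (hK : 0 ≤ K)
    (hsm : HasSmoothPotential (StrongDual ℝ E) K) (j : ℕ → ℕ) (t k : ℕ) :
    ∫ z, ‖a.levelErr z j t k‖ ^ 2 ∂μ ≤ K * σ ^ 2 * (1 + A) / 2 ^ k := by
  have h1 := hμ.integral_norm_noiseSum_sq_le h.oracle h.sigma_nonneg hA hK hsm
    ((h.measurable_half t).comp measurable_prodMk_right) (fun z => h.half_mem z j t)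
    (a.dependsOn_half j t) (2 ^ k)
  have e : ∀ z, ‖a.levelErr z j t k‖ ^ 2 = (((2 : ℝ) ^ k)⁻¹) ^ 2 *
      ‖noiseSum a.F a.G (a.half z j t) (time j t + 1) (2 ^ k) z‖ ^ 2 := fun z => by
    rw [levelErr_eq, norm_smul, mul_pow, norm_inv, norm_pow, Real.norm_two]
  simp only [e]
  rw [integral_const_mul]
  push_cast at h1
  calc _ ≤ (((2 : ℝ) ^ k)⁻¹) ^ 2 * (2 ^ k * (K * σ ^ 2 * (1 + A))) := by gcongr; exact h1
    _ = _ := by field_simp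

omit [MeasurableSpace S] in
lemma norm_sum_ite_sq {V : Type*} [NormedAddCommGroup V] (s : Finset ℕ) (i : ℕ) (x : ℕ → V) :
    ‖∑ k ∈ s, if i = k then x k else 0‖ ^ 2 = ∑ k ∈ s, if i = k then ‖x k‖ ^ 2 else 0 := by
  simp only [Finset.sum_ite_eq]
  split_ifs <;> simp

lemma norm_add_sq_le_two {V : Type*} [NormedAddCommGroup V] (x y : V) :
    ‖x + y‖ ^ 2 ≤ 2 * ‖x‖ ^ 2 + 2 * ‖y‖ ^ 2 := by
  have h1 := norm_add_le x y
  have h2 : ‖x + y‖ ^ 2 ≤ (‖x‖ + ‖y‖) ^ 2 := by gcongr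
  nlinarith [sq_nonneg (‖x‖ - ‖y‖)]

omit [IsProbabilityMeasure π] in
-- At most one indicator is active, so the square of the sum is the sum of squares. The factor `4`
-- is two uses of `‖x + y‖² ≤ 2‖x‖² + 2‖y‖²`.
lemma IsValid.norm_err_sq_le (h : a.IsValid π σ D) (hM : a.M ≠ 0) (z : ℕ → S) (j : ℕ → ℕ)
    (t : ℕ) : ‖a.err z j t‖ ^ 2 ≤ 2 * σ ^ 2 + ∑ k ∈ Finset.Icc 1 (Nat.log 2 a.M),
      if j t = k then 4 * 4 ^ k * (‖a.levelErr z j t k‖ ^ 2 + ‖a.levelErr z j t (k - 1)‖ ^ 2)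
      else 0 := by
  rw [err_eq_sum hM, norm_neg]
  refine (norm_add_sq_le_two _ _).trans ?_
  rw [norm_sum_ite_sq, Finset.mul_sum]
  refine add_le_add ?_ (Finset.sum_le_sum fun k _ => ?_)
  · have := h.norm_levelErr_le z j t 0
    gcongr
  · split_ifs
    · rw [norm_smul, mul_pow, norm_pow, Real.norm_two, ← pow_mul, mul_comm k 2, pow_mul]
      have h1 := norm_add_sq_le_two (a.levelErr z j t k) (-a.levelErr z j t (k - 1))
      rw [← sub_eq_add_neg, norm_neg] at h1
      have h2 : (0 : ℝ) < (2 ^ 2) ^ k := by positivity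
      have h3 : ((2 : ℝ) ^ 2) ^ k = 4 ^ k := by norm_num
      rw [h3] at h2 ⊢
      nlinarith
    · simp

lemma IsValid.integrable_norm_err_sq (h : a.IsValid π σ D) (hM : a.M ≠ 0) (t : ℕ) :
    Integrable (fun q : (ℕ → S) × (ℕ → ℕ) => ‖a.err q.1 q.2 t‖ ^ 2) (μ.prod ν) := by
  refine Integrable.of_bound (C := 2 * σ ^ 2 + ∑ k ∈ Finset.Icc 1 (Nat.log 2 a.M),
    4 * 4 ^ k * (σ ^ 2 + σ ^ 2)) ((h.measurable_err t).norm.pow_const 2).aestronglyMeasurable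
    (Eventually.of_forall fun q => ?_)
  rw [Real.norm_of_nonneg (by positivity)]
  refine (h.norm_err_sq_le hM q.1 q.2 t).trans ?_
  gcongr with k _
  split_ifs
  · gcongr
    · exact h.norm_levelErr_le _ _ _ _
    · exact h.norm_levelErr_le _ _ _ _
  · positivity

lemma IsGeomLevels.measureReal {ν : Measure (ℕ → ℕ)} [IsProbabilityMeasure ν]
    (hν : IsGeomLevels ν) (t : ℕ) {i : ℕ} (hi : 1 ≤ i) (r : ℝ) :
    ∫ j, (if j t = i then r else 0) ∂ν = (1 / 2 : ℝ) ^ i * r := by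
  have := hν t i hi (fun _ => r) measurable_const (fun _ _ _ => rfl)
  simpa using this

/-- Level `k` costs `4 · 4^k (V/2^k + V/2^(k-1)) = 12 V 2^k` and is drawn with probability `2^{-k}`,
so every level contributes `12 V`. The path is integrated first, with a bound uniform in the levels;
afterwards only the law of `j t` matters. -/
lemma IsValid.integral_norm_err_sq_le (h : a.IsValid π σ D) (hM : a.M ≠ 0)
    (hμ : IsDecorrelating μ π ρ) (hA : ∀ n, ∑ t ∈ Finset.Icc 1 n, ρ t ≤ A) (hK : 0 ≤ K)
    (hsm : HasSmoothPotential (StrongDual ℝ E) K) (hν : IsGeomLevels ν) (t : ℕ) :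
    ∫ q, ‖a.err q.1 q.2 t‖ ^ 2 ∂(μ.prod ν)
      ≤ 2 * σ ^ 2 + 12 * (K * σ ^ 2 * (1 + A)) * Nat.log 2 a.M := by
  set V := K * σ ^ 2 * (1 + A) with hV
  have hint := h.integrable_norm_err_sq hM t (μ := μ) (ν := ν)
  have hVk := fun j k => h.integral_norm_levelErr_sq_le hμ hA hK hsm j t k
  rw [← hV] at hVk
  have hlint : ∀ j k, Integrable (fun z => ‖a.levelErr z j t k‖ ^ 2) μ := fun j k => by
    refine Integrable.of_bound (C := σ ^ 2) (((h.measurable_levelErr t k).comp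
      measurable_prodMk_right).norm.pow_const 2).aestronglyMeasurable
      (Eventually.of_forall fun z => ?_)
    rw [Real.norm_of_nonneg (by positivity)]
    have := h.norm_levelErr_le z j t k
    gcongr
  have hz : ∀ j, ∫ z, ‖a.err z j t‖ ^ 2 ∂μ ≤ 2 * σ ^ 2 + ∑ k ∈ Finset.Icc 1 (Nat.log 2 a.M),
      if j t = k then 12 * V * 2 ^ k else 0 := by
    intro j
    have hterm : ∀ k, Integrable (fun z => if j t = k then
        4 * 4 ^ k * (‖a.levelErr z j t k‖ ^ 2 + ‖a.levelErr z j t (k - 1)‖ ^ 2) else 0) μ := by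
      intro k
      split_ifs
      · exact ((hlint j k).add (hlint j (k - 1))).const_mul _
      · exact integrable_zero _ _ _
    calc ∫ z, ‖a.err z j t‖ ^ 2 ∂μ
        ≤ ∫ z, (2 * σ ^ 2 + ∑ k ∈ Finset.Icc 1 (Nat.log 2 a.M), if j t = k then
          4 * 4 ^ k * (‖a.levelErr z j t k‖ ^ 2 + ‖a.levelErr z j t (k - 1)‖ ^ 2) else 0) ∂μ :=
          integral_mono_of_nonneg (Eventually.of_forall fun z => by positivity)
            ((integrable_const _).add (integrable_finsetSum _ fun k _ => hterm k))
            (Eventually.of_forall fun z => h.norm_err_sq_le hM z j t)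
      _ = 2 * σ ^ 2 + ∑ k ∈ Finset.Icc 1 (Nat.log 2 a.M), ∫ z, (if j t = k then
          4 * 4 ^ k * (‖a.levelErr z j t k‖ ^ 2 + ‖a.levelErr z j t (k - 1)‖ ^ 2) else 0) ∂μ := by
          rw [integral_add (integrable_const _) (integrable_finsetSum _ fun k _ => hterm k),
            integral_finsetSum _ fun k _ => hterm k]
          simp
      _ ≤ _ := by
          gcongr with k hk
          split_ifs
          · rw [integral_const_mul, integral_add (hlint j k) (hlint j (k - 1))]
            have h1 := hVk j k
            have h2 := hVk j (k - 1)
            have hk1 := (Finset.mem_Icc.1 hk).1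
            have e : (2 : ℝ) ^ k = 2 * 2 ^ (k - 1) := by
              rw [← pow_succ', Nat.sub_add_cancel hk1]
            calc 4 * 4 ^ k * (∫ z, ‖a.levelErr z j t k‖ ^ 2 ∂μ
                  + ∫ z, ‖a.levelErr z j t (k - 1)‖ ^ 2 ∂μ)
                ≤ 4 * 4 ^ k * (V / 2 ^ k + V / 2 ^ (k - 1)) := by gcongr
              _ = 12 * V * 2 ^ k := by
                rw [show (4 : ℝ) = 2 ^ 2 by norm_num, ← pow_mul, mul_comm 2 k, pow_mul, e]
                field_simp
                ring
          · simp
  have hsumint : ∀ k, Integrable (fun j : ℕ → ℕ => if j t = k then 12 * V * 2 ^ k else 0) ν := by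
    intro k
    refine Integrable.of_bound (C := |12 * V * 2 ^ k|) (Measurable.ite (measurableSet_eq_fun
      (measurable_pi_apply t) measurable_const) measurable_const
      measurable_const).aestronglyMeasurable (Eventually.of_forall fun j => ?_)
    split_ifs
    · exact le_rfl
    · simp
  rw [integral_prod_symm _ hint]
  calc ∫ j, ∫ z, ‖a.err z j t‖ ^ 2 ∂μ ∂ν
      ≤ ∫ j, (2 * σ ^ 2 + ∑ k ∈ Finset.Icc 1 (Nat.log 2 a.M),
        if j t = k then 12 * V * 2 ^ k else 0) ∂ν :=
        integral_mono hint.integral_prod_right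
          ((integrable_const _).add (integrable_finsetSum _ fun k _ => hsumint k)) hz
    _ = 2 * σ ^ 2 + ∑ k ∈ Finset.Icc 1 (Nat.log 2 a.M), 12 * V := by
        rw [integral_add (integrable_const _) (integrable_finsetSum _ fun k _ => hsumint k),
          integral_finsetSum _ fun k _ => hsumint k]
        congr 1
        · simp
        refine Finset.sum_congr rfl fun k hk => ?_
        rw [IsGeomLevels.measureReal hν t (Finset.mem_Icc.1 hk).1, one_div, inv_pow]
        field_simp
    _ = _ := by
        rw [Finset.sum_const, Nat.card_Icc, nsmul_eq_mul, Nat.add_sub_cancel]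
        ring

omit [IsProbabilityMeasure π] in
lemma IsValid.abs_levelErr_apply_le (h : a.IsValid π σ D) (z : ℕ → S) (j : ℕ → ℕ) (t k : ℕ) :
    |a.levelErr z j t k (a.half z j t - a.ghost z j t)| ≤ 2 * D * σ := by
  refine ((a.levelErr z j t k).le_opNorm _).trans ?_
  rw [mul_comm]
  have := h.D_nonneg
  gcongr
  · exact h.norm_half_sub_ghost_le z j t
  · exact h.norm_levelErr_le z j t k

lemma IsValid.integrable_err_apply (h : a.IsValid π σ D) (hM : a.M ≠ 0) (t : ℕ) :
    Integrable (fun q : (ℕ → S) × (ℕ → ℕ) =>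
      a.err q.1 q.2 t (a.half q.1 q.2 t - a.ghost q.1 q.2 t)) (μ.prod ν) := by
  have hproper := FiniteDimensional.proper_real E
  have h1 := h.integrable_norm_err_sq hM t (μ := μ) (ν := ν)
  refine Integrable.mono' ((h1.add (integrable_const 1)).const_mul (2 * D))
    (measurable_dual_apply (h.measurable_err t) ((h.measurable_half t).sub
      (h.measurable_ghost t).1)).aestronglyMeasurable (Eventually.of_forall fun q => ?_)
  refine ((a.err q.1 q.2 t).le_opNorm _).trans ?_
  rw [mul_comm]
  have := h.D_nonneg
  simp only [Pi.add_apply]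
  gcongr
  · exact h.norm_half_sub_ghost_le _ _ _
  · nlinarith [sq_nonneg (‖a.err q.1 q.2 t‖ - 1), sq_nonneg ‖a.err q.1 q.2 t‖]

/-- The multilevel estimator has the bias of its highest level. -/
lemma IsValid.integral_err_apply_le (h : a.IsValid π σ D) (hM : a.M ≠ 0)
    (hμ : IsDecorrelating μ π ρ) (hA : ∀ n, ∑ t ∈ Finset.Icc 1 n, ρ t ≤ A)
    (hν : IsGeomLevels ν) (t : ℕ) :
    ∫ q, a.err q.1 q.2 t (a.half q.1 q.2 t - a.ghost q.1 q.2 t) ∂(μ.prod ν)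
      ≤ 2 * D * σ * min 1 (A / 2 ^ Nat.log 2 a.M) := by
  have hproper := FiniteDimensional.proper_real E
  set m := Nat.log 2 a.M with hm
  -- `α k` is the mean bias of level `k`. It depends only on the levels before `t`, so the weight
  -- `2^k` and the probability `2^{-k}` of level `k` cancel and the expectation telescopes.
  let α : ℕ → (ℕ → ℕ) → ℝ := fun k j =>
    ∫ z, a.levelErr z j t k (a.half z j t - a.ghost z j t) ∂μ
  have hlm : ∀ k, Measurable fun q : (ℕ → S) × (ℕ → ℕ) =>
      a.levelErr q.1 q.2 t k (a.half q.1 q.2 t - a.ghost q.1 q.2 t) := fun k =>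
    measurable_dual_apply (h.measurable_levelErr t k) ((h.measurable_half t).sub
      (h.measurable_ghost t).1)
  have hlint : ∀ k j, Integrable (fun z =>
      a.levelErr z j t k (a.half z j t - a.ghost z j t)) μ := fun k j =>
    Integrable.of_bound (C := 2 * D * σ) ((hlm k).comp
      measurable_prodMk_right).aestronglyMeasurable
      (Eventually.of_forall fun z => h.abs_levelErr_apply_le z j t k)
  have hαb : ∀ k j, |α k j| ≤ 2 * D * σ := fun k j => by
    have := norm_integral_le_of_norm_le_const (μ := μ) (C := 2 * D * σ)
      (f := fun z => a.levelErr z j t k (a.half z j t - a.ghost z j t))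
      (Eventually.of_forall fun z => h.abs_levelErr_apply_le z j t k)
    rwa [probReal_univ, mul_one] at this
  have hαm : ∀ k, Measurable (α k) := fun k =>
    ((hlm k).stronglyMeasurable.integral_prod_left').measurable
  have hαi : ∀ k, Integrable (α k) ν := fun k =>
    Integrable.of_bound (C := 2 * D * σ) (hαm k).aestronglyMeasurable
      (Eventually.of_forall fun j => hαb k j)
  have hαd : ∀ k, DependsOn (α k) (Set.Iio t) := by
    intro k j j' hj
    have hj' : ∀ i < t, j i = j' i := fun i hi => hj i hi
    refine integral_congr_ae (Eventually.of_forall fun z => ?_)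
    have h1 := a.state_ghost_congr_level (z := z) hj'
    simp only [a.levelErr_congr_level (z := z) hj' k, a.half_congr_level h1.1, h1.2]
  have hz : ∀ j, ∫ z, a.err z j t (a.half z j t - a.ghost z j t) ∂μ
      = -(α 0 j + ∑ k ∈ Finset.Icc 1 m,
        if j t = k then 2 ^ k * (α k j - α (k - 1) j) else 0) := by
    intro j
    have e : ∀ z, a.err z j t (a.half z j t - a.ghost z j t)
        = -(a.levelErr z j t 0 (a.half z j t - a.ghost z j t) + ∑ k ∈ Finset.Icc 1 m,
          if j t = k then 2 ^ k * (a.levelErr z j t k (a.half z j t - a.ghost z j t)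
            - a.levelErr z j t (k - 1) (a.half z j t - a.ghost z j t)) else 0) := by
      intro z
      rw [err_eq_sum hM]
      simp only [neg_apply, add_apply, ← hm, Finset.sum_ite_eq]
      split_ifs <;> simp
    have hterm : ∀ k, Integrable (fun z => if j t = k then
        2 ^ k * (a.levelErr z j t k (a.half z j t - a.ghost z j t)
            - a.levelErr z j t (k - 1) (a.half z j t - a.ghost z j t)) else 0) μ := by
      intro k
      split_ifs
      · exact ((hlint k j).sub (hlint (k - 1) j)).const_mul _
      · exact integrable_zero _ _ _
    simp only [e]
    rw [integral_neg, integral_add (hlint 0 j) (integrable_finsetSum _ fun k _ => hterm k),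
      integral_finsetSum _ fun k _ => hterm k]
    congr 2
    refine Finset.sum_congr rfl fun k _ => ?_
    split_ifs
    · rw [integral_const_mul, integral_sub (hlint k j) (hlint (k - 1) j)]
    · simp
  have hint : ∀ k, Integrable (fun j : ℕ → ℕ =>
      if j t = k then 2 ^ k * (α k j - α (k - 1) j) else 0) ν := by
    intro k
    refine Integrable.mono' (((hαi k).sub (hαi (k - 1))).const_mul (2 ^ k)).norm
      (Measurable.ite (measurableSet_eq_fun (measurable_pi_apply t) measurable_const)
        (((hαm k).sub (hαm (k - 1))).const_mul _) measurable_const).aestronglyMeasurable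
      (Eventually.of_forall fun j => ?_)
    split_ifs
    · exact le_rfl
    · simp
  rw [integral_prod_symm _ (h.integrable_err_apply hM t)]
  simp only [hz]
  rw [integral_neg, integral_add (hαi 0) (integrable_finsetSum _ fun k _ => hint k),
    integral_finsetSum _ fun k _ => hint k]
  have htel : ∀ n, ∫ j, α 0 j ∂ν + ∑ k ∈ Finset.Icc 1 n,
      ∫ j, (if j t = k then 2 ^ k * (α k j - α (k - 1) j) else 0) ∂ν = ∫ j, α n j ∂ν := by
    intro n
    induction n with
    | zero => simp
    | succ n ih =>
      rw [Finset.sum_Icc_succ_top (by omega), ← add_assoc, ih,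
        hν t (n + 1) (by omega) (fun j => 2 ^ (n + 1) * (α (n + 1) j - α (n + 1 - 1) j))
        (((hαm _).sub (hαm _)).const_mul _)
        (fun j j' hj => by
          have e1 := hαd (n + 1) hj
          have e2 := hαd (n + 1 - 1) hj
          simp only [e1, e2]), integral_const_mul, integral_sub (hαi _) (hαi _), ← mul_assoc,
        ← mul_pow]
      norm_num
  rw [htel]
  -- Both the pathwise bound `2Dσ` and the decorrelation bound are retained, so that no relation
  -- between `T` and `τ` has to be assumed.
  have hαm' : ∀ j, |α m j| ≤ 2 * D * σ * min 1 (A / 2 ^ m) := fun j => by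
    have h1 := hαb m j
    have h2 := h.abs_integral_levelErr_le hμ hA j t m
    rcases le_total 1 (A / 2 ^ m) with h3 | h3
    · rw [min_eq_left h3, mul_one]; exact h1
    · rw [min_eq_right h3]; exact h2
  have hfin := norm_integral_le_of_norm_le_const (μ := ν) (f := α m) (Eventually.of_forall hαm')
  simp only [probReal_univ, mul_one, Real.norm_eq_abs] at hfin
  exact (neg_le_abs _).trans hfin

/-- The expected error of the output, in terms of the parameters. -/
lemma IsValid.integral_errVI_output_le (h : a.IsValid π σ D) (hM : a.M ≠ 0) {L : ℝ}
    (hL : ∀ x ∈ a.X, ∀ y ∈ a.X, ‖a.F x - a.F y‖ ≤ L * ‖x - y‖)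
    (hmono : ∀ x ∈ a.X, ∀ y ∈ a.X, 0 ≤ (a.F x - a.F y) (x - y))
    (hγ : 0 < a.γ) (hγL : a.γ ^ 2 * L ^ 2 ≤ 1 / 4)
    (hμ : IsDecorrelating μ π ρ) (hA : ∀ n, ∑ t ∈ Finset.Icc 1 n, ρ t ≤ A) (hK : 0 ≤ K)
    (hsm : HasSmoothPotential (StrongDual ℝ E) K) (hν : IsGeomLevels ν) {T : ℕ} (hT : 1 ≤ T)
    (hi : Integrable (fun q : (ℕ → S) × (ℕ → ℕ) => errVI a.X a.F (a.output q.1 q.2 T))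
      (μ.prod ν)) :
    ∫ q, errVI a.X a.F (a.output q.1 q.2 T) ∂(μ.prod ν) ≤
      2 * D ^ 2 / (T * a.γ) + a.γ * (2 * (2 * σ ^ 2
        + 12 * (K * σ ^ 2 * (1 + A)) * Nat.log 2 a.M) + 3 / 2 * σ ^ 2)
        + 2 * D * σ * min 1 (A / 2 ^ Nat.log 2 a.M) := by
  have hT0 : (0 : ℝ) < T := by exact_mod_cast hT
  have hint1 : ∀ t, Integrable (fun q : (ℕ → S) × (ℕ → ℕ) =>
      a.γ ^ 2 * (2 * ‖a.err q.1 q.2 t‖ ^ 2 + 3 / 2 * σ ^ 2)) (μ.prod ν) := fun t =>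
    (((h.integrable_norm_err_sq hM t).const_mul 2).add (integrable_const _)).const_mul _
  have hint2 := fun t => (h.integrable_err_apply hM t (μ := μ) (ν := ν)).const_mul a.γ
  have hint3 : ∀ t, Integrable (fun q : (ℕ → S) × (ℕ → ℕ) =>
      a.γ ^ 2 * (2 * ‖a.err q.1 q.2 t‖ ^ 2 + 3 / 2 * σ ^ 2)
      + a.γ * a.err q.1 q.2 t (a.half q.1 q.2 t - a.ghost q.1 q.2 t)) (μ.prod ν) := fun t =>
    (hint1 t).add (hint2 t)
  have hint4 := integrable_finsetSum (Finset.range T) fun t _ => hint3 t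
  set B₁ := 2 * σ ^ 2 + 12 * (K * σ ^ 2 * (1 + A)) * Nat.log 2 a.M
  set B₂ := 2 * D * σ * min 1 (A / 2 ^ Nat.log 2 a.M)
  have hterm : ∀ t, ∫ q, (a.γ ^ 2 * (2 * ‖a.err q.1 q.2 t‖ ^ 2 + 3 / 2 * σ ^ 2)
      + a.γ * a.err q.1 q.2 t (a.half q.1 q.2 t - a.ghost q.1 q.2 t)) ∂(μ.prod ν)
      ≤ a.γ ^ 2 * (2 * B₁ + 3 / 2 * σ ^ 2) + a.γ * B₂ := fun t => by
    have e1 : ∫ q, a.γ ^ 2 * (2 * ‖a.err q.1 q.2 t‖ ^ 2 + 3 / 2 * σ ^ 2) ∂(μ.prod ν)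
        = a.γ ^ 2 * (2 * ∫ q, ‖a.err q.1 q.2 t‖ ^ 2 ∂(μ.prod ν) + 3 / 2 * σ ^ 2) := by
      rw [integral_const_mul, integral_add ((h.integrable_norm_err_sq hM t).const_mul 2)
        (integrable_const _), integral_const_mul]
      simp
    rw [integral_add (hint1 t) (hint2 t)]
    refine add_le_add ?_ ?_
    · refine (le_of_eq e1).trans ?_
      gcongr
      exact h.integral_norm_err_sq_le hM hμ hA hK hsm hν t
    · rw [integral_const_mul]
      gcongr
      exact h.integral_err_apply_le hM hμ hA hν t
  calc ∫ q, errVI a.X a.F (a.output q.1 q.2 T) ∂(μ.prod ν)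
      ≤ ∫ q, (T * a.γ)⁻¹ * (2 * D ^ 2 + ∑ t ∈ Finset.range T,
        (a.γ ^ 2 * (2 * ‖a.err q.1 q.2 t‖ ^ 2 + 3 / 2 * σ ^ 2)
          + a.γ * a.err q.1 q.2 t (a.half q.1 q.2 t - a.ghost q.1 q.2 t))) ∂(μ.prod ν) :=
        integral_mono hi (((integrable_const _).add hint4).const_mul _)
          fun q => h.errVI_output_le hL hmono hγ hγL q.1 q.2 hT
    _ = (T * a.γ)⁻¹ * (2 * D ^ 2 + ∑ t ∈ Finset.range T,
        ∫ q, (a.γ ^ 2 * (2 * ‖a.err q.1 q.2 t‖ ^ 2 + 3 / 2 * σ ^ 2)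
          + a.γ * a.err q.1 q.2 t (a.half q.1 q.2 t - a.ghost q.1 q.2 t)) ∂(μ.prod ν)) := by
        rw [integral_const_mul, integral_add (integrable_const _) hint4,
          integral_finsetSum _ fun t _ => hint3 t]
        simp
    _ ≤ (T * a.γ)⁻¹ * (2 * D ^ 2 + ∑ t ∈ Finset.range T,
        (a.γ ^ 2 * (2 * B₁ + 3 / 2 * σ ^ 2) + a.γ * B₂)) := by
        gcongr with t _
        exact hterm t
    _ = _ := by
        rw [Finset.sum_const, Finset.card_range, nsmul_eq_mul]
        field_simp
        ring

omit [IsProbabilityMeasure π] in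
lemma IsValid.integrable_errVI_output (h : a.IsValid π σ D) {L : ℝ}
    (hL : ∀ x ∈ a.X, ∀ y ∈ a.X, ‖a.F x - a.F y‖ ≤ L * ‖x - y‖) {T : ℕ} (hT : 1 ≤ T) :
    Measurable (fun q : (ℕ → S) × (ℕ → ℕ) => errVI a.X a.F (a.output q.1 q.2 T)) ∧
    Integrable (fun q : (ℕ → S) × (ℕ → ℕ) => errVI a.X a.F (a.output q.1 q.2 T))
      (μ.prod ν) := by
  have hc := continuous_errVI h.compact h.nonempty (continuousOn_of_norm_sub_le hL)
  obtain ⟨C, hC⟩ := h.compact.exists_bound_of_continuousOn hc.continuousOn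
  have hm := hc.measurable.comp (h.measurable_output T)
  exact ⟨hm, Integrable.of_bound hm.aestronglyMeasurable C
    (Eventually.of_forall fun q => hC _ (h.output_mem q.1 q.2 hT))⟩

end MirrorProx

end Expectation

/-! ### Consequences of the choice of stepsize. -/

section Stepsize

/-- The noise-dependent term balances `D²/(Tγ)` against `γσ²τ`; the last bound is `1/min(a, b) ≤ 1/a
+ 1/b`. -/
lemma stepsize_bounds {L D σ : ℝ} (hL : 0 < L) (hD : 0 < D) (hσ : 0 ≤ σ) {τ T : ℕ}
    (hτ : 1 ≤ τ) (hT : 1 ≤ T) :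
    0 < stepsize L D σ τ T ∧ stepsize L D σ τ T ^ 2 * L ^ 2 ≤ 1 / 4 ∧
      stepsize L D σ τ T * (σ ^ 2 * τ) ≤ D * σ * Real.sqrt τ / Real.sqrt T ∧
      2 * D ^ 2 / (T * stepsize L D σ τ T)
        ≤ 4 * (L * D ^ 2) / T + 2 * (D * σ * Real.sqrt τ / Real.sqrt T) := by
  have hT0 : (0 : ℝ) < T := by exact_mod_cast hT
  have hτ0 : (0 : ℝ) < τ := by exact_mod_cast hτ
  have hsT : 0 < Real.sqrt T := Real.sqrt_pos.2 hT0
  have hsτ : 0 < Real.sqrt τ := Real.sqrt_pos.2 hτ0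
  have hTT : Real.sqrt T * Real.sqrt T = T := Real.mul_self_sqrt hT0.le
  have hττ : Real.sqrt τ * Real.sqrt τ = τ := Real.mul_self_sqrt hτ0.le
  have hq : ∀ γ : ℝ, 0 < γ → γ ≤ 1 / (2 * L) → γ ^ 2 * L ^ 2 ≤ 1 / 4 := by
    intro γ h0 h1
    rw [le_div_iff₀ (by positivity)] at h1
    have h2 : 0 < γ * L := by positivity
    nlinarith
  rcases hσ.eq_or_lt with rfl | hσ
  · have e : stepsize L D 0 τ T = 1 / (2 * L) := by simp [stepsize]
    rw [e]
    refine ⟨by positivity, hq _ (by positivity) le_rfl, by simp, ?_⟩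
    simp only [mul_zero, zero_mul, zero_div, add_zero]
    refine le_of_eq ?_
    field_simp
    norm_num
  · set b := D / (Real.sqrt T * σ * Real.sqrt τ) with hb
    have hb0 : 0 < b := by positivity
    have e : stepsize L D σ τ T = min (1 / (2 * L)) b := by simp [stepsize, hσ.ne', hb]
    rw [e]
    have h0 : 0 < min (1 / (2 * L)) b := lt_min (by positivity) hb0
    have e1 : b * (σ ^ 2 * τ) = D * σ * Real.sqrt τ / Real.sqrt T := by
      rw [show b * (σ ^ 2 * τ) = b * (σ ^ 2 * (Real.sqrt τ * Real.sqrt τ)) by rw [hττ], hb]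
      field_simp
    have e2 : 2 * D ^ 2 / (T * (1 / (2 * L))) = 4 * (L * D ^ 2) / T := by
      field_simp
      norm_num
    have e3 : 2 * D ^ 2 / (T * b) = 2 * (D * σ * Real.sqrt τ / Real.sqrt T) := by
      rw [hb]
      nth_rewrite 1 [← hTT]
      field_simp
    refine ⟨h0, hq _ h0 (min_le_left _ _), ?_, ?_⟩
    · rw [← e1]
      gcongr
      exact min_le_right _ _
    · rw [← e2, ← e3]
      rcases min_choice (1 / (2 * L)) b with h | h <;> rw [h]
      · have : 0 ≤ 2 * D ^ 2 / (T * b) := by positivity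
        linarith
      · have : 0 ≤ 2 * D ^ 2 / (T * (1 / (2 * L))) := by positivity
        linarith

end Stepsize

/-! ### The expected error as a function of the number of iterations. -/

section ExpectedError

variable {E S Ω : Type*} [NormedAddCommGroup E] [NormedSpace ℝ E] [FiniteDimensional ℝ E]
  [MeasurableSpace E] [BorelSpace E] [MeasurableSpace S] [MeasurableSpace Ω]

omit [MeasurableSpace E] [BorelSpace E] in
lemma errVI_nonpos_of_isLUB_zero {X : Set E} {ω : E → ℝ} {ω' F : E → StrongDual ℝ E}
    (hX : IsCompact X) (hω : IsDistanceGenerating X ω ω')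
    (hD : IsLUB (bregmanValues X ω ω') ((0 : ℝ) ^ 2)) {x : E} (hx : x ∈ X) :
    errVI X F x ≤ 0 := by
  refine csSup_le (Set.Nonempty.image _ ⟨x, hx⟩) ?_
  rintro _ ⟨u, hu, rfl⟩
  have h1 := norm_sub_sq_le_of_isLUB hX hω hD hx hu
  have h2 : x - u = 0 := by
    rw [← norm_eq_zero]
    nlinarith [norm_nonneg (x - u)]
  simp [h2]

/-- Since `2 ^ Nat.log 2 T ≥ T/2`, the second entry is at most `8bτ/T`. With `min(1, s) ≤ √s` and
`2√(8b) ≤ 1 + 8b`, the bias is brought to the rate of the noise term, whether or not `T` exceeds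
`τ`. -/
lemma min_one_div_le_sqrt {b : ℝ} (hb : 0 ≤ b) {τ T : ℕ} (hT : 1 ≤ T) :
    2 * min 1 (4 * b * τ / 2 ^ Nat.log 2 T)
      ≤ (1 + 8 * b) * (Real.sqrt τ / Real.sqrt T) := by
  have hT0 : (0 : ℝ) < T := by exact_mod_cast hT
  have h1 : (T : ℝ) ≤ 2 * 2 ^ Nat.log 2 T := by
    have := Nat.lt_pow_succ_log_self one_lt_two T
    rw [pow_succ'] at this
    exact_mod_cast this.le
  set x := Real.sqrt τ / Real.sqrt T with hx
  have hx0 : 0 ≤ x := by positivity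
  have hxx : x ^ 2 = τ / T := by
    rw [hx, div_pow, Real.sq_sqrt (by positivity), Real.sq_sqrt hT0.le]
  have h2 : 4 * b * τ / 2 ^ Nat.log 2 T ≤ 8 * b * x ^ 2 := by
    rw [hxx, div_le_iff₀ (by positivity)]
    calc 4 * b * τ = 4 * b * (τ / T) * T := by field_simp
      _ ≤ 4 * b * (τ / T) * (2 * 2 ^ Nat.log 2 T) := by gcongr
      _ = _ := by ring
  rcases le_total 1 x with h | h
  · have := min_le_left 1 (4 * b * τ / (2 : ℝ) ^ Nat.log 2 T)
    rcases le_total 1 (8 * b) with h8 | h8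
    · nlinarith
    rcases le_total 2 ((1 + 8 * b) * x) with h9 | h9
    · linarith
    have h3 := min_le_right 1 (4 * b * τ / (2 : ℝ) ^ Nat.log 2 T)
    nlinarith [mul_nonneg hb hx0]
  · have h3 := min_le_right 1 (4 * b * τ / (2 : ℝ) ^ Nat.log 2 T)
    have h4 := min_le_left 1 (4 * b * τ / (2 : ℝ) ^ Nat.log 2 T)
    set y := min 1 (4 * b * τ / (2 : ℝ) ^ Nat.log 2 T)
    have hy0 : 0 ≤ y := le_min zero_le_one (by positivity)
    have h5 : y ^ 2 ≤ 8 * b * x ^ 2 := by nlinarith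
    refine le_of_sq_le_sq ?_ (by positivity)
    nlinarith [mul_nonneg hb (sq_nonneg x), mul_nonneg (sq_nonneg (1 - 8 * b)) (sq_nonneg x)]

/-- The expected error after `T` iterations. -/
lemma expected_errVI_le {X : Set E} {ω : E → ℝ} {ω' F : E → StrongDual ℝ E}
    {G : E → S → StrongDual ℝ E} {L D σ c ℓ : ℝ} {x₀ : E} {Q : Kernel S S} [IsMarkovKernel Q]
    {π : Measure S} [IsProbabilityMeasure π] {τ : ℕ} {P : Measure Ω} [IsProbabilityMeasure P]
    {Z : ℕ → Ω → S} {J : ℕ → Ω → ℕ}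
    (hX : IsCompact X) (hω : IsDistanceGenerating X ω ω') (hD0 : 0 ≤ D)
    (hD : IsLUB (bregmanValues X ω ω') (D ^ 2)) (hx₀ : x₀ ∈ subdiffDomain X ω) (hτ : 1 ≤ τ)
    (hQ : IsUniformlyErgodic Q π τ c) (hZ : IsMarkovChain Q π P Z) (hJ : IsIIDGeomHalf P J)
    (hZJ : IndepFun (fun w n => Z n w) (fun w t => J t w) P) (hL : 0 < L)
    (hF : ∀ x ∈ X, ∀ y ∈ X, ‖F x - F y‖ ≤ L * ‖x - y‖)
    (hmono : ∀ x ∈ X, ∀ y ∈ X, 0 ≤ (F x - F y) (x - y)) (hσ : 0 ≤ σ)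
    (hG : IsOracle X F G π σ) (hℓ : 1 ≤ ℓ)
    (hsm : HasSmoothPotential (StrongDual ℝ E) (32 * ℓ)) {T : ℕ} (hT : 1 ≤ T) :
    Integrable (fun w => errVI X F (mmpOutput X ω ω' G (stepsize L D σ τ T) 1 T x₀
        (fun n => Z n w) (fun t => J t w) T)) P ∧
      ∫ w, errVI X F (mmpOutput X ω ω' G (stepsize L D σ τ T) 1 T x₀
        (fun n => Z n w) (fun t => J t w) T) ∂P ≤
        4 * (L * D ^ 2) / T + 771 * (1 + 4 * |c|) * ℓ * (1 + Nat.log 2 T) *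
          (D * σ * Real.sqrt τ / Real.sqrt T) := by
  let a : MirrorProx E S := ⟨X, ω, ω', F, G, stepsize L D σ τ T, T, x₀⟩
  have ha : a.IsValid π σ D := ⟨hX, hω, hx₀, hG, hD, hσ, hD0⟩
  have hZm := hZ.measurable_path
  have hJm : Measurable fun w t => J t w := measurable_pi_lambda _ hJ.measurable
  have hμp : IsProbabilityMeasure (P.map fun w n => Z n w) :=
    Measure.isProbabilityMeasure_map hZm.aemeasurable
  have hνp : IsProbabilityMeasure (P.map fun w t => J t w) :=
    Measure.isProbabilityMeasure_map hJm.aemeasurable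
  have hlaw := (indepFun_iff_map_prod_eq_prod_map_map hZm.aemeasurable hJm.aemeasurable).1 hZJ
  have hpm := hZm.prodMk hJm
  obtain ⟨hm, hi⟩ := ha.integrable_errVI_output hF hT (μ := P.map fun w n => Z n w)
    (ν := P.map fun w t => J t w)
  have hi' := hi
  rw [← hlaw, integrable_map_measure hm.aestronglyMeasurable hpm.aemeasurable] at hi'
  refine ⟨hi', ?_⟩
  have hint : ∫ w, errVI X F (mmpOutput X ω ω' G (stepsize L D σ τ T) 1 T x₀
        (fun n => Z n w) (fun t => J t w) T) ∂P
      = ∫ q, errVI a.X a.F (a.output q.1 q.2 T)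
        ∂((P.map fun w n => Z n w).prod (P.map fun w t => J t w)) := by
    rw [← hlaw, integral_map hpm.aemeasurable hm.aestronglyMeasurable]
    rfl
  have hT0 : (0 : ℝ) < T := by exact_mod_cast hT
  -- If `D = 0` the stepsize may vanish, but then `X` is a single point and the merit function is
  -- not positive.
  rcases hD0.eq_or_lt with rfl | hDpos
  · refine (integral_nonpos fun w => ?_).trans (by simp)
    exact errVI_nonpos_of_isLUB_zero hX hω hD
      (ha.output_mem (fun n => Z n w) (fun t => J t w) hT)
  obtain ⟨hγ, hγL, hγσ, hγT⟩ := stepsize_bounds hL hDpos hσ hτ hT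
  have hA : ∀ n : ℕ, ∑ t ∈ Finset.Icc 1 n, 2 * c * (1 / 2 : ℝ) ^ ((t : ℝ) / (τ : ℝ))
      ≤ 4 * |c| * τ := fun n => by
    rw [← Finset.mul_sum]
    have h1 := sum_half_rpow_div_le hτ n
    have h2 : 0 ≤ ∑ t ∈ Finset.Icc 1 n, (1 / 2 : ℝ) ^ ((t : ℝ) / (τ : ℝ)) :=
      Finset.sum_nonneg fun _ _ => by positivity
    have h3 := le_abs_self c
    have h4 := abs_nonneg c
    nlinarith
  have hmain := ha.integral_errVI_output_le (by change T ≠ 0; omega) hF hmono hγ hγL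
    (hZ.isDecorrelating hQ) hA (by positivity) hsm hJ.isGeomLevels hT hi
  rw [hint]
  refine hmain.trans ?_
  change 2 * D ^ 2 / (T * stepsize L D σ τ T) + stepsize L D σ τ T * (2 * (2 * σ ^ 2
    + 12 * (32 * ℓ * σ ^ 2 * (1 + 4 * |c| * τ)) * Nat.log 2 T) + 3 / 2 * σ ^ 2)
    + 2 * D * σ * min 1 (4 * |c| * τ / 2 ^ Nat.log 2 T) ≤ _
  set γ := stepsize L D σ τ T
  set m : ℝ := (Nat.log 2 T : ℝ)
  have hm0 : 0 ≤ m := Nat.cast_nonneg _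
  set b := |c|
  have hb : 0 ≤ b := abs_nonneg c
  have hτ1 : (1 : ℝ) ≤ τ := by exact_mod_cast hτ
  set U := D * σ * Real.sqrt τ / Real.sqrt T with hU
  have hU0 : 0 ≤ U := by positivity
  have h3 : 2 * D * σ * min 1 (4 * b * τ / 2 ^ Nat.log 2 T) ≤ (1 + 8 * b) * U := by
    have := mul_le_mul_of_nonneg_left (min_one_div_le_sqrt hb (τ := τ) hT)
      (mul_nonneg hD0 hσ)
    rw [hU]
    calc _ = D * σ * (2 * min 1 (4 * b * τ / 2 ^ Nat.log 2 T)) := by ring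
      _ ≤ _ := this
      _ = _ := by ring
  -- `768 = 2 · 12 · 32`; the remaining `11/2 · σ²` is covered by the `1` in `1 + m`.
  have h2 : γ * (2 * (2 * σ ^ 2 + 12 * (32 * ℓ * σ ^ 2 * (1 + 4 * b * τ)) * m)
      + 3 / 2 * σ ^ 2) ≤ 768 * (1 + 4 * b) * ℓ * (1 + m) * U := by
    have e1 : 2 * (2 * σ ^ 2 + 12 * (32 * ℓ * σ ^ 2 * (1 + 4 * b * τ)) * m) + 3 / 2 * σ ^ 2
        ≤ 768 * (1 + 4 * b) * ℓ * (1 + m) * (σ ^ 2 * τ) := by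
      have e2 : 1 + 4 * b * τ ≤ (1 + 4 * b) * τ := by nlinarith
      have e3 : σ ^ 2 * (1 + 4 * b * τ) ≤ (1 + 4 * b) * (σ ^ 2 * τ) := by
        nlinarith [mul_le_mul_of_nonneg_left e2 (sq_nonneg σ)]
      have e4 : ℓ * m * (σ ^ 2 * (1 + 4 * b * τ)) ≤ ℓ * m * ((1 + 4 * b) * (σ ^ 2 * τ)) := by
        gcongr
      have e5 : σ ^ 2 ≤ (1 + 4 * b) * (σ ^ 2 * τ) := by
        have : 0 ≤ σ ^ 2 * (4 * b * τ) := by positivity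
        linarith
      have e6 : (1 + 4 * b) * (σ ^ 2 * τ) ≤ ℓ * ((1 + 4 * b) * (σ ^ 2 * τ)) :=
        le_mul_of_one_le_left (by positivity) hℓ
      have e7 : 0 ≤ (1 + 4 * b) * (σ ^ 2 * τ) := by positivity
      linarith
    calc _ ≤ γ * (768 * (1 + 4 * b) * ℓ * (1 + m) * (σ ^ 2 * τ)) := by gcongr
      _ = 768 * (1 + 4 * b) * ℓ * (1 + m) * (γ * (σ ^ 2 * τ)) := by ring
      _ ≤ _ := by gcongr
  -- `2U` comes from the stepsize bound on `2D²/(Tγ)` and `(1 + 8b)U` from the bias.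
  have h4 : (3 + 8 * b) * U ≤ 3 * (1 + 4 * b) * ℓ * (1 + m) * U := by
    have e1 : 1 ≤ ℓ * (1 + m) := by nlinarith
    have e2 : 3 + 8 * b ≤ 3 * (1 + 4 * b) := by linarith
    have e3 : 3 * (1 + 4 * b) ≤ 3 * (1 + 4 * b) * (ℓ * (1 + m)) :=
      le_mul_of_one_le_right (by positivity) e1
    have e4 : (3 + 8 * b) * U ≤ (3 * (1 + 4 * b) * (ℓ * (1 + m))) * U := by
      gcongr
      linarith
    linarith
  linarith

end ExpectedError

/-! ### Expected number of oracle calls. -/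

section OracleCalls

variable {Ω : Type*} [MeasurableSpace Ω]

/-- The `2` covers the half step and the single call of a rejected level. An accepted level `k` adds
`2^k`, and thus `1` in expectation. -/
lemma oracleCalls_le {M : ℕ} (hM : M ≠ 0) (j : ℕ → ℕ) (T : ℕ) :
    (oracleCalls 1 M j T : ℝ) ≤ ∑ t ∈ Finset.range (T + 1),
      (2 + ∑ k ∈ Finset.Icc 1 (Nat.log 2 M), if j t = k then (2 : ℝ) ^ k else 0) := by
  rw [oracleCalls, Nat.cast_sum]
  refine Finset.sum_le_sum fun t _ => ?_
  rw [Finset.sum_ite_eq]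
  have h1 : 2 ^ j t ≤ M ↔ j t ≤ Nat.log 2 M := (Nat.le_log_iff_pow_le one_lt_two hM).symm
  rcases Nat.eq_zero_or_pos (j t) with h0 | h0
  · simp [h0, Nat.one_le_iff_ne_zero, hM]
  · simp only [Finset.mem_Icc, h1]
    by_cases h2 : j t ≤ Nat.log 2 M
    · simp [h2, Nat.one_le_iff_ne_zero, h0.ne']
    · simp [h2]

lemma lintegral_oracleCalls_le {P : Measure Ω} [IsProbabilityMeasure P] {J : ℕ → Ω → ℕ}
    (hJ : IsIIDGeomHalf P J) {M : ℕ} (hM : M ≠ 0) (T : ℕ) :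
    ∫⁻ w, (oracleCalls 1 M (fun t => J t w) T : ℝ≥0∞) ∂P
      ≤ ENNReal.ofReal ((T + 1) * (2 + Nat.log 2 M)) := by
  have hset : ∀ t k, MeasurableSet {w | J t w = k} := fun t k =>
    measurableSet_eq_fun (hJ.measurable t) measurable_const
  have e : ∀ t k, (fun w => if J t w = k then (2 : ℝ) ^ k else 0)
      = {w | J t w = k}.indicator fun _ => (2 : ℝ) ^ k := fun t k => by
    funext w
    simp [Set.indicator_apply]
  have hint : ∀ t k, Integrable (fun w => if J t w = k then (2 : ℝ) ^ k else 0) P :=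
    fun t k => by
      rw [e]
      exact (integrable_const _).indicator (hset t k)
  have hint2 : ∀ t, Integrable (fun w => 2 + ∑ k ∈ Finset.Icc 1 (Nat.log 2 M),
      if J t w = k then (2 : ℝ) ^ k else 0) P := fun t =>
    (integrable_const _).add (integrable_finsetSum _ fun k _ => hint t k)
  calc ∫⁻ w, (oracleCalls 1 M (fun t => J t w) T : ℝ≥0∞) ∂P
      ≤ ∫⁻ w, ENNReal.ofReal (∑ t ∈ Finset.range (T + 1),
        (2 + ∑ k ∈ Finset.Icc 1 (Nat.log 2 M), if J t w = k then (2 : ℝ) ^ k else 0)) ∂P := by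
        refine lintegral_mono fun w => ?_
        rw [← ENNReal.ofReal_natCast]
        exact ENNReal.ofReal_le_ofReal (oracleCalls_le hM _ T)
    _ = ENNReal.ofReal (∫ w, (∑ t ∈ Finset.range (T + 1),
        (2 + ∑ k ∈ Finset.Icc 1 (Nat.log 2 M), if J t w = k then (2 : ℝ) ^ k else 0)) ∂P) := by
        rw [ofReal_integral_eq_lintegral_ofReal (integrable_finsetSum _ fun t _ => hint2 t)]
        exact Eventually.of_forall fun w => Finset.sum_nonneg fun t _ =>
          add_nonneg zero_le_two (Finset.sum_nonneg fun k _ => by positivity)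
    _ = ENNReal.ofReal ((T + 1) * (2 + Nat.log 2 M)) := by
        congr 1
        rw [integral_finsetSum _ fun t _ => hint2 t]
        have : ∀ t, ∫ w, (2 + ∑ k ∈ Finset.Icc 1 (Nat.log 2 M),
            if J t w = k then (2 : ℝ) ^ k else 0) ∂P = 2 + Nat.log 2 M := fun t => by
          rw [integral_add (integrable_const _) (integrable_finsetSum _ fun k _ => hint t k),
            integral_finsetSum _ fun k _ => hint t k]
          have h1 : ∀ k ∈ Finset.Icc 1 (Nat.log 2 M),
              ∫ w, (if J t w = k then (2 : ℝ) ^ k else 0) ∂P = 1 := fun k hk => by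
            rw [e, integral_indicator_const _ (hset t k), hJ.law t k (Finset.mem_Icc.1 hk).1,
              smul_eq_mul, ← mul_pow]
            norm_num
          rw [Finset.sum_congr rfl h1]
          simp
        simp only [this]
        rw [Finset.sum_const, Finset.card_range, nsmul_eq_mul]
        push_cast
        ring

end OracleCalls

/-! ### From the error bound to the number of iterations. -/

section Complexity

lemma natLog_two_le_log {T : ℕ} (hT : 1 ≤ T) : (Nat.log 2 T : ℝ) ≤ 2 * Real.log T := by
  have h1 : ((2 : ℝ) ^ Nat.log 2 T) ≤ T := by exact_mod_cast Nat.pow_log_le_self 2 (by omega)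
  have h2 := Real.log_le_log (by positivity) h1
  rw [Real.log_pow] at h2
  have h3 := Real.log_two_gt_d9
  have h4 : (0 : ℝ) ≤ Nat.log 2 T := Nat.cast_nonneg _
  nlinarith

/-- With `T ≥ (c Λ)^8 N` iterations the accuracy is reached. -/
lemma rate_le_one {C₁ N Λ ℓ T : ℝ} (hC₁ : 0 ≤ C₁) (hN : 1 ≤ N) (hΛ : 1 ≤ Λ) (hℓ : 0 ≤ ℓ)
    (hℓΛ : ℓ ≤ Λ) (hNΛ : Real.log N ≤ Λ) (hT : ((4 + 19 * C₁) * Λ) ^ 8 * N ≤ T) :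
    4 * N / T + C₁ * ℓ * (1 + 2 * Real.log T) * Real.sqrt (N / T) ≤ 1 := by
  have hN0 : 0 < N := by linarith
  set C₃ := 4 + 19 * C₁ with hC₃
  have hC₃4 : 4 ≤ C₃ := by linarith
  have hT0 : 0 < T := lt_of_lt_of_le (by positivity) hT
  -- In this unit `√(N/T) = u⁻⁴`, while `ℓ ≤ u` and `log T = log N + 8 log u ≤ Λ + 8u`. The two
  -- powers of `u` from `ℓ` and `log T` are dominated by `u⁴`.
  set u := (T / N) ^ (1 / 8 : ℝ) with hu
  have hu8 : u ^ 8 = T / N := by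
    rw [hu, ← Real.rpow_natCast, ← Real.rpow_mul (by positivity)]
    norm_num
  have hu0 : 0 < u := by positivity
  have huΛ : C₃ * Λ ≤ u := by
    refine le_of_pow_le_pow_left₀ (n := 8) (by norm_num) hu0.le ?_
    rw [hu8, le_div_iff₀ hN0]
    exact hT
  have hu1 : C₃ ≤ u := by nlinarith
  have hΛu : Λ ≤ u := by nlinarith
  have hNT : N / T = 1 / u ^ 8 := by rw [hu8, one_div_div]
  have hsqrt : Real.sqrt (N / T) = 1 / u ^ 4 := by
    rw [hNT, show 1 / u ^ 8 = (1 / u ^ 4) ^ 2 by ring, Real.sqrt_sq (by positivity)]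
  have hlog : Real.log T ≤ Λ + 8 * u := by
    have h1 : Real.log T = Real.log N + 8 * Real.log u := by
      have : T = N * u ^ 8 := by rw [hu8]; field_simp
      rw [this, Real.log_mul hN0.ne' (by positivity), Real.log_pow]
      norm_num
    have h2 : Real.log u ≤ u := (Real.log_le_sub_one_of_pos hu0).trans (by linarith)
    linarith
  have hnum : C₁ * ℓ * (1 + 2 * Real.log T) ≤ C₁ * (19 * u ^ 2) := by
    rw [mul_assoc]
    refine mul_le_mul_of_nonneg_left ?_ hC₁
    -- `19 = 1 + 2 + 16`, from `1 ≤ u` and `Λ ≤ u`.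
    have h1 : 1 + 2 * Real.log T ≤ 19 * u := by linarith
    calc ℓ * (1 + 2 * Real.log T) ≤ ℓ * (19 * u) := by gcongr
      _ ≤ u * (19 * u) := by gcongr; linarith
      _ = 19 * u ^ 2 := by ring
  have h1 : 4 * N / T ≤ 4 / u := by
    rw [mul_div_assoc, hNT, mul_one_div]
    gcongr
    exact le_self_pow₀ (by linarith) (by norm_num)
  have h2 : C₁ * ℓ * (1 + 2 * Real.log T) * Real.sqrt (N / T) ≤ 19 * C₁ / u := by
    rw [hsqrt]
    calc _ ≤ C₁ * (19 * u ^ 2) * (1 / u ^ 4) := by gcongr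
      _ = 19 * C₁ / u ^ 2 := by field_simp
      _ ≤ 19 * C₁ / u := by
        gcongr
        exact le_self_pow₀ (by linarith) (by norm_num)
  have h3 : 4 / u + 19 * C₁ / u ≤ 1 := by
    rw [← add_div, div_le_one hu0]
    linarith
  linarith

/-- Take the ceiling of the threshold `(C₃ Λ)^8 N`. The ninth power of `Λ` pays for the factor `2 +
log₂ T₀` in the oracle calls, through `log (Λ^8 N) ≤ 9Λ`. -/
lemma exists_iterations {C₃ N Λ : ℝ} (hC₃ : 4 ≤ C₃) (hN : 1 ≤ N) (hΛ : 1 ≤ Λ)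
    (hNΛ : Real.log N ≤ Λ) : ∃ T₀ : ℕ, 1 ≤ T₀ ∧ (C₃ * Λ) ^ 8 * N ≤ T₀ ∧
      (T₀ : ℝ) ≤ 4 * C₃ ^ 8 * (20 + 2 * Real.log (2 * C₃ ^ 8)) * Λ ^ 9 * N ∧
      ((T₀ : ℝ) + 1) * (2 + Nat.log 2 T₀)
        ≤ 4 * C₃ ^ 8 * (20 + 2 * Real.log (2 * C₃ ^ 8)) * Λ ^ 9 * N := by
  set B := (C₃ * Λ) ^ 8 * N with hB
  have h1 : 1 ≤ (C₃ * Λ) ^ 8 := one_le_pow₀ (by nlinarith)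
  have hB1 : 1 ≤ B := by nlinarith
  have hc0 : 1 ≤ C₃ ^ 8 := one_le_pow₀ (by linarith)
  have hlogc : 0 ≤ Real.log (2 * C₃ ^ 8) := Real.log_nonneg (by linarith)
  have hle : B ≤ (⌈B⌉₊ : ℝ) := Nat.le_ceil B
  have hT1 : 1 ≤ ⌈B⌉₊ := Nat.one_le_ceil_iff.2 (by linarith)
  have hlt : (⌈B⌉₊ : ℝ) ≤ 2 * B := by
    have := Nat.ceil_lt_add_one (by linarith : 0 ≤ B)
    linarith
  have hB2 : B = C₃ ^ 8 * Λ ^ 8 * N := by rw [hB, mul_pow]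
  have hmain : ((⌈B⌉₊ : ℝ) + 1) * (2 + Nat.log 2 ⌈B⌉₊)
      ≤ 4 * C₃ ^ 8 * (20 + 2 * Real.log (2 * C₃ ^ 8)) * Λ ^ 9 * N := by
    have hlog : Real.log (⌈B⌉₊ : ℝ) ≤ Real.log (2 * C₃ ^ 8) + 9 * Λ := by
      have e : 2 * B = 2 * C₃ ^ 8 * (Λ ^ 8 * N) := by rw [hB2]; ring
      have h2 : Real.log (⌈B⌉₊ : ℝ) ≤ Real.log (2 * B) :=
        Real.log_le_log (by linarith) hlt
      rw [e, Real.log_mul (by positivity) (by positivity), Real.log_mul (x := Λ ^ 8)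
        (by positivity) (by positivity), Real.log_pow] at h2
      have h3 : Real.log Λ ≤ Λ := (Real.log_le_sub_one_of_pos (by linarith)).trans (by linarith)
      push_cast at h2
      linarith
    have hm := natLog_two_le_log hT1
    have h2 : (2 + Nat.log 2 ⌈B⌉₊ : ℝ) ≤ (20 + 2 * Real.log (2 * C₃ ^ 8)) * Λ := by
      nlinarith
    calc ((⌈B⌉₊ : ℝ) + 1) * (2 + Nat.log 2 ⌈B⌉₊)
        ≤ (4 * B) * ((20 + 2 * Real.log (2 * C₃ ^ 8)) * Λ) := by
          gcongr
          linarith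
      _ = _ := by rw [hB2]; ring
  refine ⟨⌈B⌉₊, hT1, hle, le_trans ?_ hmain, hmain⟩
  have h0 : (0 : ℝ) ≤ Nat.log 2 ⌈B⌉₊ := Nat.cast_nonneg _
  have h2 : (0 : ℝ) ≤ (⌈B⌉₊ : ℝ) := Nat.cast_nonneg _
  nlinarith

end Complexity

end MarkovMirrorProx

/-! ### Assembly. -/

theorem corollary4 (c : ℝ) :
    ∃ (C : ℝ) (k : ℕ), 0 < C ∧
    -- the space `ℝ^d` with the norm `‖·‖_p`, and the compact convex set
    ∀ (d : ℕ) (p : ℝ≥0∞) [Fact (1 ≤ p)], p ≤ 2 →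
    ∀ (X : Set (PiLp p fun _ : Fin d => ℝ)), IsCompact X → Convex ℝ X →
    -- the Bregman divergence
    ∀ (ω : (PiLp p fun _ : Fin d => ℝ) → ℝ)
      (ω' : (PiLp p fun _ : Fin d => ℝ) → StrongDual ℝ (PiLp p fun _ : Fin d => ℝ)),
      MarkovMirrorProx.IsDistanceGenerating X ω ω' →
    ∀ D : ℝ, 0 ≤ D → IsLUB (MarkovMirrorProx.bregmanValues X ω ω') (D ^ 2) →
    ∀ x₀ ∈ MarkovMirrorProx.subdiffDomain X ω,
    -- the state space, the ergodic kernel, the stationary chain and the batch levels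
    ∀ {S : Type*} [MetricSpace S] [CompleteSpace S] [SecondCountableTopology S]
      [MeasurableSpace S] [BorelSpace S]
      (Q : Kernel S S) [IsMarkovKernel Q] (π : Measure S) [IsProbabilityMeasure π]
      (τ : ℕ), 1 ≤ τ → MarkovMirrorProx.IsUniformlyErgodic Q π τ c →
    ∀ {Ω : Type*} [MeasurableSpace Ω] (P : Measure Ω) [IsProbabilityMeasure P]
      (Z : ℕ → Ω → S) (J : ℕ → Ω → ℕ),
      MarkovMirrorProx.IsMarkovChain Q π P Z → MarkovMirrorProx.IsIIDGeomHalf P J →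
      IndepFun (fun w n => Z n w) (fun w t => J t w) P →
    -- the operator, Lipschitz and monotone on `X`
    ∀ (F : (PiLp p fun _ : Fin d => ℝ) → StrongDual ℝ (PiLp p fun _ : Fin d => ℝ))
      (L : ℝ), 0 < L →
      (∀ x ∈ X, ∀ y ∈ X, ‖F x - F y‖ ≤ L * ‖x - y‖) →
      (∀ x ∈ X, ∀ y ∈ X, 0 ≤ (F x - F y) (x - y)) →
    -- the stochastic oracle, unbiased under `π` and with uniformly bounded noise
    ∀ (G : (PiLp p fun _ : Fin d => ℝ) → S → StrongDual ℝ (PiLp p fun _ : Fin d => ℝ))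
      (σ : ℝ), 0 ≤ σ →
      Measurable (Function.uncurry G) →
      (∀ x ∈ X, ∫ z, G x z ∂π = F x) →
      (∀ x ∈ X, ∀ z, ‖G x z - F x‖ ^ 2 ≤ σ ^ 2) →
    ∀ ε : ℝ, 0 < ε →
    ∃ T₀ : ℕ, 1 ≤ T₀ ∧
      -- number of iterations
      (T₀ : ℝ) ≤ C * MarkovMirrorProx.logFactor p d (MarkovMirrorProx.complexity L D σ ε τ) ^ k *
        max 1 (MarkovMirrorProx.complexity L D σ ε τ) ∧
      -- expected number of oracle calls
      ∫⁻ w, (MarkovMirrorProx.oracleCalls 1 T₀ (fun t => J t w) T₀ : ℝ≥0∞) ∂P ≤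
        ENNReal.ofReal
          (C * MarkovMirrorProx.logFactor p d (MarkovMirrorProx.complexity L D σ ε τ) ^ k *
            max 1 (MarkovMirrorProx.complexity L D σ ε τ)) ∧
      -- accuracy after `T` iterations
      ∀ T : ℕ, T₀ ≤ T →
        Integrable (fun w => MarkovMirrorProx.errVI X F
          (MarkovMirrorProx.mmpOutput X ω ω' G (MarkovMirrorProx.stepsize L D σ τ T) 1 T x₀
            (fun n => Z n w) (fun t => J t w) T)) P ∧
        ∫ w, MarkovMirrorProx.errVI X F
          (MarkovMirrorProx.mmpOutput X ω ω' G (MarkovMirrorProx.stepsize L D σ τ T) 1 T x₀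
            (fun n => Z n w) (fun t => J t w) T) ∂P ≤ ε := by
  set C₁ := 771 * (1 + 4 * |c|) with hC₁
  have hC₁0 : 0 ≤ C₁ := by positivity
  -- `C₁` is the constant of `expected_errVI_le` and `C₃` the one for which `rate_le_one` holds;
  -- both depend on `c` only.
  set C₃ := 4 + 19 * C₁ with hC₃
  have hC₃4 : 4 ≤ C₃ := by linarith
  have hlogC : 0 ≤ Real.log (2 * C₃ ^ 8) :=
    Real.log_nonneg (by linarith [one_le_pow₀ (n := 8) (by linarith : 1 ≤ C₃)])
  refine ⟨4 * C₃ ^ 8 * (20 + 2 * Real.log (2 * C₃ ^ 8)), 9, by positivity, ?_⟩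
  intro d p _ hp X hX _ ω ω' hω D hD0 hD x₀ hx₀ S _ _ _ _ _ Q _ π _ τ hτ hQ Ω _ P _ Z J hZ hJ
    hZJ F L hL hF hmono G σ hσ hGm hGmean hGσ ε hε
  set R := MarkovMirrorProx.complexity L D σ ε τ with hR
  set ℓ : ℝ := if p = 2 then 1 else Real.log (d + 3) with hℓ
  have hR1 : L * D ^ 2 / ε ≤ R := le_max_left _ _
  have hR2 : τ * D ^ 2 * σ ^ 2 / ε ^ 2 ≤ R := le_max_right _ _
  have hR0 : 0 ≤ R := le_trans (by positivity) hR1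
  have hlogR := MarkovMirrorProx.one_lt_log_add_three hR0
  have hℓ1 : 1 ≤ ℓ := by
    rw [hℓ]
    split_ifs
    · exact le_rfl
    · exact (MarkovMirrorProx.one_lt_log_add_three (Nat.cast_nonneg d)).le
  have hΛ : MarkovMirrorProx.logFactor p d R = Real.log (R + 3) * ℓ := rfl
  set Λ := MarkovMirrorProx.logFactor p d R
  have hΛ1 : 1 ≤ Λ := by nlinarith
  have hℓΛ : ℓ ≤ Λ := by nlinarith
  set N := max 1 R with hN
  have hN1 : 1 ≤ N := le_max_left _ _
  have hRN : R ≤ N := le_max_right _ _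
  have hNΛ : Real.log N ≤ Λ := by
    have h1 : Real.log N ≤ Real.log (R + 3) :=
      Real.log_le_log (by linarith) (max_le (by linarith) (by linarith))
    nlinarith
  have hG : MarkovMirrorProx.IsOracle X F G π σ := ⟨hGm, hGmean, fun x hx s =>
    le_of_sq_le_sq (hGσ x hx s) hσ⟩
  obtain ⟨T₀, hT₀, hBT₀, hT₀C, hcalls⟩ :=
    MarkovMirrorProx.exists_iterations hC₃4 hN1 hΛ1 hNΛ
  refine ⟨T₀, hT₀, hT₀C, ?_, fun T hT => ?_⟩
  · exact (MarkovMirrorProx.lintegral_oracleCalls_le hJ (by omega) T₀).trans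
      (ENNReal.ofReal_le_ofReal hcalls)
  have hT1 : 1 ≤ T := hT₀.trans hT
  have hT0 : (0 : ℝ) < T := by exact_mod_cast hT1
  obtain ⟨hint, herr⟩ := MarkovMirrorProx.expected_errVI_le hX hω hD0 hD hx₀ hτ hQ hZ hJ hZJ hL
    hF hmono hσ hG hℓ1 (MarkovMirrorProx.hasSmoothPotential_dual_piLp hp) hT1
  refine ⟨hint, herr.trans ?_⟩
  have hrate := MarkovMirrorProx.rate_le_one hC₁0 hN1 hΛ1 (by linarith) hℓΛ hNΛ
    (hBT₀.trans (by exact_mod_cast hT : (T₀ : ℝ) ≤ T))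
  have h1 : 4 * (L * D ^ 2) / T ≤ ε * (4 * N / T) := by
    rw [div_le_iff₀ hε] at hR1
    rw [mul_div_assoc', div_le_div_iff_of_pos_right hT0]
    nlinarith
  -- Squared and multiplied by `T/ε²`, this is `τD²σ²/ε² ≤ N`.
  have h2 : D * σ * Real.sqrt τ / Real.sqrt T ≤ ε * Real.sqrt (N / T) := by
    rw [Real.sqrt_div (by linarith), mul_div_assoc']
    refine div_le_div_of_nonneg_right ?_ (Real.sqrt_nonneg _)
    refine le_of_sq_le_sq ?_ (by positivity)
    rw [div_le_iff₀ (by positivity)] at hR2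
    rw [mul_pow, mul_pow, mul_pow, Real.sq_sqrt (by positivity), Real.sq_sqrt (by linarith)]
    nlinarith [sq_nonneg ε]
  have h3 := MarkovMirrorProx.natLog_two_le_log hT1
  calc _ ≤ ε * (4 * N / T) + C₁ * ℓ * (1 + 2 * Real.log T) * (ε * Real.sqrt (N / T)) := by
        gcongr
    _ = ε * (4 * N / T + C₁ * ℓ * (1 + 2 * Real.log T) * Real.sqrt (N / T)) := by ring
    _ ≤ ε := mul_le_of_le_one_right hε.le hrate
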